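/- Let $\gamma\ge 1$. For $0<v_+<v_0<1$ put $$a=v_+^{\gamma}\,\frac{1-v_+}{1-v_+^{\gamma}},\qquad h(v)=-v^{\gamma+1}+a(\gamma-1)+(a+1)v^{\gamma},\qquad f(v)=v-v^{-\gamma}h(v).$$ A *compressive inflow boundary layer* with boundary value $v_0$ and end state $v_+$ (of the isentropic Navier–Stokes equations with $\gamma$-law pressure, in rescaled pseudo-Lagrangian coordinates) is the restriction to $x\ge 0$ of a positive solution $\hat v$ on $\mathbb R$ of $$\hat v'=\hat v\big(\hat v-1+a(\hat v^{-\gamma}-1)\big),\qquad \hat v(0)=v_0,\qquad \lim_{x\to+\infty}\hat v(x)=v_+,\qquad \lim_{x\to-\infty}\hat v(x)=1 .$$ A number $\lambda\in\mathbb C$ is an *eigenvalue* of the linearized operator about the layer if there is a nontrivial solution $(v,u)$ on $x\ge 0$ of $$\lambda v+v'-u'=0,\qquad \lambda u+u'-\Big(\frac{h(\hat v)}{\hat v^{\gamma+1}}\,v\Big)'=\Big(\frac{u'}{\hat v}\Big)',\qquad (v,u)(0)=(0,0),\qquad \lim_{x\to+\infty}(v,u)(x)=(0,0).$$ Written as a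 first-order system in $W=(w,u-v,v)^T$, $w=\frac{u'}{\hat v}+\frac{h(\hat v)}{\hat v^{\gamma+1}}v-u$, the eigenvalue equation is $W'=A(x,\lambda)W$ with $$A(x,\lambda)=\begin{pmatrix}0&\lambda&\lambda\\0&0&\lambda\\ \hat v(x)&\hat v(x)&f(\hat v(x))-\lambda\end{pmatrix},\qquad A_+(\lambda)=\lim_{x\to+\infty}A(x,\lambda).$$ Let $\tilde V(\lambda)\neq 0$ be an eigenvector of $-A_+(\lambda)^*$, with eigenvalue $\tilde\mu(\lambda)$, chosen so that $\overline{\tilde V(\lambda)}$ is analytic in $\lambda$ on the closed half plane $\operatorname{Re}\lambda\ge 0$ and $\operatorname{Re}\tilde\mu(\lambda)<0$ for $\lambda\ne0$ there; let $\widetilde W(x,\lambda)$, $x\ge 0$, be the solution of the adjoint equation $\widetilde W'=-A(x,\lambda)^*\widetilde W$ with $e^{-\tilde\mu(\lambda)x}\,\widetilde W(x,\lambda)\to\tilde V(\lambda)$ as $x\to+\infty$. The *Evans function* of the layer, defined up to the normalization of $\tilde V$, is $$D_{\rm in}(\lambda)=(1,0,0)^T\cdot\overline{\widetilde W(0,\lambda)}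 ,\qquad \operatorname{Re}\lambda\ge 0 .$$ **Theorem.** For every $\gamma\ge 1$ there is $\varepsilon>0$, depending only on $\gamma$, such that every compressive inflow boundary layer with $v_0<\varepsilon$ (and any $0<v_+<v_0$) is spectrally stable: the Evans function $D_{\rm in}$ exists and, for every such normalization, has no zeros on $\operatorname{Re}\lambda\ge 0$; and the linearized operator about the layer has no eigenvalues $\lambda$ with $\operatorname{Re}\lambda\ge 0$. -/

import Mathlib

open Filter Topology Matrix

noncomputable section

namespace BoundaryLayer

/-- The rescaled pressure coefficient `a = v₊^γ (1 - v₊) / (1 - v₊^γ)`, determined by the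
end states `v₋ = 1` and `v₊` (Rankine-Hugoniot relation). -/
def pressureCoeff (γ vp : ℝ) : ℝ := vp ^ γ * ((1 - vp) / (1 - vp ^ γ))

/-- The right-hand side `H(v) = v (v - 1 + a (v^{-γ} - 1))` of the profile equation. -/
def profileRHS (γ vp s : ℝ) : ℝ :=
  s * (s - 1 + pressureCoeff γ vp * (s ^ (-γ) - 1))

/-- `h(v) = -v^{γ+1} + a (γ - 1) + (a + 1) v^γ`. -/
def hFun (γ vp s : ℝ) : ℝ :=
  -s ^ (γ + 1) + pressureCoeff γ vp * (γ - 1) + (pressureCoeff γ vp + 1) * s ^ γ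

/-- `f(v) = v - v^{-γ} h(v)`. -/
def fFun (γ vp s : ℝ) : ℝ := s - s ^ (-γ) * hFun γ vp s

/-- `vhat` is the (specific volume) profile of the compressive inflow boundary layer with boundary
value `v₀` and end state `v₊`. The layer lives on `x ≥ 0`; being compressive, it continues to a
solution of the profile equation on the whole line, with limit `v₋ = 1` at `-∞`. -/
structure IsCompressiveInflowLayer (γ vp v0 : ℝ) (vhat : ℝ → ℝ) : Prop where
  vp_pos : 0 < vp
  vp_lt_v0 : vp < v0
  v0_lt_one : v0 < 1
  pos : ∀ x, 0 < vhat x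
  ode : ∀ x, HasDerivAt vhat (profileRHS γ vp (vhat x)) x
  at_zero : vhat 0 = v0
  at_top : Tendsto vhat atTop (𝓝 vp)
  at_bot : Tendsto vhat atBot (𝓝 1)

/-- The coefficient matrix of the first-order eigenvalue system `W' = A(x, z) W`, where
`W = (w, u - v, v)`, as a function of the value `s` of the profile. The matrix `A(x, z)` is obtained
for `s = vhat x`, and the limiting matrix `A₊(z)` for `s = v₊`. -/
def evansMatrix (γ vp s : ℝ) (z : ℂ) : Matrix (Fin 3) (Fin 3) ℂ :=
  !![0, z, z;
     0, 0, z;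
     (s : ℂ), (s : ℂ), (fFun γ vp s : ℂ) - z]

/-- `W` solves the adjoint eigenvalue equation `W' = -A(x, z)^* W` on `x ≥ 0`. -/
def IsAdjointSolution (γ vp : ℝ) (vhat : ℝ → ℝ) (z : ℂ) (W : ℝ → Fin 3 → ℂ) : Prop :=
  ∀ x : ℝ, 0 ≤ x →
    HasDerivWithinAt W (-(evansMatrix γ vp (vhat x) z)ᴴ *ᵥ W x) (Set.Ici 0) x

/-- `V`, `μ` is a choice of the eigenvector and eigenvalue of `-A₊(z)^*` of the mode that decays at
`+∞`. The eigenvector is nonzero and its conjugate (a left eigenvector of `A₊(z)`) is analytic on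
the closed right half plane, including the point `z = 0`; there the eigenvalue is `0` and the
direction of the eigenvector is the limit of the decaying directions. -/
structure IsDecayingAdjointEigenpair (γ vp : ℝ) (μ : ℂ → ℂ) (V : ℂ → Fin 3 → ℂ) : Prop where
  analytic : AnalyticOnNhd ℂ (fun z => star (V z)) {z | 0 ≤ z.re}
  ne_zero : ∀ z : ℂ, 0 ≤ z.re → V z ≠ 0
  eigen : ∀ z : ℂ, 0 ≤ z.re → -(evansMatrix γ vp vp z)ᴴ *ᵥ V z = μ z • V z
  decaying : ∀ z : ℂ, 0 ≤ z.re → z ≠ 0 → (μ z).re < 0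

/-- `D` is an Evans function of the inflow problem: `D(z) = W₁⁰(0) · W₁⁺(0)` (Hermitian pairing,
conjugate in the second factor), where `W₁⁰(0) = (1, 0, 0)` and `W₁⁺` is the solution of the adjoint
eigenvalue equation which behaves like `e^{μ x} V` as `x → +∞`, for an eigenpair `(μ, V)` as above.
Different normalizations of `V` change `D` by a nonvanishing factor. -/
def IsInflowEvansFunction (γ vp : ℝ) (vhat : ℝ → ℝ) (D : ℂ → ℂ) : Prop :=
  ∃ (μ : ℂ → ℂ) (V : ℂ → Fin 3 → ℂ) (W : ℂ → ℝ → Fin 3 → ℂ),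
    IsDecayingAdjointEigenpair γ vp μ V ∧
    ∀ z : ℂ, 0 ≤ z.re →
      IsAdjointSolution γ vp vhat z (W z) ∧
      Tendsto (fun x : ℝ => Complex.exp (-(μ z * (x : ℂ))) • W z x) atTop (𝓝 (V z)) ∧
      D z = ![1, 0, 0] ⬝ᵥ star (W z 0)

/-- `z` is an eigenvalue of the linearized operator about the inflow layer: there is a nontrivial
solution `(v, u)` of
`z v + v' - u' = 0`, `z u + u' - (h(vhat) v / vhat^{γ+1})' = (u' / vhat)'` on `x ≥ 0`
with `(v, u)(0) = (0, 0)` and `(v, u)(+∞) = (0, 0)`. The function `du` is the derivative of `u`. -/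
def IsInflowEigenvalue (γ vp : ℝ) (vhat : ℝ → ℝ) (z : ℂ) : Prop :=
  ∃ v u du : ℝ → ℂ,
    (∃ x : ℝ, 0 ≤ x ∧ (v x ≠ 0 ∨ u x ≠ 0)) ∧
    v 0 = 0 ∧ u 0 = 0 ∧
    Tendsto v atTop (𝓝 0) ∧ Tendsto u atTop (𝓝 0) ∧
    ∀ x : ℝ, 0 ≤ x →
      HasDerivWithinAt u (du x) (Set.Ici 0) x ∧
      HasDerivWithinAt v (du x - z * v x) (Set.Ici 0) x ∧
      HasDerivWithinAt
        (fun y => ((hFun γ vp (vhat y) / vhat y ^ (γ + 1) : ℝ) : ℂ) * v y + du y / (vhat y : ℂ))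
        (z * u x + du x) (Set.Ici 0) x

end BoundaryLayer

end

noncomputable section

namespace BoundaryLayer

/-! ### The layer profile: bounds on the coefficients that are uniform in the end state. -/

section Profile

variable {γ vp v0 : ℝ} {vhat : ℝ → ℝ}

/-! The conjugate `(p, q, r)` of an adjoint solution satisfies `p' = -v r`, `q' = -z p - v r`, `r' =
(z + F) r - z (p + q)` with `v = vhat` and `F = -f(vhat)`. For `z ≠ 0` a zero of the Evans function
means `p 0 = 0`, and an energy argument on this row system shows that a decaying solution with `p 0
= 0` is trivial (`exists_forall_rowSolution_eq_zero`).

The growth rate of `r` has real part at least `1/2`, so a decaying `r` is slaved to `p + q`: to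
leading order `r = K (p + q)`, where `K` is the bounded solution of `K' = (z + F) K - z`, and `Re K
> 0` (`exists_response_function`). Hence `Re (q conj p)`, whose derivative is `-Re z |p|² - v Re (r
conj (p + q))`, nearly decreases. Two corrections make it a strict Lyapunov functional for small
`v`. A multiple of `Re (conj z (q - p) conj p)` supplies control of `|z|² |p|²` even on the
imaginary axis, and subtracting a multiple of `|d|²` controls the defect `d = r - K (p + q) + k K
p`, `k = z / (1 + z)`. Weighting by powers of `|z| / (1 + |z|)` makes `dissipation_pos` uniform from
`z` near `0` to `z` near infinity. The energy tends to `0` at infinity and is nonpositive at the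
boundary when `p 0 = 0`, so it vanishes identically and so does the solution. The smallness of `v`
depends only on bounds for `F` and `F'`, which depend only on `γ` because `a vhat^{-γ} ≤ 1` along
the layer.

At `z = 0` the third component vanishes and the first is constant, equal to that of the eigenvector,
which is nonzero (`at_zero`). Eigenvalues with `z ≠ 0` are excluded by pairing an eigenfunction with
the adjoint solution: the pairing is constant, tends to `0`, and equals `p 0 * w 0 ≠ 0` at the
boundary.

For existence, the left eigenvector of `A₊` is written `(1, ξ, m / v)`; then `z` is an explicit
rational function of `ξ`, which is inverted analytically on a half plane (`exists_analytic_ratio`).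
The solution with the prescribed asymptotics comes from a contraction in a weighted space after
triangularizing the limiting system (`exists_rowSolution`). -/

lemma pressureCoeff_pos (hγ : 1 ≤ γ) (h0 : 0 < vp) (h1 : vp < 1) : 0 < pressureCoeff γ vp := by
  have h := Real.rpow_lt_one h0.le h1 (by linarith : 0 < γ)
  exact mul_pos (Real.rpow_pos_of_pos h0 _) (div_pos (by linarith) (by linarith))

lemma pressureCoeff_le (hγ : 1 ≤ γ) (h0 : 0 < vp) (h1 : vp < 1) :
    pressureCoeff γ vp ≤ vp ^ γ := by
  have h := Real.rpow_lt_one h0.le h1 (by linarith : 0 < γ)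
  have h2 : vp ^ γ ≤ vp := by
    simpa using Real.rpow_le_rpow_of_exponent_ge h0 h1.le hγ
  have h3 : (1 - vp) / (1 - vp ^ γ) ≤ 1 := by
    rw [div_le_one (by linarith)]; linarith
  have := Real.rpow_pos_of_pos h0 γ
  unfold pressureCoeff
  nlinarith

/-- The scaled pressure `a s^{-γ}` is at most one to the right of the end state. -/
lemma pressureCoeff_mul_rpow_le_one (hγ : 1 ≤ γ) (h0 : 0 < vp) (h1 : vp < 1) {s : ℝ}
    (hs : vp ≤ s) : pressureCoeff γ vp * s ^ (-γ) ≤ 1 := by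
  have hs0 : 0 < s := h0.trans_le hs
  have h2 : vp ^ γ ≤ s ^ γ := Real.rpow_le_rpow h0.le hs (by linarith)
  have h3 : 0 < s ^ γ := Real.rpow_pos_of_pos hs0 _
  rw [Real.rpow_neg hs0.le, ← div_eq_mul_inv, div_le_one h3]
  exact (pressureCoeff_le hγ h0 h1).trans h2

lemma pressureCoeff_mul_rpow_nonneg (hγ : 1 ≤ γ) (h0 : 0 < vp) (h1 : vp < 1) {s : ℝ}
    (hs : 0 < s) : 0 ≤ pressureCoeff γ vp * s ^ (-γ) :=
  mul_nonneg (pressureCoeff_pos hγ h0 h1).le (Real.rpow_nonneg hs.le _)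

lemma fFun_eq {s : ℝ} (hs : 0 < s) :
    fFun γ vp s = 2 * s - 1 - pressureCoeff γ vp
      - (γ - 1) * (pressureCoeff γ vp * s ^ (-γ)) := by
  have h1 : s ^ (-γ) * s ^ (γ + 1) = s := by
    rw [← Real.rpow_add hs]; simp
  have h2 : s ^ (-γ) * s ^ γ = 1 := by
    rw [← Real.rpow_add hs]; simp
  unfold fFun hFun
  linear_combination h1 - (pressureCoeff γ vp + 1) * h2

lemma neg_fFun_ge (hγ : 1 ≤ γ) (h0 : 0 < vp) (h1 : vp < 1) {s : ℝ} (hs : vp ≤ s)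
    (hs' : s ≤ 1 / 4) : 1 / 2 ≤ -fFun γ vp s := by
  have hs0 : 0 < s := h0.trans_le hs
  have := pressureCoeff_mul_rpow_nonneg hγ h0 h1 hs0
  have := pressureCoeff_pos hγ h0 h1
  rw [fFun_eq hs0]
  nlinarith

lemma neg_fFun_le (hγ : 1 ≤ γ) (h0 : 0 < vp) (h1 : vp < 1) {s : ℝ} (hs : vp ≤ s) :
    -fFun γ vp s ≤ γ + 1 := by
  have hs0 : 0 < s := h0.trans_le hs
  have := pressureCoeff_mul_rpow_le_one hγ h0 h1 hs
  have := pressureCoeff_le hγ h0 h1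
  have := Real.rpow_le_one h0.le h1.le (by linarith : 0 ≤ γ)
  rw [fFun_eq hs0]
  nlinarith

lemma profileRHS_endState (h0 : 0 < vp) (h1 : vp < 1) (hγ : 1 ≤ γ) :
    vp - 1 + pressureCoeff γ vp * (vp ^ (-γ) - 1) = 0 := by
  have h := Real.rpow_lt_one h0.le h1 (by linarith : 0 < γ)
  have h3 : 0 < vp ^ γ := Real.rpow_pos_of_pos h0 _
  have h4 : 1 - vp ^ γ ≠ 0 := by linarith
  unfold pressureCoeff
  rw [Real.rpow_neg h0.le]
  field_simp
  ring

lemma strictConvexOn_profileRate (hγ : 1 ≤ γ) {a : ℝ} (ha : 0 < a) :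
    StrictConvexOn ℝ (Set.Ioi 0) (fun s : ℝ => s - 1 + a * (s ^ (-γ) - 1)) := by
  have hd : ∀ s : ℝ, 0 < s →
      HasDerivAt (fun s : ℝ => s - 1 + a * (s ^ (-γ) - 1)) (1 + a * (-γ * s ^ (-γ - 1))) s := by
    intro s hs
    have := (Real.hasDerivAt_rpow_const (x := s) (p := -γ) (Or.inl hs.ne'))
    exact ((hasDerivAt_id s).sub_const 1).add ((this.sub_const 1).const_mul a)
  refine StrictMonoOn.strictConvexOn_of_deriv (convex_Ioi 0)
    (fun s hs => (hd s hs).continuousAt.continuousWithinAt) ?_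
  rw [interior_Ioi]
  intro s hs t ht hst
  rw [(hd s hs).deriv, (hd t ht).deriv]
  have := Real.rpow_lt_rpow_of_neg hs hst (by linarith : -γ - 1 < 0)
  have h2 : 0 < a * γ := by positivity
  nlinarith

/-- The decay rate of the profile at the end state: the profile equation is `v' = v φ(v)` with `φ`
convex, so `φ` lies below its chord. -/
lemma exists_profileRate_le (hγ : 1 ≤ γ) (h0 : 0 < vp) (h01 : vp < v0) (h1 : v0 < 1) :
    ∃ c > 0, ∀ s, vp ≤ s → s ≤ v0 →
      s - 1 + pressureCoeff γ vp * (s ^ (-γ) - 1) ≤ -c * (s - vp) := by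
  have hvp1 : vp < 1 := h01.trans h1
  set φ : ℝ → ℝ := fun s => s - 1 + pressureCoeff γ vp * (s ^ (-γ) - 1) with hφ
  have hconv : StrictConvexOn ℝ (Set.Ioi 0) φ :=
    strictConvexOn_profileRate hγ (pressureCoeff_pos hγ h0 hvp1)
  have e0 : φ vp = 0 := profileRHS_endState h0 hvp1 hγ
  have e1 : φ 1 = 0 := by simp [hφ]
  -- The rate vanishes at both end states `vp` and `1`, so strict convexity makes it negative
  -- between them. The constant `c` is minus the slope of the chord from `vp` to `v0`.
  have hneg : φ v0 < 0 := by
    have := hconv.secant_strict_mono_aux1 (x := vp) (y := v0) (z := 1) h0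
      (by simp) h01 h1
    rw [e0, e1] at this
    nlinarith
  refine ⟨-φ v0 / (v0 - vp), div_pos (by linarith) (by linarith), fun s hs hs' => ?_⟩
  change φ s ≤ _
  have hd : 0 < v0 - vp := by linarith
  have e2 : -(-φ v0 / (v0 - vp)) * (s - vp) = φ v0 * (s - vp) / (v0 - vp) := by ring
  rw [e2, le_div_iff₀ hd]
  rcases hs.eq_or_lt with rfl | hs
  · simp [e0]
  rcases hs'.eq_or_lt with rfl | hs'
  · exact le_rfl
  · have := hconv.convexOn.secant_mono_aux1 (x := vp) (y := s) (z := v0) h0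
      (h0.trans h01) hs hs'
    rw [e0] at this
    nlinarith

lemma profileRHS_neg (hγ : 1 ≤ γ) (h0 : 0 < vp) (h01 : vp < v0) (h1 : v0 < 1) :
    profileRHS γ vp v0 < 0 := by
  obtain ⟨c, hc, h⟩ := exists_profileRate_le hγ h0 h01 h1
  have := h v0 h01.le le_rfl
  unfold profileRHS
  have h2 : 0 < c * (v0 - vp) := mul_pos hc (by linarith)
  exact mul_neg_of_pos_of_neg (by linarith) (by linarith)

namespace IsCompressiveInflowLayer

lemma continuous (h : IsCompressiveInflowLayer γ vp v0 vhat) : Continuous vhat :=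
  continuous_iff_continuousAt.2 fun x => (h.ode x).continuousAt

/-- The right-hand side of the profile equation is negative at `v0`, so this level is a barrier that
cannot be crossed upwards. -/
lemma le_boundary (hγ : 1 ≤ γ) (h : IsCompressiveInflowLayer γ vp v0 vhat) {x : ℝ}
    (hx : 0 ≤ x) : vhat x ≤ v0 := by
  refine image_le_of_deriv_right_lt_deriv_boundary (a := 0) (b := x) (B := fun _ => v0)
    (B' := fun _ => 0) (f' := fun y => profileRHS γ vp (vhat y))
    h.continuous.continuousOn (fun y _ => (h.ode y).hasDerivWithinAt) h.at_zero.le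
    (fun y => hasDerivAt_const y v0) ?_ ⟨hx, le_rfl⟩
  intro y _ hy
  rw [hy]
  exact profileRHS_neg hγ h.vp_pos h.vp_lt_v0 h.v0_lt_one

/-- The constant `vp` solves the same equation, so by backward uniqueness a layer that reached it
would already equal it at `0`. -/
lemma endState_lt (hγ : 1 ≤ γ) (h : IsCompressiveInflowLayer γ vp v0 vhat) {x : ℝ}
    (hx : 0 ≤ x) : vp < vhat x := by
  by_contra! hcon
  obtain ⟨y, hy, hyv⟩ : vp ∈ vhat '' Set.Icc 0 x :=
    intermediate_value_Icc' hx h.continuous.continuousOn ⟨hcon, by rw [h.at_zero]; exact h.vp_lt_v0.le⟩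
  -- The range over the compact interval stays away from `0`, where the right-hand side need not be
  -- Lipschitz.
  obtain ⟨m, hm, hmin⟩ := (isCompact_Icc (a := (0:ℝ)) (b := y)).exists_isMinOn ⟨0, by simp [hy.1]⟩
    h.continuous.continuousOn
  obtain ⟨M, hM, hmax⟩ := (isCompact_Icc (a := (0:ℝ)) (b := y)).exists_isMaxOn ⟨0, by simp [hy.1]⟩
    h.continuous.continuousOn
  have hmem : ∀ t ∈ Set.Icc 0 y, vhat t ∈ Set.Icc (vhat m) (vhat M) := fun t ht =>
    ⟨hmin ht, hmax ht⟩
  have hvpmem : vp ∈ Set.Icc (vhat m) (vhat M) := hyv ▸ hmem y ⟨hy.1, le_rfl⟩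
  have hCD : ContDiffOn ℝ 1 (profileRHS γ vp) (Set.Icc (vhat m) (vhat M)) := by
    have hne : ∀ t ∈ Set.Icc (vhat m) (vhat M), t ≠ 0 := fun t ht =>
      ((h.pos m).trans_le ht.1).ne'
    have h1 : ContDiffOn ℝ 1 (fun s : ℝ => s ^ (-γ)) (Set.Icc (vhat m) (vhat M)) :=
      contDiffOn_id.rpow_const_of_ne hne
    unfold profileRHS
    exact contDiffOn_id.mul ((contDiffOn_id.sub contDiffOn_const).add
      (contDiffOn_const.mul (h1.sub contDiffOn_const)))
  obtain ⟨K, hK⟩ := hCD.exists_lipschitzOnWith (by norm_num) (convex_Icc _ _) isCompact_Icc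
  have hcst : profileRHS γ vp vp = 0 := by
    unfold profileRHS
    rw [profileRHS_endState h.vp_pos (h.vp_lt_v0.trans h.v0_lt_one) hγ, mul_zero]
  have := ODE_solution_unique_of_mem_Icc_left (v := fun _ => profileRHS γ vp)
    (s := fun _ => Set.Icc (vhat m) (vhat M)) (K := K) (f := vhat) (g := fun _ => vp)
    (a := 0) (b := y) (fun _ _ => hK) h.continuous.continuousOn
    (fun t _ => (h.ode t).hasDerivWithinAt) (fun t ht => hmem t ⟨ht.1.le, ht.2⟩)
    continuousOn_const (fun t _ => by rw [hcst]; exact (hasDerivAt_const t vp).hasDerivWithinAt)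
    (fun t _ => hvpmem) hyv
  have h0 := this (x := 0) ⟨le_rfl, hy.1⟩
  rw [h.at_zero] at h0
  exact h.vp_lt_v0.ne' h0

lemma vp_lt_one (h : IsCompressiveInflowLayer γ vp v0 vhat) : vp < 1 :=
  h.vp_lt_v0.trans h.v0_lt_one

/-- The factor `vhat` of the profile equation absorbs one power of the singular `vhat^{-γ-1}`. Only
`a vhat^{-γ}` remains, which keeps this derivative bounded uniformly in `vp`. -/
lemma hasDerivAt_fFun (h : IsCompressiveInflowLayer γ vp v0 vhat) (x : ℝ) :
    HasDerivAt (fun x => fFun γ vp (vhat x))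
      ((2 * vhat x + γ * (γ - 1) * (pressureCoeff γ vp * vhat x ^ (-γ))) *
        (vhat x - 1 + pressureCoeff γ vp * (vhat x ^ (-γ) - 1))) x := by
  have h1 := (h.ode x).rpow_const (p := -γ) (Or.inl (h.pos x).ne')
  have h2 := (((h.ode x).const_mul 2).sub_const 1).sub_const (pressureCoeff γ vp)
  have h3 := h2.sub ((h1.const_mul (pressureCoeff γ vp)).const_mul (γ - 1))
  have e : (fun x => fFun γ vp (vhat x)) = fun x => 2 * vhat x - 1 - pressureCoeff γ vp
      - (γ - 1) * (pressureCoeff γ vp * vhat x ^ (-γ)) := funext fun x => fFun_eq (h.pos x)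
  rw [e]
  convert! h3 using 1
  have e2 : vhat x ^ (-γ - 1) * vhat x = vhat x ^ (-γ) := by
    conv_lhs => rw [← Real.rpow_add_one (h.pos x).ne']
    congr 1; ring
  unfold profileRHS
  linear_combination (-(γ - 1) * pressureCoeff γ vp * γ *
    (vhat x - 1 + pressureCoeff γ vp * (vhat x ^ (-γ) - 1))) * e2

lemma abs_deriv_fFun_le (hγ : 1 ≤ γ) (h : IsCompressiveInflowLayer γ vp v0 vhat)
    (hv0 : v0 ≤ 1 / 4) {x : ℝ} (hx : 0 ≤ x) :
    |(2 * vhat x + γ * (γ - 1) * (pressureCoeff γ vp * vhat x ^ (-γ))) *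
        (vhat x - 1 + pressureCoeff γ vp * (vhat x ^ (-γ) - 1))| ≤ 2 * (γ ^ 2 + 1) := by
  have h1 := pressureCoeff_mul_rpow_le_one hγ h.vp_pos h.vp_lt_one (h.endState_lt hγ hx).le
  have h2 := pressureCoeff_mul_rpow_nonneg hγ h.vp_pos h.vp_lt_one (h.pos x)
  have h3 := pressureCoeff_le hγ h.vp_pos h.vp_lt_one
  have h4 := Real.rpow_le_one h.vp_pos.le h.vp_lt_one.le (by linarith : 0 ≤ γ)
  have h5 := pressureCoeff_pos hγ h.vp_pos h.vp_lt_one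
  have h6 := h.le_boundary hγ hx
  have h7 := h.pos x
  set e := pressureCoeff γ vp * vhat x ^ (-γ) with he
  rw [abs_mul]
  have b1 : |2 * vhat x + γ * (γ - 1) * e| ≤ γ ^ 2 + 1 := by
    have : 0 ≤ γ * (γ - 1) := mul_nonneg (by linarith) (by linarith)
    rw [abs_of_nonneg (by positivity)]
    nlinarith
  have b2 : |vhat x - 1 + pressureCoeff γ vp * (vhat x ^ (-γ) - 1)| ≤ 2 := by
    rw [mul_sub, ← he, abs_le]
    constructor <;> linarith
  calc _ ≤ (γ ^ 2 + 1) * 2 := mul_le_mul b1 b2 (abs_nonneg _) (by positivity)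
    _ = _ := by ring

/-- The linear bound on the rate, multiplied by `vhat ≥ vp`, gives a Gronwall inequality. The
exponent depends on `vp` and `v0`; this is harmless, since the decay serves only the existence of
the Evans function and not the choice of `ε`. -/
lemma exists_exp_decay (hγ : 1 ≤ γ) (h : IsCompressiveInflowLayer γ vp v0 vhat) :
    ∃ ω > 0, ∀ x, 0 ≤ x → vhat x - vp ≤ Real.exp (-ω * x) := by
  obtain ⟨c, hc, hφ⟩ := exists_profileRate_le hγ h.vp_pos h.vp_lt_v0 h.v0_lt_one
  have hvp := h.vp_pos
  refine ⟨vp * c, mul_pos hvp hc, fun x hx => ?_⟩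
  have hd : ∀ y, HasDerivAt (fun y => (vhat y - vp) * Real.exp (vp * c * y))
      (profileRHS γ vp (vhat y) * Real.exp (vp * c * y) +
        (vhat y - vp) * (Real.exp (vp * c * y) * (vp * c * 1))) y := fun y =>
    ((h.ode y).sub_const vp).mul ((hasDerivAt_id y).const_mul (vp * c)).exp
  have hanti : AntitoneOn (fun y => (vhat y - vp) * Real.exp (vp * c * y)) (Set.Ici 0) := by
    refine antitoneOn_of_deriv_nonpos (convex_Ici 0)
      (fun y _ => (hd y).continuousAt.continuousWithinAt)
      (fun y _ => (hd y).differentiableAt.differentiableWithinAt) fun y hy => ?_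
    rw [interior_Ici] at hy
    have hy : 0 ≤ y := le_of_lt hy
    rw [(hd y).deriv]
    have h1 := hφ (vhat y) (h.endState_lt hγ hy).le (h.le_boundary hγ hy)
    have h2 := h.endState_lt hγ hy
    have h3 : profileRHS γ vp (vhat y) ≤ -(vp * c) * (vhat y - vp) := by
      unfold profileRHS
      have : vhat y * (vhat y - 1 + pressureCoeff γ vp * (vhat y ^ (-γ) - 1)) ≤
          vhat y * (-c * (vhat y - vp)) := mul_le_mul_of_nonneg_left h1 (h.pos y).le
      have h5 : 0 ≤ c * (vhat y - vp) := mul_nonneg hc.le (by linarith)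
      nlinarith
    have h4 := Real.exp_pos (vp * c * y)
    nlinarith
  have := hanti (Set.mem_Ici.2 le_rfl) (Set.mem_Ici.2 hx) hx
  simp only [h.at_zero, mul_zero, Real.exp_zero, mul_one] at this
  rw [neg_mul, Real.exp_neg, ← one_div, le_div_iff₀ (Real.exp_pos _)]
  have := h.v0_lt_one
  linarith

end IsCompressiveInflowLayer

end Profile

/-! ### The scalar equation `K' = (z + F) K - z` and its bounded solution. -/

section ScalarEquation

open MeasureTheory

lemma hasDerivAt_integral_Ioi {E : Type*} [NormedAddCommGroup E] [NormedSpace ℝ E]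
    [CompleteSpace E] {f : ℝ → E} (hf : Continuous f)
    (hi : ∀ x, IntegrableOn f (Set.Ioi x)) (x : ℝ) :
    HasDerivAt (fun x => ∫ y in Set.Ioi x, f y) (-f x) x := by
  have e : (fun x => ∫ y in Set.Ioi x, f y) =
      fun x => (∫ y in Set.Ioi 0, f y) - ∫ y in (0 : ℝ)..x, f y := by
    funext t
    rw [eq_sub_iff_add_eq, add_comm]
    exact intervalIntegral.integral_interval_add_Ioi' (hf.intervalIntegrable _ _) (hi t)
  rw [e]
  exact (hf.integral_hasStrictDerivAt 0 x).hasDerivAt.const_sub _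

variable {z : ℂ} {F : ℝ → ℝ} {F₀ F₁ : ℝ}

lemma mul_le_integral_of_le (hF : Continuous F) (hF₀ : ∀ x, 0 ≤ x → F₀ ≤ F x) {x y : ℝ}
    (hx : 0 ≤ x) (hxy : x ≤ y) :
    (∫ t in (0 : ℝ)..x, F t) + F₀ * (y - x) ≤ ∫ t in (0 : ℝ)..y, F t := by
  rw [← intervalIntegral.integral_add_adjacent_intervals (hF.intervalIntegrable 0 x)
    (hF.intervalIntegrable x y)]
  have : ∫ _ in x..y, F₀ ≤ ∫ t in x..y, F t :=
    intervalIntegral.integral_mono_on hxy (by simp) (hF.intervalIntegrable _ _)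
      fun t ht => hF₀ t (hx.trans ht.1)
  simp only [intervalIntegral.integral_const, smul_eq_mul] at this
  linarith

/-- A bounded solution of `e' = (z + F) e + g` with positive growth rate `Re z + F` is bounded
by the supremum of `|g| / (Re z + F)`. -/
lemma norm_le_of_bounded_solution (hz : 0 ≤ z.re) (hF : Continuous F) (hF0 : 0 < F₀)
    (hF₀ : ∀ x, 0 ≤ x → F₀ ≤ F x) {e g : ℝ → ℂ} {C G : ℝ}
    (he : ∀ x, 0 ≤ x → HasDerivWithinAt e ((z + F x) * e x + g x) (Set.Ici 0) x)
    (hb : ∀ x, 0 ≤ x → ‖e x‖ ≤ C) (hg : ∀ x, 0 ≤ x → ‖g x‖ ≤ G * (z.re + F x)) {x : ℝ}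
    (hx : 0 ≤ x) : ‖e x‖ ≤ G := by
  set Φ : ℝ → ℝ := fun x => ∫ t in (0 : ℝ)..x, F t with hΦ
  have hΦd : ∀ t, HasDerivAt Φ (F t) t := fun t => (hF.integral_hasStrictDerivAt 0 t).hasDerivAt
  set E : ℝ → ℝ := fun t => Real.exp (-(z.re * t + Φ t)) with hE
  have hEd : ∀ t, HasDerivAt E (-(z.re + F t) * E t) t := by
    intro t
    have := (((hasDerivAt_id t).const_mul z.re).add (hΦd t)).neg.exp
    convert! this using 1
    simp [E]; ring
  set ψ : ℝ → ℂ := fun t => e t * Complex.exp (-(z * t + Φ t)) with hψ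
  have hnorm : ∀ t : ℝ, ‖Complex.exp (-(z * t + Φ t))‖ = E t := by
    intro t
    rw [Complex.norm_exp]; simp [E]
  have hψd : ∀ t, 0 ≤ t →
      HasDerivWithinAt ψ (g t * Complex.exp (-(z * t + Φ t))) (Set.Ici 0) t := by
    intro t ht
    have h1 : HasDerivAt (fun t : ℝ => (t : ℂ)) 1 t := Complex.ofRealCLM.hasDerivAt
    have h2 := ((h1.const_mul z).add (hΦd t).ofReal_comp).neg.cexp
    convert! (he t ht).mul h2.hasDerivWithinAt using 1
    simp only [Pi.neg_apply, Pi.add_apply]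
    ring
  -- Variation of constants on `[x, T]`: the forcing contributes at most the integral of `G (Re z +
  -- F) E`, which is `G (E x - E T)`. The bounded end value carries the factor `E T`, which vanishes
  -- as `T → ∞`.
  have key : ∀ T, x ≤ T → ‖e x‖ * E x ≤ C * E T + G * (E x - E T) := by
    intro T hT
    have h1 := image_norm_le_of_norm_deriv_right_le_deriv_boundary (a := x) (b := T)
      (f := fun t => ψ t - ψ x) (f' := fun t => g t * Complex.exp (-(z * t + Φ t)))
      (B := fun t => G * (E x - E t)) (B' := fun t => G * (z.re + F t) * E t)
      (fun t ht => ((hψd t (hx.trans ht.1)).sub_const _).continuousWithinAt.mono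
        fun y hy => hx.trans hy.1)
      (fun t ht => ((hψd t (hx.trans ht.1)).sub_const _).mono
        (Set.Ici_subset_Ici.2 (hx.trans ht.1))) (by simp)
      (fun t => by
        convert! (((hEd t).const_sub (E x)).const_mul G) using 1
        ring)
      (fun t ht => by
        rw [norm_mul, hnorm]
        exact mul_le_mul_of_nonneg_right (hg t (hx.trans ht.1)) (Real.exp_pos _).le)
      (x := T) ⟨hT, le_rfl⟩
    have h2 : ‖ψ T‖ ≤ C * E T := by
      rw [hψ]; simp only [norm_mul, hnorm]
      exact mul_le_mul_of_nonneg_right (hb T (hx.trans hT)) (Real.exp_pos _).le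
    have h3 : ‖ψ x‖ = ‖e x‖ * E x := by
      rw [hψ]; simp only [norm_mul, hnorm]
    have h4 : ‖ψ x‖ ≤ ‖ψ T‖ + ‖ψ T - ψ x‖ := by
      have := norm_sub_le (ψ T) (ψ T - ψ x)
      simpa using this
    rw [← h3]; linarith
  have hlim : Tendsto E atTop (𝓝 0) := by
    refine Real.tendsto_exp_atBot.comp (tendsto_neg_atTop_atBot.comp ?_)
    refine tendsto_atTop_mono' atTop ?_ (tendsto_id.const_mul_atTop hF0)
    filter_upwards [eventually_ge_atTop 0] with t ht
    have := mul_le_integral_of_le hF hF₀ le_rfl ht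
    simp only [intervalIntegral.integral_same, sub_zero, zero_add] at this
    have h5 : 0 ≤ z.re * t := mul_nonneg hz ht
    simp only [id]; linarith
  have hl : ‖e x‖ * E x ≤ C * 0 + G * (E x - 0) :=
    ge_of_tendsto ((hlim.const_mul C).add ((hlim.const_sub (E x)).const_mul G))
      (by filter_upwards [eventually_ge_atTop x] with T hT using key T hT)
  have hpos : 0 < E x := Real.exp_pos _
  simp only [mul_zero, zero_add, sub_zero] at hl
  exact le_of_mul_le_mul_right hl hpos

/-- The bounded solution of `K' = (z + F) K - z`. -/
lemma exists_bounded_solution (hz : 0 ≤ z.re) (hF : Continuous F) (hF0 : 0 < F₀)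
    (hF₀ : ∀ x, 0 ≤ x → F₀ ≤ F x) :
    ∃ K : ℝ → ℂ, (∀ x, 0 ≤ x → HasDerivAt K ((z + F x) * K x - z) x) ∧
      ∃ C, ∀ x, 0 ≤ x → ‖K x‖ ≤ C := by
  set Φ : ℝ → ℝ := fun x => ∫ t in (0 : ℝ)..x, F t with hΦ
  have hΦd : ∀ t, HasDerivAt Φ (F t) t := fun t => (hF.integral_hasStrictDerivAt 0 t).hasDerivAt
  have hΦc : Continuous Φ := continuous_iff_continuousAt.2 fun t => (hΦd t).continuousAt
  set f : ℝ → ℂ := fun t => Complex.exp (-(z * t + Φ t)) with hf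
  have hfc : Continuous f := by fun_prop
  have hfn : ∀ x t, 0 ≤ x → x ≤ t →
      ‖f t‖ ≤ Real.exp (-(z.re * x + Φ x) + F₀ * x) * Real.exp (-F₀ * t) := by
    intro x t hx hxt
    rw [hf, Complex.norm_exp, ← Real.exp_add, Real.exp_le_exp]
    have := mul_le_integral_of_le hF hF₀ hx hxt
    have h2 : z.re * x ≤ z.re * t := mul_le_mul_of_nonneg_left hxt hz
    simp
    linarith
  have hint0 : ∀ x, 0 ≤ x → IntegrableOn f (Set.Ioi x) := fun x hx =>
    Integrable.mono' ((integrableOn_exp_mul_Ioi (by linarith : -F₀ < 0) x).const_mul _)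
      hfc.aestronglyMeasurable
      ((ae_restrict_iff' measurableSet_Ioi).2 (Eventually.of_forall fun t ht =>
        hfn x t hx (le_of_lt ht)))
  have hint : ∀ x, IntegrableOn f (Set.Ioi x) := by
    intro x
    rcases le_total 0 x with hx | hx
    · exact hint0 x hx
    · rw [← Set.Ioc_union_Ioi_eq_Ioi hx]
      exact ((hfc.integrableOn_Icc (a := x) (b := 0)).mono_set Set.Ioc_subset_Icc_self).union
        (hint0 0 le_rfl)
  have hJ := hasDerivAt_integral_Ioi hfc hint
  -- Integration from infinity selects the bounded solution; the integral converges because `Re z +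
  -- F` is bounded below by `F₀`.
  refine ⟨fun x => z * (Complex.exp (z * x + Φ x) * ∫ y in Set.Ioi x, f y), fun x hx => ?_,
    ‖z‖ / F₀, fun x hx => ?_⟩
  · have h1 : HasDerivAt (fun t : ℝ => (t : ℂ)) 1 x := Complex.ofRealCLM.hasDerivAt
    have h2 := ((h1.const_mul z).add (hΦd x).ofReal_comp).cexp
    convert! (h2.mul (hJ x)).const_mul z using 1
    have h3 : Complex.exp (z * x + Φ x) * f x = 1 := by
      rw [hf, ← Complex.exp_add]; simp
    simp only [Pi.add_apply]
    linear_combination z * h3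
  · rw [norm_mul, norm_mul, div_eq_mul_inv]
    refine mul_le_mul_of_nonneg_left ?_ (norm_nonneg _)
    have h1 : ‖∫ y in Set.Ioi x, f y‖ ≤
        ∫ t in Set.Ioi x, Real.exp (-(z.re * x + Φ x) + F₀ * x) * Real.exp (-F₀ * t) :=
      norm_integral_le_of_norm_le ((integrableOn_exp_mul_Ioi (by linarith : -F₀ < 0) x).const_mul _)
        ((ae_restrict_iff' measurableSet_Ioi).2 (Eventually.of_forall fun t ht =>
          hfn x t hx (le_of_lt ht)))
    rw [integral_const_mul, integral_exp_mul_Ioi (by linarith : -F₀ < 0)] at h1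
    calc _ ≤ Real.exp (z.re * x + Φ x) * (Real.exp (-(z.re * x + Φ x) + F₀ * x) *
          (-Real.exp (-F₀ * x) / -F₀)) := by
          refine mul_le_mul ?_ h1 (norm_nonneg _) (Real.exp_pos _).le
          rw [Complex.norm_exp]; simp
      _ = Real.exp (z.re * x + Φ x + (-(z.re * x + Φ x) + F₀ * x) + (-F₀ * x)) * F₀⁻¹ := by
          rw [Real.exp_add _ (-F₀ * x), Real.exp_add (z.re * x + Φ x)]; ring
      _ = F₀⁻¹ := by
          rw [show z.re * x + Φ x + (-(z.re * x + Φ x) + F₀ * x) + (-F₀ * x) = 0 by ring]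
          simp

/-- Half-plane, size and quasi-static estimates for the bounded solution of `K' = (z + F) K - z`,
uniformly in the spectral parameter `z` of the closed right half plane. -/
lemma exists_response_function {F' : ℝ → ℝ} {C : ℝ} (hz : 0 ≤ z.re) (hz0 : z ≠ 0)
    (hF : Continuous F)
    (hF₀ : ∀ x, 0 ≤ x → 1 / 2 ≤ F x) (hF₁ : ∀ x, 0 ≤ x → F x ≤ F₁)
    (hF' : ∀ x, 0 ≤ x → HasDerivAt F (F' x) x) (hC : ∀ x, 0 ≤ x → |F' x| ≤ C) :
    ∃ K : ℝ → ℂ, ∀ x, 0 ≤ x → HasDerivAt K ((z + F x) * K x - z) x ∧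
      ‖K x‖ ≤ 4 * (‖z‖ / (1 + ‖z‖)) ∧
      (1 / (2 * F₁)) * (‖z‖ / (F₁ + ‖z‖)) ^ 2 ≤ (K x).re ∧
      ‖K x - z / (1 + z)‖ ≤ 5 * (2 * C + F₁ + 1) * (‖z‖ / (1 + ‖z‖) ^ 2) := by
  obtain ⟨K, hK, B, hB⟩ := exists_bounded_solution hz hF (by norm_num : (0:ℝ) < 1 / 2) hF₀
  have hA : ∀ {e g : ℝ → ℂ} {C G : ℝ}, (∀ x, 0 ≤ x → HasDerivAt e ((z + F x) * e x + g x) x) →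
    (∀ x, 0 ≤ x → ‖e x‖ ≤ C) → (∀ x, 0 ≤ x → ‖g x‖ ≤ G * (z.re + F x)) → ∀ {x : ℝ},
    0 ≤ x → ‖e x‖ ≤ G := fun {e g C G} he hb hg {x} hx =>
      norm_le_of_bounded_solution hz hF (by norm_num : (0:ℝ) < 1 / 2) hF₀
        (fun x hx => (he x hx).hasDerivWithinAt) hb hg hx
  have hz1 : 0 < ‖z‖ := norm_pos_iff.2 hz0
  have hsq : ‖z‖ ^ 2 = z.re ^ 2 + z.im ^ 2 := by
    rw [Complex.sq_norm, Complex.normSq_apply]; ring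
  have hF1 : 1 / 2 ≤ F₁ := (hF₀ 0 le_rfl).trans (hF₁ 0 le_rfl)
  have hC0 : 0 ≤ C := (abs_nonneg _).trans (hC 0 le_rfl)
  refine ⟨K, fun x hx => ⟨hK x hx, ?_, ?_, ?_⟩⟩
  -- `1 - K` has forcing `-F` and `K` has forcing `-z`. The resulting bounds `‖K‖ ≤ 2` and `‖K‖ ≤ 2
  -- ‖z‖` add up to `(1 + ‖z‖) ‖K‖ ≤ 4 ‖z‖`.
  · have h1 : ‖1 - K x‖ ≤ 1 := by
      refine hA (e := fun x => 1 - K x) (g := fun x => -F x) (C := 1 + B) (G := 1) ?_ ?_ ?_ hx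
      · intro t ht
        convert! (hK t ht).const_sub 1 using 1; ring
      · intro t ht
        exact (norm_sub_le _ _).trans (by rw [norm_one]; linarith [hB t ht])
      · intro t ht
        have := hF₀ t ht
        rw [norm_neg, Complex.norm_real, Real.norm_of_nonneg (by linarith)]
        linarith
    have h2 : ‖K x‖ ≤ 2 * ‖z‖ := by
      refine hA (e := K) (g := fun _ => -z) (C := B) ?_ hB ?_ hx
      · intro t ht
        convert! hK t ht using 1
      · intro t ht
        have := hF₀ t ht
        rw [norm_neg]
        nlinarith
    have h3 : ‖K x‖ ≤ 2 := by
      have := norm_sub_le (1 : ℂ) (1 - K x)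
      simp only [sub_sub_cancel, norm_one] at this
      linarith
    rw [mul_div_assoc', le_div_iff₀ (by linarith)]
    nlinarith [norm_nonneg (K x)]
  · have hne : (F₁ : ℂ) + z ≠ 0 := by
      intro h
      have := congrArg Complex.re h
      simp at this; linarith
    have hnsq : ‖(F₁ : ℂ) + z‖ ^ 2 = (F₁ + z.re) ^ 2 + z.im ^ 2 := by
      rw [Complex.sq_norm, Complex.normSq_apply]; simp; ring
    have hn : F₁ ≤ ‖(F₁ : ℂ) + z‖ := by
      have := Complex.re_le_norm ((F₁ : ℂ) + z)
      simp at this; linarith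
    -- The bound `‖1 - K‖ ≤ 1` gives only `Re K ≥ 0`. Subtracting `L₀` replaces the forcing `-F` by
    -- one of size at most `(1 - 1 / (2 F₁)) F`, and the remaining `1 / (2 F₁) - Re L₀` is positive
    -- of order `‖z‖²` near the origin.
    set L₀ : ℂ := (1 / 2) / ((F₁ : ℂ) + z) with hL₀
    have hL : ((F₁ : ℂ) + z) * L₀ = 1 / 2 := by rw [hL₀]; field_simp
    have hLn : ‖L₀‖ ≤ 1 / (2 * F₁) := by
      rw [hL₀, norm_div, div_le_div_iff₀ (by linarith) (by linarith)]
      norm_num; linarith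
    have h1 : ‖1 - K x - L₀‖ ≤ 1 - 1 / (2 * F₁) := by
      refine hA (e := fun x => 1 - K x - L₀)
        (g := fun x => (F x - F₁) * L₀ + (1 / 2 - F x)) (C := 1 + B + ‖L₀‖) ?_ ?_ ?_ hx
      · intro t ht
        convert! ((hK t ht).const_sub 1).sub_const L₀ using 1
        linear_combination -hL
      · intro t ht
        refine (norm_sub_le _ _).trans ?_
        have := norm_sub_le (1 : ℂ) (K t)
        rw [norm_one] at this
        linarith [hB t ht]
      · intro t ht
        have h0 := hF₀ t ht
        have h1 := hF₁ t ht
        have e1 : ‖((F t : ℂ) - F₁) * L₀‖ ≤ (F₁ - F t) * (1 / (2 * F₁)) := by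
          rw [norm_mul, ← Complex.ofReal_sub, Complex.norm_real, Real.norm_eq_abs, abs_sub_comm,
            abs_of_nonneg (by linarith)]
          exact mul_le_mul_of_nonneg_left hLn (by linarith)
        have e2 : ‖(1 / 2 - F t : ℂ)‖ = F t - 1 / 2 := by
          rw [show (1 / 2 - F t : ℂ) = ((1 / 2 - F t : ℝ) : ℂ) by push_cast; ring,
            Complex.norm_real, Real.norm_eq_abs, abs_sub_comm, abs_of_nonneg (by linarith)]
        refine (norm_add_le _ _).trans ?_
        rw [e2]
        have e3 : F₁ * (1 / (2 * F₁)) = 1 / 2 := by field_simp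
        have e4 : 1 / (2 * F₁) ≤ 1 := by rw [div_le_one (by linarith)]; linarith
        nlinarith
    have h2 : (1 - K x - L₀).re ≤ 1 - 1 / (2 * F₁) := (Complex.re_le_norm _).trans h1
    have h3 : L₀.re = (1 / 2) * (F₁ + z.re) / ‖(F₁ : ℂ) + z‖ ^ 2 := by
      rw [hL₀, Complex.div_re, Complex.sq_norm]; simp
    have h4 : 1 / (2 * F₁) - L₀.re ≤ (K x).re := by
      simp at h2; simp; linarith
    refine le_trans ?_ h4
    have h5 : ‖(F₁ : ℂ) + z‖ ^ 2 ≤ (F₁ + ‖z‖) ^ 2 := by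
      refine pow_le_pow_left₀ (norm_nonneg _) ?_ 2
      refine (norm_add_le _ _).trans ?_
      rw [Complex.norm_real, Real.norm_of_nonneg (by linarith)]
    have h6 : 0 < ‖(F₁ : ℂ) + z‖ ^ 2 := by positivity
    have h7 : 1 / (2 * F₁) - L₀.re =
        (1 / (2 * F₁)) * ((‖z‖ ^ 2 + F₁ * z.re) / ‖(F₁ : ℂ) + z‖ ^ 2) := by
      rw [h3]
      field_simp
      rw [hnsq, hsq]; ring
    rw [h7]
    refine mul_le_mul_of_nonneg_left ?_ (by positivity)
    rw [div_pow]
    refine div_le_div₀ (by positivity) ?_ h6 h5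
    nlinarith [mul_nonneg (by linarith : 0 ≤ F₁) hz]
  · have hne : ∀ t, 0 ≤ t → z + F t ≠ 0 := by
      intro t ht h
      have := congrArg Complex.re h
      simp at this; linarith [hF₀ t ht]
    have hnsq : ∀ t, 0 ≤ t → ‖z‖ ^ 2 + 1 / 4 ≤ ‖z + F t‖ ^ 2 := by
      intro t ht
      have := hF₀ t ht
      rw [hsq, Complex.sq_norm, Complex.normSq_apply]; simp
      nlinarith [mul_nonneg hz (by linarith : 0 ≤ F t)]
    have h1n : ‖z‖ ^ 2 + 1 / 4 ≤ ‖1 + z‖ ^ 2 := by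
      rw [hsq, Complex.sq_norm, Complex.normSq_apply]; simp
      nlinarith
    have h1ne : (1 : ℂ) + z ≠ 0 := by
      intro h
      have := congrArg Complex.re h
      simp at this; linarith
    -- Five times the difference of the two sides is the perfect square `(2 ‖z‖ - 1/2)²`.
    have hq : (1 + ‖z‖) ^ 2 / 5 ≤ ‖z‖ ^ 2 + 1 / 4 := by nlinarith [sq_nonneg (2 * ‖z‖ - 1 / 2)]
    have hq0 : 0 < (1 + ‖z‖) ^ 2 / 5 := by positivity
    -- The frozen-coefficient solution `z / (z + F)` has residual `z F' / (z + F)²`. Afterwards `F`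
    -- is replaced by `1`, at a cost of the same order in `z`.
    have h1 : ‖K x - z / (z + F x)‖ ≤ 2 * (C * (‖z‖ / ((1 + ‖z‖) ^ 2 / 5))) := by
      refine hA (e := fun x => K x - z / (z + F x))
        (g := fun x => z * F' x / (z + F x) ^ 2) (C := B + 1) ?_ ?_ ?_ hx
      · intro t ht
        have h2 : HasDerivAt (fun x => z + (F x : ℂ)) (F' t) t := (hF' t ht).ofReal_comp.const_add z
        have h3 := (hK t ht).sub ((hasDerivAt_const t z).div h2 (hne t ht))
        convert! h3 using 1
        have := hne t ht
        field_simp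
        ring
      · intro t ht
        refine (norm_sub_le _ _).trans (add_le_add (hB t ht) ?_)
        rw [norm_div, div_le_one (norm_pos_iff.2 (hne t ht))]
        have := hnsq t ht
        exact (sq_le_sq₀ (norm_nonneg _) (norm_nonneg _)).1 (by linarith)
      · intro t ht
        rw [norm_div, norm_mul, norm_pow, Complex.norm_real, Real.norm_eq_abs]
        have e1 : ‖z‖ * |F' t| / ‖z + F t‖ ^ 2 ≤ ‖z‖ * C / ((1 + ‖z‖) ^ 2 / 5) :=
          div_le_div₀ (by positivity) (mul_le_mul_of_nonneg_left (hC t ht) (norm_nonneg _)) hq0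
            (hq.trans (hnsq t ht))
        have e2 : 1 / 2 ≤ z.re + F t := by linarith [hF₀ t ht]
        have e3 : 0 ≤ C * (‖z‖ / ((1 + ‖z‖) ^ 2 / 5)) := by positivity
        calc _ ≤ ‖z‖ * C / ((1 + ‖z‖) ^ 2 / 5) := e1
          _ = 2 * (C * (‖z‖ / ((1 + ‖z‖) ^ 2 / 5))) * (1 / 2) := by ring
          _ ≤ _ := mul_le_mul_of_nonneg_left e2 (by positivity)
    have h2 : ‖z / (z + F x) - z / (1 + z)‖ ≤ (F₁ + 1) * (‖z‖ / ((1 + ‖z‖) ^ 2 / 5)) := by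
      have e1 : z / (z + F x) - z / (1 + z) = z * (1 - F x) / ((z + F x) * (1 + z)) := by
        have := hne x hx
        field_simp
        ring
      have e2 : ‖(1 - F x : ℂ)‖ ≤ F₁ + 1 := by
        rw [show (1 - F x : ℂ) = ((1 - F x : ℝ) : ℂ) by push_cast; ring, Complex.norm_real,
          Real.norm_eq_abs, abs_le]
        have := hF₀ x hx
        have := hF₁ x hx
        constructor <;> linarith
      rw [e1, norm_div, norm_mul, norm_mul, mul_comm (F₁ + 1), div_mul_eq_mul_div]
      refine div_le_div₀ (by positivity) (mul_le_mul_of_nonneg_left e2 (norm_nonneg _)) hq0 ?_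
      refine (sq_le_sq₀ (by positivity) (by positivity)).1 ?_
      rw [mul_pow, sq ((1 + ‖z‖) ^ 2 / 5)]
      exact mul_le_mul (hq.trans (hnsq x hx)) (hq.trans h1n) hq0.le (by positivity)
    calc _ = ‖(K x - z / (z + F x)) + (z / (z + F x) - z / (1 + z))‖ := by congr 1; ring
      _ ≤ _ := norm_add_le _ _
      _ ≤ _ := add_le_add h1 h2
      _ = _ := by rw [div_div_eq_mul_div]; ring

end ScalarEquation

/-! ### Positivity of the dissipation. -/

section Energy

open ComplexConjugate

/-- Positivity of the quadratic form that bounds the dissipation of the energy from below. -/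
lemma dissipation_form_pos {c C w β v a₁ a₂ a₃ ρ : ℝ} (hc : 0 < c) (hc' : c ≤ 1 / 2)
    (hw : w = c / 16) (hβ : β = w / (16 * C ^ 2 + 16)) (hv : 0 < v)
    (hv' : v ≤ β * c / 160000) (h₁ : 0 ≤ a₁) (h₂ : 0 ≤ a₂) (h₃ : 0 ≤ a₃)
    (hρ : ρ = 4 * a₁ + 8 * a₂ + a₃) (hpos : 0 < a₁ ∨ 0 < a₂ ∨ 0 < a₃) :
    0 < v * (c * a₁ ^ 2 - 8 * a₂ * a₁ - a₃ * a₁) + w * a₂ ^ 2 - w * v * (a₁ + 2 * a₂) * ρ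
      + β * a₃ ^ 2 - 2 * β * C * a₃ * a₂ - 32 * β * v * a₃ * ρ := by
  obtain ⟨k, hk⟩ : ∃ k : ℝ, c * k = 1 := ⟨c⁻¹, mul_inv_cancel₀ hc.ne'⟩
  have hk0 : 2 ≤ k := by nlinarith
  have hw0 : 0 < w := by rw [hw]; positivity
  have hw1 : w ≤ 1 / 32 := by rw [hw]; linarith
  have hD : 0 < 16 * C ^ 2 + 16 := by positivity
  have hβ0 : 0 < β := by rw [hβ]; positivity
  have hβw : β * (16 * C ^ 2 + 16) = w := by rw [hβ]; field_simp
  have hβ1 : β ≤ w := by nlinarith [mul_nonneg hβ0.le (sq_nonneg C)]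
  -- Only `v c a₁²` is available for `a₁`, but every cross term with `a₁` also carries `v`. Young's
  -- inequality therefore leaves multiples of `v` and `v / c` in front of `a₂²` and `a₃²`, absorbed
  -- by `w` and `β` for small `v`. Here `k` is `1 / c`.
  have y1 : 8 * a₂ * a₁ ≤ c / 8 * a₁ ^ 2 + 128 * k * a₂ ^ 2 := by
    have := mul_nonneg hc.le (sq_nonneg (a₁ - 32 * k * a₂))
    have e : c * (a₁ - 32 * k * a₂) ^ 2 =
      c * a₁ ^ 2 - 64 * (c * k) * a₁ * a₂ + 1024 * (c * k) * k * a₂ ^ 2 := by ring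
    rw [e, hk] at this
    linarith
  have y2 : a₃ * a₁ ≤ c / 8 * a₁ ^ 2 + 2 * k * a₃ ^ 2 := by
    have := mul_nonneg hc.le (sq_nonneg (a₁ - 4 * k * a₃))
    have e : c * (a₁ - 4 * k * a₃) ^ 2 =
      c * a₁ ^ 2 - 8 * (c * k) * a₁ * a₃ + 16 * (c * k) * k * a₃ ^ 2 := by ring
    rw [e, hk] at this
    linarith
  -- The pure term is `4 w a₁²`; the choice `w = c / 16` makes it `c / 4 * a₁²`.
  have y3 : w * (a₁ + 2 * a₂) * ρ ≤ (c / 4 + c / 8 + c / 32) * a₁ ^ 2 + 3 * a₂ ^ 2 + 2 * a₃ ^ 2 := by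
    have e : w * (a₁ + 2 * a₂) * ρ =
      c / 4 * a₁ ^ 2 + c * (a₁ * a₂) + c * a₂ ^ 2 + c / 16 * (a₁ * a₃) + c / 8 * (a₂ * a₃) := by
      rw [hρ, hw]; ring
    rw [e]
    have i1 := mul_nonneg hc.le (sq_nonneg (a₁ - 4 * a₂))
    have i2 := mul_nonneg hc.le (sq_nonneg (a₁ - a₃))
    have i3 := mul_nonneg hc.le (sq_nonneg (a₂ - a₃))
    have i4 := mul_le_mul_of_nonneg_right hc' (sq_nonneg a₂)
    have i5 := mul_le_mul_of_nonneg_right hc' (sq_nonneg a₃)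
    have i6 := sq_nonneg a₂
    have i7 := sq_nonneg a₃
    linarith
  -- This is the cross term without a factor `v`, and the choice of `β` relative to `w / C²` is made
  -- for it.
  have y4 : 2 * β * C * a₃ * a₂ ≤ w / 4 * a₂ ^ 2 + β / 4 * a₃ ^ 2 := by
    have i1 := mul_nonneg hβ0.le (sq_nonneg (4 * C * a₂ - a₃))
    have i2 : β * (16 * C ^ 2) * a₂ ^ 2 ≤ w * a₂ ^ 2 :=
      mul_le_mul_of_nonneg_right (by linarith) (sq_nonneg _)
    linarith
  have y5 : 32 * β * a₃ * ρ ≤ c / 8 * a₁ ^ 2 + 128 * a₂ ^ 2 + (32768 * k + 160) * a₃ ^ 2 := by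
    have i0 : 32 * β * a₃ * ρ ≤ 32 * a₃ * ρ := by
      have : 0 ≤ a₃ * ρ := by rw [hρ]; positivity
      nlinarith
    have i1 := mul_nonneg hc.le (sq_nonneg (a₁ - 512 * k * a₃))
    have e : c * (a₁ - 512 * k * a₃) ^ 2 =
      c * a₁ ^ 2 - 1024 * (c * k) * a₁ * a₃ + 262144 * (c * k) * k * a₃ ^ 2 := by ring
    rw [e, hk] at i1
    have i2 := sq_nonneg (a₂ - a₃)
    rw [hρ] at i0 ⊢
    linarith
  have hvk : v * k ≤ β / 160000 := by
    have : v * k ≤ β * c / 160000 * k := mul_le_mul_of_nonneg_right hv' (by linarith)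
    have e : β * c / 160000 * k = β / 160000 * (c * k) := by ring
    rw [e, hk, mul_one] at this
    exact this
  have hv1 : v ≤ β / 320000 := by
    have : v * 2 ≤ v * k := mul_le_mul_of_nonneg_left hk0 hv.le
    linarith
  have z2 : (v * (128 * k + 3 + 128)) * a₂ ^ 2 ≤ w / 4 * a₂ ^ 2 :=
    mul_le_mul_of_nonneg_right (by nlinarith) (sq_nonneg _)
  have z3 : (v * (2 * k + 2 + (32768 * k + 160))) * a₃ ^ 2 ≤ β / 4 * a₃ ^ 2 :=
    mul_le_mul_of_nonneg_right (by nlinarith) (sq_nonneg _)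
  have s1 := mul_le_mul_of_nonneg_left y1 hv.le
  have s2 := mul_le_mul_of_nonneg_left y2 hv.le
  have s3 := mul_le_mul_of_nonneg_left y3 hv.le
  have s5 := mul_le_mul_of_nonneg_left y5 hv.le
  have hfin : 0 < v * c / 8 * a₁ ^ 2 + w / 4 * a₂ ^ 2 + β / 4 * a₃ ^ 2 := by
    have n1 : 0 ≤ v * c / 8 * a₁ ^ 2 := by positivity
    have n2 : 0 ≤ w / 4 * a₂ ^ 2 := by positivity
    have n3 : 0 ≤ β / 4 * a₃ ^ 2 := by positivity
    rcases hpos with h | h | h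
    · have : 0 < v * c / 8 * a₁ ^ 2 := by positivity
      linarith
    · have : 0 < w / 4 * a₂ ^ 2 := by positivity
      linarith
    · have : 0 < β / 4 * a₃ ^ 2 := by positivity
      linarith
  have n1 : 0 ≤ v * c * a₁ ^ 2 := by positivity
  have n2 : 0 ≤ w * a₂ ^ 2 := by positivity
  have n3 : 0 ≤ β * a₃ ^ 2 := by positivity
  linarith

lemma neg_norm_le_re_mul (a b : ℂ) : -(‖a‖ * ‖b‖) ≤ (a * b).re := by
  have := (abs_le.1 (Complex.abs_re_le_norm (a * b))).1
  rwa [norm_mul] at this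

set_option maxHeartbeats 1000000 in
/-- Pointwise lower bound for the dissipation of the energy of the adjoint system. -/
lemma dissipation_pos {c C w β v F : ℝ} {z K p q r d k : ℂ} (hc : 0 < c) (hc' : c ≤ 1 / 2)
    (hC : 0 ≤ C) (hw : w = c / 16) (hβ : β = w / (16 * C ^ 2 + 16)) (hv : 0 < v)
    (hv' : v ≤ β * c / 160000) (hz : 0 ≤ z.re) (hz0 : z ≠ 0) (hF : 1 / 2 ≤ F)
    (hk : k = z / (1 + z)) (hK : ‖K‖ ≤ 4 * (‖z‖ / (1 + ‖z‖)))
    (hKre : c * (‖z‖ / (1 + ‖z‖)) ^ 2 ≤ K.re)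
    (hKk : ‖K - k‖ ≤ C * (‖z‖ / (1 + ‖z‖) ^ 2))
    (hd : d = r - K * (p + q) + k * K * p) (hne : p ≠ 0 ∨ q ≠ 0 ∨ r ≠ 0) :
    0 < z.re * ‖p‖ ^ 2 + v * (r * conj (p + q)).re
      + w / (1 + ‖z‖) * (‖z‖ ^ 2 * ‖p‖ ^ 2 + v * (conj z * (q - p) * conj r).re)
      + β / (‖z‖ / (1 + ‖z‖)) ^ 2 * (2 * (z.re + F) * ‖d‖ ^ 2 +
        2 * (conj d * (z * (K - k) * p + v * (2 - k) * K * r)).re) := by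
  have hz1 : 0 < ‖z‖ := norm_pos_iff.2 hz0
  have hw0 : 0 < w := by rw [hw]; positivity
  have hβ0 : 0 < β := by rw [hβ]; positivity
  set Λ := ‖z‖ with hΛ
  set κ := Λ / (1 + Λ) with hκ
  have hκ0 : 0 < κ := by positivity
  have hκ1 : κ ≤ 1 := by rw [hκ, div_le_one (by linarith)]; linarith
  have hκΛ : κ * (1 + Λ) = Λ := by rw [hκ]; field_simp
  have hkn : ‖k‖ ≤ 2 * κ := by
    rw [hk, norm_div, hκ, mul_div_assoc', div_le_div_iff₀ (norm_pos_iff.2 _) (by linarith)]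
    · have h1 : ((1 + Λ) / 2) ^ 2 ≤ ‖1 + z‖ ^ 2 := by
        have hsq : Λ ^ 2 = z.re ^ 2 + z.im ^ 2 := by
          rw [hΛ, Complex.sq_norm, Complex.normSq_apply]; ring
        rw [Complex.sq_norm, Complex.normSq_apply]
        simp only [Complex.add_re, Complex.one_re, Complex.add_im, Complex.one_im]
        nlinarith [sq_nonneg (Λ - 1)]
      have h2 := (sq_le_sq₀ (by positivity) (norm_nonneg _)).1 h1
      rw [← hΛ]
      nlinarith
    · intro h
      have := congrArg Complex.re h
      simp at this; linarith
  have hk2 : ‖k‖ ≤ 2 := by linarith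
  set g := Real.sqrt (1 + Λ) with hg
  have hg2 : g ^ 2 = 1 + Λ := Real.sq_sqrt (by linarith)
  have hg1 : 1 ≤ g := by rw [hg, Real.one_le_sqrt]; linarith
  -- In these weighted norms the dissipation becomes a quadratic form whose constants do not depend
  -- on `z`: `κ²` is the size of the lower bound for `Re K`, `κ² (1 + Λ)` is `Λ² / (1 + Λ)`, and the
  -- division in `a₃` matches the factor `1 / κ²` of the defect energy.
  set a₁ := κ * ‖p + q‖ with ha₁
  set a₂ := κ * g * ‖p‖ with ha₂
  set a₃ := ‖d‖ / κ with ha₃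
  have hd3 : ‖d‖ = κ * a₃ := by rw [ha₃]; field_simp
  have n₁ : 0 ≤ a₁ := by positivity
  have n₂ : 0 ≤ a₂ := by positivity
  have n₃ : 0 ≤ a₃ := by positivity
  have hP : κ * ‖p‖ ≤ a₂ := by
    rw [ha₂]
    have : 0 ≤ κ * ‖p‖ := by positivity
    nlinarith
  have hkK : ‖k * K‖ ≤ 8 * κ ^ 2 := by
    rw [norm_mul]
    calc _ ≤ (2 * κ) * (4 * κ) := mul_le_mul hkn hK (norm_nonneg _) (by positivity)
      _ = _ := by ring
  have hr : r = K * (p + q) - k * K * p + d := by rw [hd]; ring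
  set ρ := 4 * a₁ + 8 * a₂ + a₃ with hρ
  have hρ0 : 0 ≤ ρ := by positivity
  have hrn : ‖r‖ ≤ ρ := by
    have e1 : ‖K * (p + q)‖ ≤ 4 * a₁ := by
      rw [norm_mul, ha₁, ← mul_assoc]
      exact mul_le_mul_of_nonneg_right hK (norm_nonneg _)
    have e2 : ‖k * K * p‖ ≤ 8 * a₂ := by
      rw [norm_mul]
      calc _ ≤ 8 * κ ^ 2 * ‖p‖ := mul_le_mul_of_nonneg_right hkK (norm_nonneg _)
        _ = 8 * κ * (κ * ‖p‖) := by ring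
        _ ≤ 8 * 1 * a₂ := mul_le_mul (by linarith) hP (by positivity) (by norm_num)
        _ = _ := by ring
    have e3 : ‖d‖ ≤ a₃ := by rw [hd3]; nlinarith
    rw [hr]
    calc _ ≤ ‖K * (p + q)‖ + ‖k * K * p‖ + ‖d‖ :=
          (norm_add_le _ _).trans (add_le_add_left (norm_sub_le _ _) _)
      _ ≤ _ := by rw [hρ]; linarith
  have hpos : 0 < a₁ ∨ 0 < a₂ ∨ 0 < a₃ := by
    by_contra! hcon
    have z1 : a₁ = 0 := le_antisymm hcon.1 n₁
    have z2 : a₂ = 0 := le_antisymm hcon.2.1 n₂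
    have z3 : a₃ = 0 := le_antisymm hcon.2.2 n₃
    have hp : p = 0 := by
      rw [ha₂] at z2
      have : κ * g ≠ 0 := by positivity
      simpa [this, hκ0.ne'] using z2
    have hq : q = 0 := by
      rw [ha₁, hp, zero_add] at z1
      simpa [hκ0.ne'] using z1
    have hr0 : r = 0 := by
      have : ρ = 0 := by rw [hρ, z1, z2, z3]; ring
      rw [this] at hrn
      simpa using hrn
    rcases hne with h | h | h
    · exact h hp
    · exact h hq
    · exact h hr0
  -- Inserting `r = K (p + q) - k K p + d` produces the good term `Re K |p + q|²` and two errors.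
  have T1 : v * (c * a₁ ^ 2 - 8 * a₂ * a₁ - a₃ * a₁) ≤ v * (r * conj (p + q)).re := by
    refine mul_le_mul_of_nonneg_left ?_ hv.le
    have e : r * conj (p + q) = ((‖p + q‖ ^ 2 : ℝ) : ℂ) * K + (-(k * K * p)) * conj (p + q)
        + d * conj (p + q) := by
      have : ((‖p + q‖ ^ 2 : ℝ) : ℂ) = (p + q) * conj (p + q) := by
        rw [Complex.mul_conj, Complex.normSq_eq_norm_sq]
      rw [this, hr]; ring
    rw [e, Complex.add_re, Complex.add_re, Complex.re_ofReal_mul]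
    have i1 : c * a₁ ^ 2 ≤ ‖p + q‖ ^ 2 * K.re := by
      calc c * a₁ ^ 2 = ‖p + q‖ ^ 2 * (c * κ ^ 2) := by rw [ha₁]; ring
        _ ≤ _ := mul_le_mul_of_nonneg_left hKre (sq_nonneg _)
    have i2 := neg_norm_le_re_mul (-(k * K * p)) (conj (p + q))
    have i3 := neg_norm_le_re_mul d (conj (p + q))
    rw [norm_neg, norm_mul, RCLike.norm_conj] at i2
    rw [RCLike.norm_conj] at i3
    have i4 : ‖k * K‖ * ‖p‖ * ‖p + q‖ ≤ 8 * a₂ * a₁ := by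
      calc _ ≤ 8 * κ ^ 2 * ‖p‖ * ‖p + q‖ := by gcongr
        _ = 8 * (κ * ‖p‖) * a₁ := by rw [ha₁]; ring
        _ ≤ _ := by gcongr
    have i5 : ‖d‖ * ‖p + q‖ = a₃ * a₁ := by rw [hd3, ha₁]; ring
    linarith
  have T2 : w / (1 + Λ) * (Λ ^ 2 * ‖p‖ ^ 2) = w * a₂ ^ 2 := by
    rw [ha₂, mul_pow, mul_pow, hg2, hκ]
    field_simp
  have T3 : -(w * v * (a₁ + 2 * a₂) * ρ) ≤
      w / (1 + Λ) * (v * (conj z * (q - p) * conj r).re) := by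
    have i1 := neg_norm_le_re_mul (conj z * (q - p)) (conj r)
    rw [norm_mul, RCLike.norm_conj, RCLike.norm_conj, ← hΛ] at i1
    have i2 : κ * ‖q - p‖ ≤ a₁ + 2 * a₂ := by
      have : ‖q - p‖ ≤ ‖p + q‖ + 2 * ‖p‖ := by
        have := norm_sub_le (p + q) (2 * p)
        rw [norm_mul, show (p + q) - 2 * p = q - p by ring] at this
        simpa using this
      calc _ ≤ κ * (‖p + q‖ + 2 * ‖p‖) := by gcongr
        _ = a₁ + 2 * (κ * ‖p‖) := by rw [ha₁]; ring
        _ ≤ _ := by linarith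
    have i3 : w * v * (κ * ‖q - p‖) * ‖r‖ ≤ w * v * (a₁ + 2 * a₂) * ρ := by gcongr
    have i4 : w / (1 + Λ) * (v * -(Λ * ‖q - p‖ * ‖r‖)) = -(w * v * (κ * ‖q - p‖) * ‖r‖) := by
      rw [hκ]; field_simp
    calc _ ≤ -(w * v * (κ * ‖q - p‖) * ‖r‖) := by linarith
      _ = _ := i4.symm
      _ ≤ _ := by gcongr
  have T4 : β * a₃ ^ 2 ≤ β / κ ^ 2 * (2 * (z.re + F) * ‖d‖ ^ 2) := by
    have : β / κ ^ 2 * (2 * (z.re + F) * ‖d‖ ^ 2) = 2 * (z.re + F) * (β * a₃ ^ 2) := by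
      rw [hd3]; field_simp
    rw [this]
    have : 0 ≤ β * a₃ ^ 2 := by positivity
    nlinarith
  have T5 : -(2 * β * C * a₃ * a₂ + 32 * β * v * a₃ * ρ) ≤
      β / κ ^ 2 * (2 * (conj d * (z * (K - k) * p + v * (2 - k) * K * r)).re) := by
    have i1 := neg_norm_le_re_mul (conj d) (z * (K - k) * p + v * (2 - k) * K * r)
    rw [RCLike.norm_conj] at i1
    have i2 : ‖z * (K - k) * p‖ ≤ C * κ * a₂ := by
      rw [norm_mul, norm_mul, ← hΛ]
      calc _ ≤ Λ * (C * (Λ / (1 + Λ) ^ 2)) * ‖p‖ := by gcongr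
        _ = C * κ * (κ * ‖p‖) := by rw [hκ]; field_simp
        _ ≤ _ := by gcongr
    have i3 : ‖(v : ℂ) * (2 - k) * K * r‖ ≤ 16 * v * κ * ρ := by
      have : ‖2 - k‖ ≤ 4 := by
        have := norm_sub_le (2 : ℂ) k
        simp only [Complex.norm_ofNat] at this
        linarith
      rw [norm_mul, norm_mul, norm_mul, Complex.norm_real, Real.norm_of_nonneg hv.le]
      calc _ ≤ v * 4 * (4 * κ) * ρ := by gcongr
        _ = _ := by ring
    have i4 : ‖z * (K - k) * p + v * (2 - k) * K * r‖ ≤ κ * (C * a₂ + 16 * v * ρ) := by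
      refine (norm_add_le _ _).trans ?_
      linarith
    have i5 : -(κ * a₃ * (κ * (C * a₂ + 16 * v * ρ))) ≤
        (conj d * (z * (K - k) * p + v * (2 - k) * K * r)).re := by
      refine le_trans ?_ i1
      rw [hd3]
      gcongr
    have i6 : β / κ ^ 2 * (2 * -(κ * a₃ * (κ * (C * a₂ + 16 * v * ρ)))) =
        -(2 * β * C * a₃ * a₂ + 32 * β * v * a₃ * ρ) := by
      field_simp
      ring
    rw [← i6]
    gcongr
  have main := dissipation_form_pos hc hc' hw hβ hv hv' n₁ n₂ n₃ hρ hpos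
  have T0 : 0 ≤ z.re * ‖p‖ ^ 2 := by positivity
  rw [mul_add (w / (1 + Λ)), mul_add (β / κ ^ 2), T2]
  linarith

end Energy

/-! ### The energy argument for the adjoint system. -/

section Energy

open ComplexConjugate

/-- The adjoint eigenvalue equation for `Y = (p, q, r)`, the conjugate of `W`. -/
structure IsRowSolution (v F : ℝ → ℝ) (z : ℂ) (p q r : ℝ → ℂ) : Prop where
  left : ∀ x, 0 ≤ x → HasDerivWithinAt p (-(v x * r x)) (Set.Ici 0) x
  mid : ∀ x, 0 ≤ x → HasDerivWithinAt q (-(z * p x) - v x * r x) (Set.Ici 0) x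
  right : ∀ x, 0 ≤ x →
    HasDerivWithinAt r ((z + F x) * r x - z * (p x + q x)) (Set.Ici 0) x

/-- The left side is the product rule for the corrected energy. The gain `‖z‖² ‖p‖²` appears because
`(q - p)' = -z p`. -/
lemma re_energy_deriv (p q r d z e : ℂ) (v F ω b : ℝ) :
    ((-(z * p) - v * r) * conj p + q * conj (-(v * r))
      + ω * (conj z * ((-(z * p) - v * r) - (-(v * r))) * conj p
        + conj z * (q - p) * conj (-(v * r)))
      - b * (((z + F) * d + e) * conj d + d * conj ((z + F) * d + e))).re
    = -(z.re * ‖p‖ ^ 2 + v * (r * conj (p + q)).re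
      + ω * (‖z‖ ^ 2 * ‖p‖ ^ 2 + v * (conj z * (q - p) * conj r).re)
      + b * (2 * (z.re + F) * ‖d‖ ^ 2 + 2 * (conj d * e).re)) := by
  simp only [Complex.sq_norm, Complex.normSq_apply, Complex.mul_re, Complex.mul_im, Complex.add_re,
    Complex.add_im, Complex.sub_re, Complex.sub_im, Complex.neg_re, Complex.neg_im,
    Complex.conj_re, Complex.conj_im, Complex.ofReal_re, Complex.ofReal_im]
  ring

/-- For small `v`, a decaying solution of the adjoint equation whose first component vanishes
at the boundary is trivial, uniformly in the spectral parameter. -/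
theorem exists_forall_rowSolution_eq_zero (F₁ C : ℝ) (hF₁ : 1 ≤ F₁) (hC : 0 ≤ C) :
    ∃ ε > 0, ∀ (z : ℂ) (v F F' : ℝ → ℝ) (p q r : ℝ → ℂ), 0 ≤ z.re → z ≠ 0 → Continuous F →
      (∀ x, 0 ≤ x → 0 < v x ∧ v x ≤ ε ∧ 1 / 2 ≤ F x ∧ F x ≤ F₁ ∧ HasDerivAt F (F' x) x ∧
        |F' x| ≤ C) →
      IsRowSolution v F z p q r → Tendsto p atTop (𝓝 0) → Tendsto q atTop (𝓝 0) →
      Tendsto r atTop (𝓝 0) → p 0 = 0 → ∀ x, 0 < x → p x = 0 ∧ q x = 0 ∧ r x = 0 := by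
  -- The lower bound for `Re K` is brought to the form `c (‖z‖ / (1 + ‖z‖))²` through `F₁ + ‖z‖ ≤ F₁
  -- (1 + ‖z‖)`, whence the cube; `C₂` is the constant of the quasi-static estimate.
  set c : ℝ := 1 / (2 * F₁ ^ 3) with hc
  set C₂ : ℝ := 5 * (2 * C + F₁ + 1) with hC₂
  set w : ℝ := c / 16 with hw
  set β : ℝ := w / (16 * C₂ ^ 2 + 16) with hβ
  have hF₁3 : 1 ≤ F₁ ^ 3 := one_le_pow₀ hF₁
  have hc0 : 0 < c := by positivity
  have hc1 : c ≤ 1 / 2 := by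
    rw [hc]; exact one_div_le_one_div_of_le (by norm_num) (by linarith)
  have hC₂0 : 0 ≤ C₂ := by positivity
  have hβ0 : 0 < β := by positivity
  refine ⟨β * c / 160000, by positivity, ?_⟩
  intro z v F F' p q r hz hz0 hFc hvF hsol hp0 hq0 hr0 hp x₀ hx₀
  obtain ⟨K, hK⟩ := exists_response_function hz hz0 hFc (fun x hx => (hvF x hx).2.2.1)
    (fun x hx => (hvF x hx).2.2.2.1) (fun x hx => (hvF x hx).2.2.2.2.1)
    (fun x hx => (hvF x hx).2.2.2.2.2)
  have hz1 : 0 < ‖z‖ := norm_pos_iff.2 hz0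
  set k : ℂ := z / (1 + z) with hk
  set ω : ℝ := w / (1 + ‖z‖) with hω
  set b : ℝ := β / (‖z‖ / (1 + ‖z‖)) ^ 2 with hb
  have hb0 : 0 ≤ b := by positivity
  -- Without the last term the forcing of the defect would contain `z K p`. The correction `k K p`
  -- turns it into `z (K - k) p`, with the smaller coefficient supplied by the estimate of `K - k`.
  set d : ℝ → ℂ := fun x => r x - K x * (p x + q x) + k * K x * p x with hd
  set e : ℝ → ℂ := fun x => z * (K x - k) * p x + v x * (2 - k) * K x * r x with he
  have hdd : ∀ x, 0 ≤ x → HasDerivWithinAt d ((z + F x) * d x + e x) (Set.Ici 0) x := by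
    intro x hx
    have hKx := (hK x hx).1.hasDerivWithinAt (s := Set.Ici 0)
    have := ((hsol.right x hx).sub (hKx.mul ((hsol.left x hx).add (hsol.mid x hx)))).add
      ((hKx.const_mul k).mul (hsol.left x hx))
    convert! this using 1
    simp only [hd, he, Pi.add_apply]
    ring
  set Ec : ℝ → ℂ := fun x => q x * conj (p x) + ω * (conj z * (q x - p x) * conj (p x))
    - b * (d x * conj (d x)) with hEc
  set D : ℝ → ℝ := fun x => z.re * ‖p x‖ ^ 2 + v x * (r x * conj (p x + q x)).re
      + ω * (‖z‖ ^ 2 * ‖p x‖ ^ 2 + v x * (conj z * (q x - p x) * conj (r x)).re)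
      + b * (2 * (z.re + F x) * ‖d x‖ ^ 2 + 2 * (conj (d x) * e x).re) with hD
  have hEd : ∀ x, 0 ≤ x → HasDerivWithinAt (fun x => (Ec x).re) (-D x) (Set.Ici 0) x := by
    intro x hx
    have hpc := (hsol.left x hx).star
    have hdc := (hdd x hx).star
    have h1 := (hsol.mid x hx).mul hpc
    have h2 := ((((hsol.mid x hx).sub (hsol.left x hx)).const_mul (conj z)).mul hpc).const_mul
      (ω : ℂ)
    have h3 := ((hdd x hx).mul hdc).const_mul (b : ℂ)
    have h4 := Complex.reCLM.hasFDerivAt.comp_hasDerivWithinAt x ((h1.add h2).sub h3)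
    rw [hD, ← re_energy_deriv]
    exact h4
  have hDpos : ∀ x, 0 ≤ x → (p x ≠ 0 ∨ q x ≠ 0 ∨ r x ≠ 0) → 0 < D x := by
    intro x hx hne
    obtain ⟨h1, h2, h3, h4, -, -⟩ := hvF x hx
    obtain ⟨-, k1, k2, k3⟩ := hK x hx
    refine dissipation_pos hc0 hc1 hC₂0 hw hβ h1 h2 hz hz0 h3 hk k1 ?_ k3 rfl hne
    refine le_trans ?_ k2
    have e1 : c * (‖z‖ / (1 + ‖z‖)) ^ 2 = 1 / (2 * F₁) * (‖z‖ / (F₁ * (1 + ‖z‖))) ^ 2 := by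
      rw [hc]; field_simp
    rw [e1]
    gcongr
    nlinarith
  have hD0 : ∀ x, 0 ≤ x → 0 ≤ D x := by
    intro x hx
    by_cases hne : p x ≠ 0 ∨ q x ≠ 0 ∨ r x ≠ 0
    · exact (hDpos x hx hne).le
    · push Not at hne
      simp [hD, hd, he, hne]
  have hint : ∀ x, 0 < x → HasDerivAt (fun x => (Ec x).re) (-D x) x := fun x hx =>
    (hEd x hx.le).hasDerivAt (Ici_mem_nhds hx)
  have hanti : AntitoneOn (fun x => (Ec x).re) (Set.Ici 0) := by
    refine antitoneOn_of_deriv_nonpos (convex_Ici 0) (fun x hx => (hEd x hx).continuousWithinAt)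
      (fun x hx => ?_) fun x hx => ?_
    · rw [interior_Ici] at hx
      exact (hint x hx).differentiableAt.differentiableWithinAt
    · rw [interior_Ici] at hx
      rw [(hint x hx).deriv]
      linarith [hD0 x (le_of_lt hx)]
  have hKlim : ∀ {f : ℝ → ℂ}, Tendsto f atTop (𝓝 0) → Tendsto (fun x => K x * f x) atTop (𝓝 0) := by
    intro f hf
    refine squeeze_zero_norm' (a := fun x => 4 * ‖f x‖) ?_ (by simpa using hf.norm.const_mul 4)
    filter_upwards [eventually_ge_atTop 0] with x hx
    rw [norm_mul]
    refine mul_le_mul_of_nonneg_right ((hK x hx).2.1.trans ?_) (norm_nonneg _)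
    have : ‖z‖ / (1 + ‖z‖) ≤ 1 := by rw [div_le_one (by linarith)]; linarith
    linarith
  have hpq : Tendsto (fun x => p x + q x) atTop (𝓝 0) := by simpa using hp0.add hq0
  have hd0 : Tendsto d atTop (𝓝 0) := by
    have := (hr0.sub (hKlim hpq)).add ((hKlim hp0).const_mul k)
    simpa [hd, mul_assoc] using this
  have hE0 : Tendsto (fun x => (Ec x).re) atTop (𝓝 0) := by
    have hpc : Tendsto (fun x => conj (p x)) atTop (𝓝 0) := by
      simpa [Function.comp_def] using (Complex.continuous_conj.tendsto _).comp hp0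
    have hdc : Tendsto (fun x => conj (d x)) atTop (𝓝 0) := by
      simpa [Function.comp_def] using (Complex.continuous_conj.tendsto _).comp hd0
    have h1 := ((hq0.mul hpc).add ((((hq0.sub hp0).const_mul (conj z)).mul hpc).const_mul
      (ω : ℂ))).sub ((hd0.mul hdc).const_mul (b : ℂ))
    have h2 := (Complex.continuous_re.tendsto _).comp h1
    simp only [mul_zero, add_zero, sub_zero, Complex.zero_re] at h2
    exact h2
  have hstart : (Ec 0).re ≤ 0 := by
    have : Ec 0 = ((-(b * ‖d 0‖ ^ 2) : ℝ) : ℂ) := by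
      simp only [hEc, hp, map_zero, mul_zero, zero_sub, add_zero]
      rw [Complex.mul_conj, Complex.normSq_eq_norm_sq]
      push_cast; ring
    rw [this, Complex.ofReal_re]
    have : 0 ≤ b * ‖d 0‖ ^ 2 := by positivity
    linarith
  -- The energy is nonincreasing, starts at most `0` and tends to `0`. The sign at the start uses `p
  -- 0 = 0`, which leaves only `-b |d 0|²`.
  have hzero : ∀ x, 0 ≤ x → (Ec x).re = 0 := by
    intro x hx
    refine le_antisymm ((hanti (Set.mem_Ici.2 le_rfl) hx hx).trans hstart) ?_
    exact le_of_tendsto hE0 (by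
      filter_upwards [eventually_ge_atTop x] with y hy
      exact hanti hx (Set.mem_Ici.2 (hx.trans hy)) hy)
  by_contra hcon
  have hne : p x₀ ≠ 0 ∨ q x₀ ≠ 0 ∨ r x₀ ≠ 0 := by
    by_contra! h
    exact hcon h
  have h1 : HasDerivAt (fun x => (Ec x).re) 0 x₀ := by
    refine (hasDerivAt_const x₀ (0 : ℝ)).congr_of_eventuallyEq ?_
    filter_upwards [Ici_mem_nhds hx₀] with x hx using hzero x hx
  have h2 := h1.unique (hint x₀ hx₀)
  have := hDpos x₀ hx₀.le hne
  linarith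

end Energy

/-! ### The adjoint equation in conjugate components, and the decaying mode. -/

section Stability

open ComplexConjugate

variable {γ vp v0 : ℝ} {vhat : ℝ → ℝ} {z : ℂ}

lemma IsAdjointSolution.isRowSolution {W : ℝ → Fin 3 → ℂ} (h : IsAdjointSolution γ vp vhat z W) :
    IsRowSolution vhat (fun x => -fFun γ vp (vhat x)) z
      (fun x => conj (W x 0)) (fun x => conj (W x 1)) (fun x => conj (W x 2)) := by
  refine ⟨fun x hx => ?_, fun x hx => ?_, fun x hx => ?_⟩
  · have := (hasDerivWithinAt_pi.1 (h x hx) 0).star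
    convert! this using 1
    simp [evansMatrix, Matrix.mulVec, dotProduct, Fin.sum_univ_three]
  · have := (hasDerivWithinAt_pi.1 (h x hx) 1).star
    convert! this using 1
    simp [evansMatrix, Matrix.mulVec, dotProduct, Fin.sum_univ_three]
    ring
  · have := (hasDerivWithinAt_pi.1 (h x hx) 2).star
    convert! this using 1
    simp [evansMatrix, Matrix.mulVec, dotProduct, Fin.sum_univ_three]
    ring

lemma IsRowSolution.isAdjointSolution {p q r : ℝ → ℂ}
    (h : IsRowSolution vhat (fun x => -fFun γ vp (vhat x)) z p q r) :
    IsAdjointSolution γ vp vhat z (fun x => ![conj (p x), conj (q x), conj (r x)]) := by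
  intro x hx
  rw [hasDerivWithinAt_pi]
  intro i
  fin_cases i
  · convert! (h.left x hx).star using 1
    simp [evansMatrix, Matrix.mulVec, dotProduct, Fin.sum_univ_three]
  · convert! (h.mid x hx).star using 1
    simp [evansMatrix, Matrix.mulVec, dotProduct, Fin.sum_univ_three]
    ring
  · convert! (h.right x hx).star using 1
    simp [evansMatrix, Matrix.mulVec, dotProduct, Fin.sum_univ_three]
    ring

/-- The eigenvalue relation for the conjugate `(P, Q, R)` of an eigenvector of `-A₊(z)^*`. -/
lemma conj_eigen {μ : ℂ} {V : Fin 3 → ℂ} :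
    -(evansMatrix γ vp vp z)ᴴ *ᵥ V = μ • V ↔
      vp * conj (V 2) = -conj μ * conj (V 0) ∧
      z * conj (V 0) + vp * conj (V 2) = -conj μ * conj (V 1) ∧
      z * conj (V 0) + z * conj (V 1) + (fFun γ vp vp - z) * conj (V 2) =
        -conj μ * conj (V 2) := by
  rw [funext_iff, Fin.forall_fin_succ, Fin.forall_fin_succ, Fin.forall_fin_succ]
  have key : ∀ a b : ℂ, -a = b ↔ conj a = -conj b := by
    intro a b
    rw [← map_neg, RingHom.injective (starRingEnd ℂ) |>.eq_iff, neg_eq_iff_eq_neg]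
  simp only [Matrix.neg_mulVec, Pi.neg_apply, Pi.smul_apply, smul_eq_mul, key]
  simp [evansMatrix, Matrix.mulVec, dotProduct, Fin.sum_univ_three, add_assoc]

namespace IsDecayingAdjointEigenpair

variable {μ : ℂ → ℂ} {V : ℂ → Fin 3 → ℂ}

/-- At `z = 0` the eigenvalue of the decaying mode vanishes, and the first component of the
eigenvector does not. -/
lemma at_zero (hvp : 0 < vp) (hf : fFun γ vp vp < 0)
    (h : IsDecayingAdjointEigenpair γ vp μ V) : μ 0 = 0 ∧ V 0 0 ≠ 0 := by
  have hc : ∀ i, ContinuousAt (fun w => conj (V w i)) 0 := fun i =>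
    (continuous_apply i).continuousAt.comp (h.analytic 0 (by simp)).continuousAt
  have hcr : ∀ i, Tendsto (fun t : ℝ => conj (V t i)) (𝓝[>] 0) (𝓝 (conj (V 0 i))) := by
    intro i
    refine (hc i).tendsto.comp ?_
    have : Tendsto (fun t : ℝ => (t : ℂ)) (𝓝 0) (𝓝 ((0 : ℝ) : ℂ)) :=
      Complex.continuous_ofReal.tendsto 0
    simpa using this.mono_left nhdsWithin_le_nhds
  have ht : Tendsto (fun t : ℝ => (t : ℂ)) (𝓝[>] 0) (𝓝 0) := by
    have : Tendsto (fun t : ℝ => (t : ℂ)) (𝓝 0) (𝓝 ((0 : ℝ) : ℂ)) :=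
      Complex.continuous_ofReal.tendsto 0
    simpa using this.mono_left nhdsWithin_le_nhds
  have hE : ∀ t : ℝ, 0 < t → _ := fun t ht => conj_eigen.1 (h.eigen t (by simpa using ht.le))
  obtain ⟨e1, e2, e3⟩ := conj_eigen.1 (h.eigen 0 (by simp))
  -- Otherwise the eigenvalue `-conj (μ 0)` would be `f(vp) < 0`, yet it would also be the limit,
  -- along positive reals, of numbers with positive real part.
  have hR : conj (V 0 2) = 0 := by
    by_contra hR
    have hm : -conj (μ 0) = fFun γ vp vp := by
      refine mul_right_cancel₀ hR ?_
      rw [← e3]; ring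
    have hlim : Tendsto (fun t : ℝ => ((t : ℂ) * conj (V t 0) + t * conj (V t 1) +
        (fFun γ vp vp - t) * conj (V t 2)) / conj (V t 2)) (𝓝[>] 0)
        (𝓝 ((0 * conj (V 0 0) + 0 * conj (V 0 1) +
        (fFun γ vp vp - 0) * conj (V 0 2)) / conj (V 0 2))) :=
      (((ht.mul (hcr 0)).add (ht.mul (hcr 1))).add ((ht.const_sub _).mul (hcr 2))).div (hcr 2) hR
    rw [e3, mul_div_cancel_right₀ _ hR, hm] at hlim
    have hlim' := (Complex.continuous_re.tendsto _).comp hlim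
    have : 0 ≤ ((fFun γ vp vp : ℝ) : ℂ).re := by
      refine ge_of_tendsto hlim' ?_
      filter_upwards [(hcr 2).eventually_ne hR, self_mem_nhdsWithin] with t ht2 ht0
      have ht0 : 0 < t := ht0
      simp only [Function.comp_apply]
      rw [(hE t ht0).2.2, mul_div_cancel_right₀ _ ht2]
      have := h.decaying t (by simpa using ht0.le) (by exact_mod_cast ht0.ne')
      simp; linarith
    simp at this
    linarith
  have hμ : μ 0 = 0 := by
    by_contra hμ
    have hμ' : -conj (μ 0) ≠ 0 := by simpa using hμ
    rw [hR] at e1 e2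
    simp only [mul_zero, zero_mul, zero_add, zero_eq_mul, hμ', false_or] at e1 e2
    refine h.ne_zero 0 (by simp) ?_
    funext i
    fin_cases i
    · simpa using e1
    · simpa using e2
    · simpa using hR
  refine ⟨hμ, fun hP => ?_⟩
  have hP' : conj (V 0 0) = 0 := by rw [hP, map_zero]
  -- Eliminating the eigenvalue from the eigenvector relations, which is legitimate for `t > 0` as
  -- it is nonzero there, leaves a homogeneous cubic relation. In the limit a vanishing first
  -- component forces the cube of the second to vanish.
  have key : ∀ t : ℝ, 0 < t → vp * (conj (V t 1) - conj (V t 0)) * (conj (V t 1) + conj (V t 0)) *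
      conj (V t 1) = (t * conj (V t 0) + vp * conj (V t 2) + (t - fFun γ vp vp) * conj (V t 1)) *
      conj (V t 0) ^ 2 := by
    intro t ht0
    obtain ⟨f1, f2, f3⟩ := hE t ht0
    have hm : -conj (μ t) ≠ 0 := by
      intro h0
      have := h.decaying t (by simpa using ht0.le) (by exact_mod_cast ht0.ne')
      rw [neg_eq_zero, map_eq_zero] at h0
      rw [h0] at this
      simp at this
    refine mul_left_cancel₀ hm ?_
    rw [f2]
    set m := -conj (μ t)
    linear_combination (vp * (conj (V t 1) + conj (V t 0)) * conj (V t 1)) * (f1 - f2)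
      + (conj (V t 0) * conj (V t 1) * (m + t - fFun γ vp vp)) * f1
      + vp * conj (V t 0) * conj (V t 1) * f3
  have hlim := tendsto_nhds_unique_of_eventuallyEq
    ((((hcr 1).sub (hcr 0)).const_mul (vp : ℂ)).mul ((hcr 1).add (hcr 0)) |>.mul (hcr 1))
    ((((ht.mul (hcr 0)).add ((hcr 2).const_mul (vp : ℂ))).add
      ((ht.sub_const (fFun γ vp vp : ℂ)).mul (hcr 1))).mul ((hcr 0).pow 2))
    (by filter_upwards [self_mem_nhdsWithin] with t ht using key t ht)
  rw [hP'] at hlim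
  have hQ : conj (V 0 1) = 0 := by
    have hvp' : (vp : ℂ) ≠ 0 := by exact_mod_cast hvp.ne'
    simpa [hvp'] using hlim
  refine h.ne_zero 0 (by simp) ?_
  funext i
  fin_cases i
  · simpa using hP
  · simpa using hQ
  · simpa using hR

end IsDecayingAdjointEigenpair

/-- A solution of the adjoint equation with `e^{-μx} W → V`, `Re μ < 0`, decays, even after
multiplication with `x`. -/
lemma tendsto_mul_of_exp_decay {μ : ℂ} (hμ : μ.re < 0) {f : ℝ → ℂ} {c : ℂ}
    (h : Tendsto (fun x : ℝ => Complex.exp (-(μ * x)) * f x) atTop (𝓝 c)) :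
    Tendsto (fun x : ℝ => (x : ℂ) * f x) atTop (𝓝 0) := by
  have h1 : Tendsto (fun x : ℝ => (x : ℂ) * Complex.exp (μ * x)) atTop (𝓝 0) := by
    rw [tendsto_zero_iff_norm_tendsto_zero]
    have h2 := (Real.tendsto_pow_mul_exp_neg_atTop_nhds_zero 1).comp
      (tendsto_id.const_mul_atTop (by linarith : 0 < -μ.re))
    have h3 := h2.const_mul (1 / (-μ.re))
    rw [mul_zero] at h3
    refine h3.congr' ?_
    filter_upwards [eventually_ge_atTop 0] with x hx
    rw [norm_mul, Complex.norm_exp, Complex.norm_real, Real.norm_of_nonneg hx]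
    have : -μ.re ≠ 0 := by linarith
    simp only [Function.comp_apply, pow_one, id]
    rw [← mul_assoc, ← mul_assoc, one_div, inv_mul_cancel₀ this]
    simp
  have h2 := h1.mul h
  rw [zero_mul] at h2
  refine h2.congr fun x => ?_
  have : Complex.exp (μ * x) * Complex.exp (-(μ * x)) = 1 := by rw [← Complex.exp_add]; simp
  linear_combination (x * f x) * this

lemma tendsto_zero_of_tendsto_mul {f : ℝ → ℂ}
    (h : Tendsto (fun x : ℝ => (x : ℂ) * f x) atTop (𝓝 0)) : Tendsto f atTop (𝓝 0) := by
  have h1 : Tendsto (fun x : ℝ => (x : ℂ)⁻¹) atTop (𝓝 0) := by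
    rw [tendsto_zero_iff_norm_tendsto_zero]
    refine tendsto_inv_atTop_zero.congr' ?_
    filter_upwards [eventually_ge_atTop 0] with x hx
    rw [norm_inv, Complex.norm_real, Real.norm_of_nonneg hx]
  have h2 := h1.mul h
  rw [zero_mul] at h2
  refine h2.congr' ?_
  filter_upwards [eventually_gt_atTop 0] with x hx
  rw [← mul_assoc, inv_mul_cancel₀ (by exact_mod_cast hx.ne'), one_mul]

end Stability

/-! ### Nonvanishing at the boundary and exclusion of eigenvalues. -/

section Stability

open ComplexConjugate

variable {γ vp v0 : ℝ} {vhat : ℝ → ℝ} {z : ℂ}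

lemma tendsto_exp_mul_apply {μ : ℂ} {V : Fin 3 → ℂ} {W : ℝ → Fin 3 → ℂ}
    (h : Tendsto (fun x : ℝ => Complex.exp (-(μ * (x : ℂ))) • W x) atTop (𝓝 V)) (i : Fin 3) :
    Tendsto (fun x : ℝ => Complex.exp (-(conj μ * (x : ℂ))) * conj (W x i)) atTop
      (𝓝 (conj (V i))) := by
  have h1 := (Complex.continuous_conj.tendsto _).comp ((tendsto_pi_nhds.1 h) i)
  refine h1.congr fun x => ?_
  simp [← Complex.exp_conj]

/-- The decaying solution of the adjoint equation has a nonzero first component at the boundary,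
uniformly for `z ≠ 0` in the closed right half plane. -/
theorem exists_forall_adjointSolution_ne_zero (hγ : 1 ≤ γ) :
    ∃ ε > 0, ∀ (vp v0 : ℝ) (vhat : ℝ → ℝ), IsCompressiveInflowLayer γ vp v0 vhat → v0 < ε →
      ∀ (z μ : ℂ) (V : Fin 3 → ℂ) (W : ℝ → Fin 3 → ℂ), 0 ≤ z.re → z ≠ 0 → μ.re < 0 → V ≠ 0 →
        IsAdjointSolution γ vp vhat z W →
        Tendsto (fun x : ℝ => Complex.exp (-(μ * (x : ℂ))) • W x) atTop (𝓝 V) → W 0 0 ≠ 0 := by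
  obtain ⟨ε, hε, key⟩ := exists_forall_rowSolution_eq_zero (γ + 1) (2 * (γ ^ 2 + 1))
    (by linarith) (by positivity)
  refine ⟨min ε (1 / 4), by positivity, ?_⟩
  intro vp v0 vhat hl hv0 z μ V W hz hz0 hμ hV hW hlim hcon
  have hv1 : v0 < ε := hv0.trans_le (min_le_left _ _)
  have hv2 : v0 < 1 / 4 := hv0.trans_le (min_le_right _ _)
  have hl0 : ∀ i, Tendsto (fun x => conj (W x i)) atTop (𝓝 0) := fun i =>
    tendsto_zero_of_tendsto_mul (tendsto_mul_of_exp_decay (by simpa using hμ)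
      (tendsto_exp_mul_apply hlim i))
  have hzero := key z vhat _ _ _ _ _ hz hz0
    (continuous_iff_continuousAt.2 fun x => (hl.hasDerivAt_fFun x).neg.continuousAt)
    (fun x hx => ⟨hl.pos x, (hl.le_boundary hγ hx).trans hv1.le,
      neg_fFun_ge hγ hl.vp_pos hl.vp_lt_one (hl.endState_lt hγ hx).le
        ((hl.le_boundary hγ hx).trans hv2.le),
      neg_fFun_le hγ hl.vp_pos hl.vp_lt_one (hl.endState_lt hγ hx).le,
      (hl.hasDerivAt_fFun x).neg, by
        rw [abs_neg]; exact hl.abs_deriv_fFun_le hγ hv2.le hx⟩)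
    hW.isRowSolution (hl0 0) (hl0 1) (hl0 2) (by simp [hcon])
  -- A solution vanishing for all `x > 0` would have asymptotic amplitude `V = 0`.
  refine hV (tendsto_nhds_unique hlim ?_)
  refine tendsto_const_nhds.congr' ?_
  filter_upwards [eventually_gt_atTop 0] with x hx
  obtain ⟨h0, h1, h2⟩ := hzero x hx
  have : W x = 0 := by
    funext i
    fin_cases i
    · simpa using h0
    · simpa using h1
    · simpa using h2
  rw [this, smul_zero]

/-- At `z = 0` the bounded solutions of the adjoint equation are constant in the first component. -/
lemma IsAdjointSolution.first_component_of_zero (hγ : 1 ≤ γ)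
    (hl : IsCompressiveInflowLayer γ vp v0 vhat) (hv0 : v0 ≤ 1 / 4) {W : ℝ → Fin 3 → ℂ}
    {V : Fin 3 → ℂ} (hW : IsAdjointSolution γ vp vhat 0 W) (hlim : Tendsto W atTop (𝓝 V)) :
    W 0 0 = V 0 := by
  have hF : Continuous fun x => -fFun γ vp (vhat x) :=
    continuous_iff_continuousAt.2 fun x => (hl.hasDerivAt_fFun x).neg.continuousAt
  have hs := hW.isRowSolution
  have hl2 : Tendsto (fun x => conj (W x 2)) atTop (𝓝 (conj (V 2))) :=
    (Complex.continuous_conj.tendsto _).comp ((tendsto_pi_nhds.1 hlim) 2)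
  have hbdd : ∃ C, ∀ x, 0 ≤ x → ‖conj (W x 2)‖ ≤ C := by
    obtain ⟨N, hN⟩ := eventually_atTop.1 (hl2.norm.eventually_le_const
      (lt_add_one ‖conj (V 2)‖))
    have hcont : ContinuousOn (fun x => conj (W x 2)) (Set.Icc 0 N) := fun x hx =>
      ((hs.right x hx.1).continuousWithinAt).mono fun y hy => hy.1
    obtain ⟨C, hC⟩ := isCompact_Icc.exists_bound_of_continuousOn hcont
    refine ⟨max C (‖conj (V 2)‖ + 1), fun x hx => ?_⟩
    rcases le_total x N with h | h
    · exact (hC x ⟨hx, h⟩).trans (le_max_left _ _)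
    · exact (hN x h).trans (le_max_right _ _)
  obtain ⟨C, hC⟩ := hbdd
  -- At `z = 0` the third component satisfies `r' = F r` with `F ≥ 1/2`, whose only bounded solution
  -- is zero.
  have hR : ∀ x, 0 ≤ x → W x 2 = 0 := by
    intro x hx
    have := norm_le_of_bounded_solution (z := 0) (F₀ := 1 / 2) (g := fun _ => 0) (G := 0) le_rfl hF
      (by norm_num) (fun x hx => neg_fFun_ge hγ hl.vp_pos hl.vp_lt_one (hl.endState_lt hγ hx).le
        ((hl.le_boundary hγ hx).trans hv0))
      (fun x hx => by simpa using hs.right x hx) hC (fun x hx => by simp) hx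
    simpa using this
  have hconst : ∀ x, 0 ≤ x → conj (W x 0) = conj (W 0 0) := by
    intro x hx
    refine constant_of_has_deriv_right_zero (a := 0) (b := x) (f := fun x => conj (W x 0))
      (fun y hy => ((hs.left y hy.1).continuousWithinAt).mono fun t ht => ht.1)
      (fun y hy => ?_) x ⟨hx, le_rfl⟩
    have := hs.left y hy.1
    rw [hR y hy.1] at this
    simpa using this.mono (Set.Ici_subset_Ici.2 hy.1)
  refine tendsto_nhds_unique (tendsto_const_nhds.congr' ?_) ((tendsto_pi_nhds.1 hlim) 0)
  filter_upwards [eventually_ge_atTop 0] with x hx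
  exact (RingHom.injective (starRingEnd ℂ) (hconst x hx)).symm

/-- The eigenvalue equation as a first-order system. -/
structure IsColumnSolution (v F : ℝ → ℝ) (z : ℂ) (w α u : ℝ → ℂ) : Prop where
  fst : ∀ x, 0 ≤ x → HasDerivWithinAt w (z * (α x + u x)) (Set.Ici 0) x
  snd : ∀ x, 0 ≤ x → HasDerivWithinAt α (z * u x) (Set.Ici 0) x
  trd : ∀ x, 0 ≤ x →
    HasDerivWithinAt u (v x * (w x + α x) - (F x + z) * u x) (Set.Ici 0) x

/-- Gronwall for the linear system in the maximum norm. It ensures that a nontrivial eigenfunction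
has `w 0 ≠ 0`. -/
lemma IsColumnSolution.eq_zero {v F : ℝ → ℝ} {w α u : ℝ → ℂ} {M : ℝ}
    (h : IsColumnSolution v F z w α u) (hv : ∀ x, 0 ≤ x → |v x| ≤ 1)
    (hF : ∀ x, 0 ≤ x → |F x| ≤ M) (hw0 : w 0 = 0) (hα0 : α 0 = 0) (hu0 : u 0 = 0) {x : ℝ}
    (hx : 0 ≤ x) : w x = 0 ∧ α x = 0 ∧ u x = 0 := by
  set f : ℝ → ℂ × ℂ × ℂ := fun x => (w x, α x, u x) with hf
  have hd : ∀ t, 0 ≤ t → HasDerivWithinAt f (z * (α t + u t), z * u t,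
      v t * (w t + α t) - (F t + z) * u t) (Set.Ici 0) t := fun t ht =>
    (h.fst t ht).prodMk ((h.snd t ht).prodMk (h.trd t ht))
  have hM : 0 ≤ M := (abs_nonneg _).trans (hF 0 le_rfl)
  have hb := norm_le_gronwallBound_of_norm_deriv_right_le (f := f) (δ := 0)
    (K := 2 * ‖z‖ + M + 2) (ε := 0) (a := 0) (b := x)
    (fun t ht => ((hd t ht.1).continuousWithinAt).mono fun y hy => hy.1)
    (fun t ht => (hd t ht.1).mono (Set.Ici_subset_Ici.2 ht.1)) (by simp [hf, hw0, hα0, hu0])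
    (fun t ht => by
      have n1 : ‖w t‖ ≤ ‖f t‖ := le_max_left _ _
      have n2 : ‖α t‖ ≤ ‖f t‖ := (le_max_left _ _).trans (le_max_right _ _)
      have n3 : ‖u t‖ ≤ ‖f t‖ := (le_max_right _ _).trans (le_max_right _ _)
      have n0 : 0 ≤ ‖f t‖ := norm_nonneg _
      have nz := norm_nonneg z
      have m1 : ‖z * (α t + u t)‖ ≤ ‖z‖ * (2 * ‖f t‖) := by
        rw [norm_mul]
        exact mul_le_mul_of_nonneg_left ((norm_add_le _ _).trans (by linarith)) nz
      have m2 : ‖z * u t‖ ≤ ‖z‖ * ‖f t‖ := by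
        rw [norm_mul]
        exact mul_le_mul_of_nonneg_left n3 nz
      have m3 : ‖v t * (w t + α t) - (F t + z) * u t‖ ≤
          1 * (2 * ‖f t‖) + (M + ‖z‖) * ‖f t‖ := by
        refine (norm_sub_le _ _).trans (add_le_add ?_ ?_)
        · rw [norm_mul, Complex.norm_real]
          exact mul_le_mul (hv t ht.1) ((norm_add_le _ _).trans (by linarith)) (norm_nonneg _)
            zero_le_one
        · rw [norm_mul]
          refine mul_le_mul ((norm_add_le _ _).trans ?_) n3 (norm_nonneg _) (by positivity)
          rw [Complex.norm_real]
          linarith [hF t ht.1, Real.norm_eq_abs (F t)]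
      have pz : 0 ≤ ‖z‖ * ‖f t‖ := by positivity
      have pM : 0 ≤ M * ‖f t‖ := by positivity
      refine max_le ?_ (max_le ?_ ?_)
      · linarith
      · linarith
      · linarith) x ⟨hx, le_rfl⟩
  rw [gronwallBound_ε0_δ0] at hb
  have : f x = 0 := norm_le_zero_iff.1 hb
  simpa [hf] using this

/-- The pairing of a solution of the eigenvalue equation with a solution of the adjoint equation
is constant. -/
lemma IsColumnSolution.pairing_eq {v F : ℝ → ℝ} {w α u p q r : ℝ → ℂ}
    (h : IsColumnSolution v F z w α u) (h' : IsRowSolution v F z p q r) {x : ℝ} (hx : 0 ≤ x) :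
    p x * w x + q x * α x + r x * u x = p 0 * w 0 + q 0 * α 0 + r 0 * u 0 := by
  have hd : ∀ t, 0 ≤ t →
      HasDerivWithinAt (fun x => p x * w x + q x * α x + r x * u x) 0 (Set.Ici 0) t := by
    intro t ht
    convert! (((h'.left t ht).mul (h.fst t ht)).add ((h'.mid t ht).mul (h.snd t ht))).add
      ((h'.right t ht).mul (h.trd t ht)) using 1
    ring
  exact constant_of_has_deriv_right_zero (a := 0) (b := x)
    (fun y hy => ((hd y hy.1).continuousWithinAt).mono fun t ht => ht.1)
    (fun y hy => (hd y hy.1).mono (Set.Ici_subset_Ici.2 hy.1)) x ⟨hx, le_rfl⟩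

/-- A nontrivial eigenfunction gives a nontrivial solution of the first-order system with
`W(0) = (w(0), 0, 0)`. -/
lemma IsInflowEigenvalue.exists_columnSolution (hγ : 1 ≤ γ)
    (hl : IsCompressiveInflowLayer γ vp v0 vhat) (h : IsInflowEigenvalue γ vp vhat z) :
    ∃ w α u : ℝ → ℂ, IsColumnSolution vhat (fun x => -fFun γ vp (vhat x)) z w α u ∧
      w 0 ≠ 0 ∧ α 0 = 0 ∧ u 0 = 0 ∧ Tendsto α atTop (𝓝 0) ∧ Tendsto u atTop (𝓝 0) := by
  obtain ⟨v, u, du, hne, hv0, hu0, hvl, hul, hd⟩ := h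
  set g : ℝ → ℝ := fun y => hFun γ vp (vhat y) / vhat y ^ (γ + 1) with hg
  set w : ℝ → ℂ := fun y => (g y : ℂ) * v y + du y / (vhat y : ℂ) - u y with hw
  -- This solves the definition of `w` for `u'`, using `vhat g = vhat - f(vhat)`.
  have hdu : ∀ x, du x = vhat x * (w x + (u x - v x)) + (fFun γ vp (vhat x)) * v x := by
    intro x
    have hp := hl.pos x
    have hpc : (vhat x : ℂ) ≠ 0 := by exact_mod_cast hp.ne'
    have e : vhat x * g x = vhat x - fFun γ vp (vhat x) := by
      have hpow : 0 < vhat x ^ γ := Real.rpow_pos_of_pos hp _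
      simp only [hg, fFun]
      rw [Real.rpow_add_one hp.ne', Real.rpow_neg hp.le]
      field_simp
      ring
    have ec : (vhat x : ℂ) * g x = vhat x - fFun γ vp (vhat x) := by exact_mod_cast e
    simp only [hw]
    have e2 : (vhat x : ℂ) * (du x / vhat x) = du x := by field_simp
    linear_combination -v x * ec - e2
  have hsol : IsColumnSolution vhat (fun x => -fFun γ vp (vhat x)) z w (fun x => u x - v x) v := by
    refine ⟨fun x hx => ?_, fun x hx => ?_, fun x hx => ?_⟩
    · obtain ⟨h1, h2, h3⟩ := hd x hx
      convert! h3.sub h1 using 1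
      ring
    · obtain ⟨h1, h2, h3⟩ := hd x hx
      convert! h1.sub h2 using 1
      ring
    · obtain ⟨h1, h2, h3⟩ := hd x hx
      convert! h2 using 1
      rw [hdu x]
      push_cast
      ring
  refine ⟨w, fun x => u x - v x, v, hsol, fun hw0 => ?_, by simp [hv0, hu0], hv0, ?_, hvl⟩
  · obtain ⟨x, hx, hxne⟩ := hne
    have hb : ∀ x, 0 ≤ x → |fFun γ vp (vhat x)| ≤ γ + 4 := by
      intro x hx
      have h1 := neg_fFun_le hγ hl.vp_pos hl.vp_lt_one (hl.endState_lt hγ hx).le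
      have h2 := pressureCoeff_mul_rpow_nonneg hγ hl.vp_pos hl.vp_lt_one (hl.pos x)
      have h3 := pressureCoeff_pos hγ hl.vp_pos hl.vp_lt_one
      have h4 := (hl.le_boundary hγ hx).trans hl.v0_lt_one.le
      have h5 := mul_nonneg (by linarith : 0 ≤ γ - 1) h2
      have h6 := fFun_eq (γ := γ) (vp := vp) (hl.pos x)
      rw [abs_le]
      constructor <;> linarith
    obtain ⟨-, h2, h3⟩ := hsol.eq_zero (M := γ + 4)
      (fun t ht => by
        rw [abs_of_pos (hl.pos t)]
        exact (hl.le_boundary hγ ht).trans hl.v0_lt_one.le)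
      (fun t ht => by rw [abs_neg]; exact hb t ht) hw0 (by simp [hv0, hu0]) hv0 hx
    rw [h3, sub_zero] at h2
    rcases hxne with h | h
    · exact h h3
    · exact h h2
  · simpa using hul.sub hvl

/-- `z = 0` is not an eigenvalue. -/
lemma not_isInflowEigenvalue_zero (hγ : 1 ≤ γ) (hl : IsCompressiveInflowLayer γ vp v0 vhat) :
    ¬ IsInflowEigenvalue γ vp vhat 0 := by
  intro h
  obtain ⟨w, α, u, hs, hw0, hα0, hu0, hαl, hul⟩ := h.exists_columnSolution hγ hl
  have hconst : ∀ f : ℝ → ℂ, (∀ x, 0 ≤ x → HasDerivWithinAt f 0 (Set.Ici 0) x) → ∀ x, 0 ≤ x →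
      f x = f 0 := fun f hf x hx =>
    constant_of_has_deriv_right_zero (a := 0) (b := x)
      (fun y hy => ((hf y hy.1).continuousWithinAt).mono fun t ht => ht.1)
      (fun y hy => (hf y hy.1).mono (Set.Ici_subset_Ici.2 hy.1)) x ⟨hx, le_rfl⟩
  have hw : ∀ x, 0 ≤ x → w x = w 0 := hconst w fun x hx => by simpa using hs.fst x hx
  have hα : ∀ x, 0 ≤ x → α x = 0 := fun x hx =>
    (hconst α (fun x hx => by simpa using hs.snd x hx) x hx).trans hα0
  set u' : ℝ → ℂ := fun x => vhat x * w 0 + fFun γ vp (vhat x) * u x with hu'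
  have hd : ∀ x, 0 ≤ x → HasDerivWithinAt u (u' x) (Set.Ici 0) x := by
    intro x hx
    convert! hs.trd x hx using 1
    rw [hw x hx, hα x hx, hu']
    push_cast
    ring
  have hvl : Tendsto (fun x => (vhat x : ℂ)) atTop (𝓝 vp) :=
    (Complex.continuous_ofReal.tendsto _).comp hl.at_top
  have hfl : Tendsto (fun x => (fFun γ vp (vhat x) : ℂ)) atTop (𝓝 (fFun γ vp vp)) := by
    have : ContinuousAt (fFun γ vp) vp := by
      have h1 : ContinuousAt (fun s : ℝ => 2 * s - 1 - pressureCoeff γ vp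
          - (γ - 1) * (pressureCoeff γ vp * s ^ (-γ))) vp := by
        have := Real.continuousAt_rpow_const vp (-γ) (Or.inl hl.vp_pos.ne')
        fun_prop
      refine h1.congr ?_
      filter_upwards [Ioi_mem_nhds hl.vp_pos] with s hs
      rw [fFun_eq hs]
    exact (Complex.continuous_ofReal.tendsto _).comp (this.tendsto.comp hl.at_top)
  have hul' : Tendsto u' atTop (𝓝 (vp * w 0)) := by
    have := (hvl.mul_const (w 0)).add (hfl.mul hul)
    simpa using this
  -- The derivative of `u` tends to `vp * w 0 ≠ 0`, so unit increments of `u` cannot tend to `0`.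
  have hlim : Tendsto (fun x => u (x + 1) - u x) atTop (𝓝 0) := by
    have := (hul.comp (tendsto_atTop_add_const_right atTop 1 tendsto_id)).sub hul
    simpa using this
  set c : ℂ := vp * w 0 with hc
  have hc0 : 0 < ‖c‖ := norm_pos_iff.2
    (mul_ne_zero (by exact_mod_cast hl.vp_pos.ne') hw0)
  have hev := (tendsto_iff_norm_sub_tendsto_zero.1 hul').eventually_le_const
    (half_pos hc0)
  obtain ⟨N, hN⟩ := eventually_atTop.1 (hev.and (eventually_ge_atTop 0))
  have hbd : ∀ x, N ≤ x → ‖u (x + 1) - u x - c‖ ≤ ‖c‖ / 2 := by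
    intro x hx
    have hx0 := (hN x hx).2
    have := norm_image_sub_le_of_norm_deriv_right_le_segment (a := x) (b := x + 1)
      (f := fun t => u t - c * (t : ℂ)) (f' := fun t => u' t - c) (C := ‖c‖ / 2)
      (fun t ht => by
        have h1 : ContinuousWithinAt u (Set.Icc x (x + 1)) t :=
          ((hd t (hx0.trans ht.1)).continuousWithinAt).mono fun y hy => hx0.trans hy.1
        exact h1.sub (by fun_prop))
      (fun t ht => by
        have h1 := (hd t (hx0.trans ht.1)).mono (Set.Ici_subset_Ici.2 (hx0.trans ht.1))
        have h2 : HasDerivAt (fun t : ℝ => (t : ℂ)) 1 t := Complex.ofRealCLM.hasDerivAt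
        have h3 := h1.sub ((h2.const_mul c).hasDerivWithinAt (s := Set.Ici t))
        rw [mul_one] at h3
        exact h3)
      (fun t ht => (hN t (hx.trans ht.1)).1) (x + 1) ⟨by linarith, le_rfl⟩
    refine le_trans (le_of_eq ?_) (this.trans (by simp))
    congr 1
    push_cast
    ring
  have hl2 := le_of_tendsto ((hlim.sub_const c).norm)
    (by filter_upwards [eventually_ge_atTop N] with x hx using hbd x hx)
  rw [zero_sub, norm_neg] at hl2
  linarith

/-- The decaying solution of the adjoint equation rules out eigenvalues if its first component
does not vanish at the boundary. -/
lemma not_isInflowEigenvalue_of_rowSolution (hγ : 1 ≤ γ)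
    (hl : IsCompressiveInflowLayer γ vp v0 vhat) {p q r : ℝ → ℂ}
    (hs : IsRowSolution vhat (fun x => -fFun γ vp (vhat x)) z p q r)
    (hp : Tendsto (fun x : ℝ => (x : ℂ) * p x) atTop (𝓝 0)) (hq : Tendsto q atTop (𝓝 0))
    (hr : Tendsto r atTop (𝓝 0)) (hp0 : p 0 ≠ 0) : ¬ IsInflowEigenvalue γ vp vhat z := by
  intro h
  obtain ⟨w, α, u, hc, hw0, hα0, hu0, hαl, hul⟩ := h.exists_columnSolution hγ hl
  -- `w` is not assumed to decay, but `w' = z (α + u)` is bounded. Linear growth is beaten by `p`,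
  -- because `x p(x) → 0`.
  have hbdd : ∃ C, ∀ x, 0 ≤ x → ‖w x‖ ≤ ‖w 0‖ + C * x := by
    have hlim : Tendsto (fun x => z * (α x + u x)) atTop (𝓝 0) := by
      simpa using (hαl.add hul).const_mul z
    obtain ⟨N, hN⟩ := eventually_atTop.1 (hlim.norm.eventually_le_const
      (by simp : ‖(0 : ℂ)‖ < 1))
    have hcont : ContinuousOn (fun x => z * (α x + u x)) (Set.Icc 0 N) := fun x hx =>
      ((((hc.snd x hx.1).continuousWithinAt).add ((hc.trd x hx.1).continuousWithinAt)).const_mul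
        z).mono fun y hy => hy.1
    obtain ⟨C, hC⟩ := isCompact_Icc.exists_bound_of_continuousOn hcont
    refine ⟨max C 1, fun x hx => ?_⟩
    have := norm_image_sub_le_of_norm_deriv_right_le_segment (a := 0) (b := x) (f := w)
      (C := max C 1)
      (fun t ht => ((hc.fst t ht.1).continuousWithinAt).mono fun y hy => hy.1)
      (fun t ht => (hc.fst t ht.1).mono (Set.Ici_subset_Ici.2 ht.1))
      (fun t ht => by
        rcases le_total t N with h | h
        · exact (hC t ⟨ht.1, h⟩).trans (le_max_left _ _)
        · exact (hN t h).trans (le_max_right _ _)) x ⟨hx, le_rfl⟩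
    have h2 := norm_sub_norm_le (w x) (w 0)
    rw [sub_zero] at this
    linarith
  obtain ⟨C, hC⟩ := hbdd
  have hpw : Tendsto (fun x => p x * w x) atTop (𝓝 0) := by
    refine squeeze_zero_norm' (a := fun x : ℝ => ‖w 0‖ * ‖p x‖ + C * ‖(x : ℂ) * p x‖) ?_ ?_
    · filter_upwards [eventually_ge_atTop 0] with x hx
      rw [norm_mul, norm_mul, Complex.norm_real, Real.norm_of_nonneg hx]
      have := mul_le_mul_of_nonneg_left (hC x hx) (norm_nonneg (p x))
      linarith
    · have := ((tendsto_zero_of_tendsto_mul hp).norm.const_mul ‖w 0‖).add (hp.norm.const_mul C)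
      simpa using this
  have hlim := (hpw.add (hq.mul hαl)).add (hr.mul hul)
  have heq : p 0 * w 0 = 0 := by
    refine tendsto_nhds_unique (tendsto_const_nhds.congr' ?_) (by simpa using hlim)
    filter_upwards [eventually_ge_atTop 0] with x hx
    rw [hc.pairing_eq hs hx, hα0, hu0]
    ring
  exact (mul_ne_zero hp0 hw0) heq

end Stability

/-! ### The analytic branch of the growing eigenvalue of `A₊(z)`. -/

section Eigenpair

open ComplexConjugate

/-- The spectral parameter as a function of the ratio `ξ` of the first two components of the
left eigenvector `(1, ξ, m / v)` of `A₊(z)`, where `G = v - f(v)`. -/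
def ratioMap (v G : ℝ) (ξ : ℂ) : ℂ := v * ξ ^ 2 - v * ξ - G + G / ξ

/-- The eigenvalue of `A₊(z)` as a function of the ratio `ξ`. -/
def ratioRate (v G : ℝ) (ξ : ℂ) : ℂ := v * ξ - G / ξ

variable {v G ρ : ℝ}

/-- The factorization `z = (ξ - 1) m` is the second of the eigenvector relations for `(1, ξ, m /
v)`. -/
lemma ratioMap_eq {ξ : ℂ} (hξ : ξ ≠ 0) : ratioMap v G ξ = (ξ - 1) * ratioRate v G ξ := by
  unfold ratioMap ratioRate
  field_simp
  ring

/-- This form exhibits `v ‖ξ‖² - G`, whose sign together with that of `Re ξ` decides the sign of `Re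
m`. -/
lemma ratioMap_re {ξ : ℂ} (hξ : ξ ≠ 0) : (ratioMap v G ξ).re =
    -(G - v * ‖ξ‖ ^ 2) * (1 - ξ.re / ‖ξ‖ ^ 2) - 2 * v * ξ.im ^ 2 := by
  have hN : (0 : ℝ) < ‖ξ‖ ^ 2 := by positivity
  have e : ‖ξ‖ ^ 2 = ξ.re ^ 2 + ξ.im ^ 2 := by
    rw [Complex.sq_norm, Complex.normSq_apply]; ring
  have h1 : (ratioMap v G ξ).re =
      v * (ξ.re ^ 2 - ξ.im ^ 2) - v * ξ.re - G + G * ξ.re / ‖ξ‖ ^ 2 := by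
    unfold ratioMap
    rw [Complex.add_re, Complex.div_re, ← Complex.sq_norm]
    simp [sq]
  rw [h1]
  field_simp
  rw [e]
  ring

lemma ratioRate_re {ξ : ℂ} : (ratioRate v G ξ).re = ξ.re * (v - G / ‖ξ‖ ^ 2) := by
  unfold ratioRate
  rw [Complex.sub_re, Complex.div_re, ← Complex.sq_norm]
  simp
  ring

lemma ne_zero_of_re_pos {ξ : ℂ} (h : 0 < ξ.re) : ξ ≠ 0 := by
  rintro rfl
  simp at h

lemma ratioRate_re_pos {ξ : ℂ} (hv : 0 < v) (hξ : 1 < ξ.re)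
    (hz : 0 ≤ (ratioMap v G ξ).re) (hz0 : ratioMap v G ξ ≠ 0) : 0 < (ratioRate v G ξ).re := by
  have h0 : ξ ≠ 0 := ne_zero_of_re_pos (by linarith)
  have hN : (0 : ℝ) < ‖ξ‖ ^ 2 := by positivity
  have e : ‖ξ‖ ^ 2 = ξ.re ^ 2 + ξ.im ^ 2 := by
    rw [Complex.sq_norm, Complex.normSq_apply]; ring
  have hlt : ξ.re / ‖ξ‖ ^ 2 < 1 := by
    rw [div_lt_one hN, e]; nlinarith [sq_nonneg ξ.im]
  rw [ratioRate_re]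
  refine mul_pos (by linarith) ?_
  rw [sub_pos, div_lt_iff₀ hN]
  by_contra! hcon
  rw [ratioMap_re h0] at hz
  have h1 : 0 ≤ (G - v * ‖ξ‖ ^ 2) * (1 - ξ.re / ‖ξ‖ ^ 2) :=
    mul_nonneg (by linarith) (by linarith)
  have h2 : 0 ≤ 2 * v * ξ.im ^ 2 := by positivity
  have h3 : ξ.im = 0 := by
    have : 2 * v * ξ.im ^ 2 = 0 := by linarith
    simpa [hv.ne'] using this
  have h4 : G = v * ‖ξ‖ ^ 2 := by
    have : (G - v * ‖ξ‖ ^ 2) * (1 - ξ.re / ‖ξ‖ ^ 2) = 0 := by linarith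
    rcases mul_eq_zero.1 this with h | h <;> linarith
  refine hz0 ?_
  have hξr : ξ = (ξ.re : ℂ) := Complex.ext (by simp) (by simp [h3])
  have h5 : (G : ℂ) = v * ξ ^ 2 := by
    rw [h4, e, h3]
    rw [hξr]
    push_cast
    simp
  rw [ratioMap_eq h0]
  unfold ratioRate
  rw [h5]
  field_simp
  ring

/-- Growing modes over the closed right half plane lie in `Re ξ ≥ √(G / v)`, inside the region where
the ratio map is injective. -/
lemma le_re_of_ratioRate_re_pos {ξ : ℂ} (hv : 0 < v)
    (hz : 0 ≤ (ratioMap v G ξ).re) (hm : 0 < (ratioRate v G ξ).re) :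
    0 < ξ.re ∧ G ≤ v * ξ.re ^ 2 := by
  have h0 : ξ ≠ 0 := by
    rintro rfl
    simp [ratioRate] at hm
  have hN : (0 : ℝ) < ‖ξ‖ ^ 2 := by positivity
  have e : ‖ξ‖ ^ 2 = ξ.re ^ 2 + ξ.im ^ 2 := by
    rw [Complex.sq_norm, Complex.normSq_apply]; ring
  rw [ratioRate_re] at hm
  rw [ratioMap_re h0] at hz
  have h2 : 0 ≤ 2 * v * ξ.im ^ 2 := by positivity
  have hpos : 0 < ξ.re := by
    by_contra! hx
    have hlt : v - G / ‖ξ‖ ^ 2 < 0 := by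
      by_contra! h
      linarith [mul_nonpos_of_nonpos_of_nonneg hx h]
    have h1 : 0 < G - v * ‖ξ‖ ^ 2 := by
      rw [sub_neg, lt_div_iff₀ hN] at hlt
      linarith
    have h3 : ξ.re / ‖ξ‖ ^ 2 ≤ 0 := div_nonpos_of_nonpos_of_nonneg hx hN.le
    have h4 : 0 < (G - v * ‖ξ‖ ^ 2) * (1 - ξ.re / ‖ξ‖ ^ 2) := mul_pos h1 (by linarith)
    linarith
  refine ⟨hpos, ?_⟩
  have hgt : 0 < v - G / ‖ξ‖ ^ 2 := by
    by_contra! h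
    linarith [mul_nonpos_of_nonneg_of_nonpos hpos.le h]
  have h1 : 0 < v * ‖ξ‖ ^ 2 - G := by
    rw [sub_pos, div_lt_iff₀ hN] at hgt
    linarith
  have h3 : 0 ≤ ξ.re / ‖ξ‖ ^ 2 := by positivity
  have h4 : 0 ≤ (v * ‖ξ‖ ^ 2 - G) * (ξ.re / ‖ξ‖ ^ 2) := mul_nonneg h1.le h3
  have h5 : 2 * v * ξ.im ^ 2 ≤ v * ‖ξ‖ ^ 2 - G := by linarith
  have h6 := sq_nonneg ξ.im
  rw [e] at h5 h1
  linarith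

/-- The difference quotient is `v (a + b) - v - G / (a b)`. Its real part is at least `v (2 ρ - 3)`,
since `|G / (a b)| ≤ G / ρ² = 2 v`. -/
lemma norm_sub_le_ratioMap (hv : 0 < v) (hG : 0 < G) (hρ : 4 ≤ ρ) (hρG : 2 * v * ρ ^ 2 = G)
    {a b : ℂ} (ha : ρ ≤ a.re) (hb : ρ ≤ b.re) :
    v * ‖a - b‖ ≤ ‖ratioMap v G a - ratioMap v G b‖ := by
  have ha0 : a ≠ 0 := ne_zero_of_re_pos (by linarith)
  have hb0 : b ≠ 0 := ne_zero_of_re_pos (by linarith)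
  have e : ratioMap v G a - ratioMap v G b = (v * (a + b) - v - G / (a * b)) * (a - b) := by
    unfold ratioMap
    field_simp
    ring
  rw [e, norm_mul]
  refine mul_le_mul_of_nonneg_right ?_ (norm_nonneg _)
  refine le_trans ?_ (Complex.re_le_norm _)
  have h1 : ‖(G : ℂ) / (a * b)‖ ≤ 2 * v := by
    rw [norm_div, norm_mul, Complex.norm_real, Real.norm_of_nonneg hG.le, div_le_iff₀
      (mul_pos (norm_pos_iff.2 ha0) (norm_pos_iff.2 hb0)), ← hρG]
    have h2 := ha.trans (Complex.re_le_norm a)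
    have h3 := hb.trans (Complex.re_le_norm b)
    have h4 : ρ ^ 2 ≤ ‖a‖ * ‖b‖ := by
      rw [sq]; exact mul_le_mul h2 h3 (by linarith) (norm_nonneg _)
    exact mul_le_mul_of_nonneg_left h4 (by positivity)
  have h2 := (Complex.re_le_norm _).trans h1
  simp only [Complex.sub_re, Complex.mul_re, Complex.add_re, Complex.ofReal_re, Complex.ofReal_im,
    zero_mul, sub_zero] at h2 ⊢
  nlinarith

lemma hasStrictDerivAt_ratioMap {ξ : ℂ} (hξ : ξ ≠ 0) :
    HasStrictDerivAt (ratioMap v G) (2 * v * ξ - v - G / ξ ^ 2) ξ := by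
  have e : ratioMap v G = fun y : ℂ => v * y ^ 2 - v * y - G + G * y⁻¹ := by
    funext y
    simp only [ratioMap, div_eq_mul_inv]
  rw [e]
  have h1 := (hasStrictDerivAt_pow 2 ξ).const_mul (v : ℂ)
  have h2 := (hasStrictDerivAt_id ξ).const_mul (v : ℂ)
  have h3 := (hasStrictDerivAt_inv hξ).const_mul (G : ℂ)
  have h4 : HasStrictDerivAt (fun y : ℂ => v * y ^ 2 - v * y - G + G * y⁻¹)
      (v * (2 * ξ ^ (2 - 1)) - v * 1 + G * -(ξ ^ 2)⁻¹) ξ := ((h1.sub h2).sub_const (G : ℂ)).add h3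
  convert! h4 using 1
  simp only [Nat.add_one_sub_one, pow_one, mul_one, div_eq_mul_inv]
  ring

lemma ratioMap_deriv_ne_zero (hv : 0 < v) (hG : 0 < G) (hρ : 4 ≤ ρ) (hρG : 2 * v * ρ ^ 2 = G)
    {ξ : ℂ} (hξ : ρ ≤ ξ.re) : (2 * v * ξ - v - G / ξ ^ 2 : ℂ) ≠ 0 := by
  have h0 : ξ ≠ 0 := ne_zero_of_re_pos (by linarith)
  intro h
  have h1 : ‖(G : ℂ) / ξ ^ 2‖ ≤ 2 * v := by
    rw [norm_div, norm_pow, Complex.norm_real, Real.norm_of_nonneg hG.le, div_le_iff₀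
      (by positivity), ← hρG]
    have h2 := pow_le_pow_left₀ (by linarith) (hξ.trans (Complex.re_le_norm ξ)) 2
    exact mul_le_mul_of_nonneg_left h2 (by positivity)
  have h2 := (Complex.re_le_norm _).trans h1
  have h3 := congrArg Complex.re h
  rw [Complex.sub_re] at h3
  simp only [Complex.sub_re, Complex.mul_re, Complex.ofReal_re, Complex.ofReal_im, Complex.re_ofNat,
    Complex.im_ofNat, Complex.zero_re, Complex.mul_im, zero_mul, mul_zero, sub_zero, add_zero]
    at h2 h3
  nlinarith

/-- The ratio map has an inverse on a neighbourhood of the closed right half plane. -/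
lemma exists_ratio (hv : 0 < v) (hG : 0 < G) (hρ : 4 ≤ ρ) (hρG : 2 * v * ρ ^ 2 = G) {z : ℂ}
    (hz : -(G / 4) < z.re) : ∃ ξ : ℂ, ρ < ξ.re ∧ ratioMap v G ξ = z := by
  set A : Set ℂ := ratioMap v G '' {ξ | ρ < ξ.re} with hA
  have hAo : IsOpen A := by
    rw [isOpen_iff_mem_nhds]
    rintro _ ⟨ξ, hξ, rfl⟩
    have hξ' : ρ < ξ.re := hξ
    rw [← (hasStrictDerivAt_ratioMap (ne_zero_of_re_pos (by linarith))).map_nhds_eq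
      (ratioMap_deriv_ne_zero hv hG hρ hρG hξ'.le)]
    exact image_mem_map ((isOpen_lt continuous_const Complex.continuous_re).mem_nhds hξ)
  have hH : IsPreconnected {z : ℂ | -(G / 4) < z.re} :=
    (convex_halfSpace_re_gt _).isPreconnected
  -- The image is open, contains `0 = ratioMap (√(G / v))`, and is relatively closed in the
  -- connected half plane, hence covers it.
  have hsub : {z : ℂ | -(G / 4) < z.re} ⊆ A := by
    refine hH.subset_of_closure_inter_subset hAo ?_ ?_
    · set ξ : ℝ := Real.sqrt (G / v) with hξ
      have hξ2 : ξ ^ 2 = G / v := Real.sq_sqrt (by positivity)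
      have hξρ : ρ < ξ := by
        refine lt_of_pow_lt_pow_left₀ 2 (Real.sqrt_nonneg _) ?_
        rw [hξ2, lt_div_iff₀ hv]
        nlinarith
      have hξ0 : (ξ : ℂ) ≠ 0 := by
        have : ξ ≠ 0 := by linarith
        exact_mod_cast this
      have hmap : ratioMap v G ξ = 0 := by
        rw [ratioMap_eq hξ0, ratioRate]
        have : (v : ℂ) * ξ ^ 2 = G := by
          have : v * ξ ^ 2 = G := by rw [hξ2]; field_simp
          exact_mod_cast this
        have h2 : (v : ℂ) * ξ - G / ξ = 0 := by
          rw [← this]; field_simp; ring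
        rw [h2, mul_zero]
      exact ⟨0, by simp [hG], ξ, by simpa using hξρ, hmap⟩
    · rintro w ⟨hw, hwH⟩
      obtain ⟨s, hs, hsl⟩ := mem_closure_iff_seq_limit.1 hw
      choose ξ hξ hξs using hs
      have hξ' : ∀ n, ρ < (ξ n).re := hξ
      have hcs : CauchySeq ξ := by
        rw [Metric.cauchySeq_iff]
        intro ε hε
        obtain ⟨N, hN⟩ := Metric.cauchySeq_iff.1 hsl.cauchySeq (v * ε) (by positivity)
        refine ⟨N, fun m hm n hn => ?_⟩
        have h1 := hN m hm n hn
        rw [dist_eq_norm] at h1 ⊢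
        have h2 := norm_sub_le_ratioMap hv hG hρ hρG (hξ' m).le (hξ' n).le
        rw [hξs, hξs] at h2
        exact lt_of_mul_lt_mul_left (h2.trans_lt h1) hv.le
      obtain ⟨ξ₀, hξ₀⟩ := cauchySeq_tendsto_of_complete hcs
      have hre : ρ ≤ ξ₀.re :=
        ge_of_tendsto ((Complex.continuous_re.tendsto _).comp hξ₀)
          (Eventually.of_forall fun n => (hξ' n).le)
      have h0 : ξ₀ ≠ 0 := ne_zero_of_re_pos (by linarith)
      have hmap : ratioMap v G ξ₀ = w := by
        have hcont : ContinuousAt (ratioMap v G) ξ₀ :=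
          (hasStrictDerivAt_ratioMap h0).hasDerivAt.continuousAt
        refine tendsto_nhds_unique (hcont.tendsto.comp hξ₀) ?_
        refine hsl.congr fun n => (hξs n).symm
      -- A limit point on the boundary line `Re ξ = ρ` is excluded, because the real part of the
      -- ratio map is below `-G / 4` there; this fixes the half plane.
      refine ⟨ξ₀, lt_of_le_of_ne hre fun heq => ?_, hmap⟩
      have hwre : -(G / 4) < w.re := hwH
      rw [← hmap, ratioMap_re h0, ← heq] at hwre
      have hN : (0 : ℝ) < ‖ξ₀‖ ^ 2 := by positivity
      have e : ‖ξ₀‖ ^ 2 = ρ ^ 2 + ξ₀.im ^ 2 := by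
        rw [Complex.sq_norm, Complex.normSq_apply, ← heq]; ring
      have e2 : -(G - v * ‖ξ₀‖ ^ 2) * (1 - ρ / ‖ξ₀‖ ^ 2) =
          -G + v * ‖ξ₀‖ ^ 2 + G * (ρ / ‖ξ₀‖ ^ 2) - v * ρ := by
        field_simp; ring
      have h3 : ρ / ‖ξ₀‖ ^ 2 ≤ 1 / 4 := by
        rw [div_le_div_iff₀ hN (by norm_num), e]
        nlinarith [sq_nonneg ξ₀.im]
      have h4 := mul_le_mul_of_nonneg_left h3 hG.le
      rw [e2] at hwre
      have h5 : v * ‖ξ₀‖ ^ 2 = G / 2 + v * ξ₀.im ^ 2 := by rw [e, ← hρG]; ring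
      have h6 : 0 ≤ v * ξ₀.im ^ 2 := by positivity
      have h7 : 0 < v * ρ := by positivity
      linarith
  exact hsub hz

/-- The analytic branch of the ratio. -/
lemma exists_analytic_ratio (hv : 0 < v) (hG : 0 < G) (hρ : 4 ≤ ρ) (hρG : 2 * v * ρ ^ 2 = G) :
    ∃ Ξ : ℂ → ℂ, DifferentiableOn ℂ Ξ {z | -(G / 4) < z.re} ∧
      ∀ z, -(G / 4) < z.re → ρ < (Ξ z).re ∧ ratioMap v G (Ξ z) = z := by
  choose! Ξ hΞ using fun (z : ℂ) (hz : -(G / 4) < z.re) => exists_ratio hv hG hρ hρG hz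
  refine ⟨Ξ, fun z hz => ?_, hΞ⟩
  have hopen : {z : ℂ | -(G / 4) < z.re} ∈ 𝓝 z :=
    (isOpen_lt continuous_const Complex.continuous_re).mem_nhds hz
  have hcont : ContinuousAt Ξ z := by
    rw [ContinuousAt, tendsto_iff_norm_sub_tendsto_zero]
    have hlim : Tendsto (fun w => v⁻¹ * ‖w - z‖) (𝓝 z) (𝓝 0) := by
      have := ((continuous_id.sub continuous_const : Continuous fun w : ℂ => w - z).norm.tendsto
        z).const_mul v⁻¹
      simpa using this
    refine squeeze_zero' (Eventually.of_forall fun _ => norm_nonneg _) ?_ hlim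
    filter_upwards [hopen] with w hw
    have := norm_sub_le_ratioMap hv hG hρ hρG (hΞ w hw).1.le (hΞ z hz).1.le
    rw [(hΞ w hw).2, (hΞ z hz).2] at this
    rwa [inv_mul_eq_div, le_div_iff₀ hv, mul_comm]
  have h0 : Ξ z ≠ 0 := ne_zero_of_re_pos (by linarith [(hΞ z hz).1])
  exact ((hasStrictDerivAt_ratioMap h0).hasDerivAt.of_local_left_inverse hcont
    (ratioMap_deriv_ne_zero hv hG hρ hρG (hΞ z hz).1.le)
    (by filter_upwards [hopen] with w hw using (hΞ w hw).2)).differentiableAt.differentiableWithinAt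

/-- A root of the characteristic polynomial of `A₊(z)` with positive real part is the one that
belongs to the analytic branch. -/
lemma eq_ratioRate_of_root (hv : 0 < v) (hG : 0 < G) (hρ : 4 ≤ ρ) (hρG : 2 * v * ρ ^ 2 = G)
    {z ξ m : ℂ} (hz : 0 ≤ z.re) (hξ : ρ < ξ.re) (hξz : ratioMap v G ξ = z) (hm : 0 < m.re)
    (hroot : m ^ 3 + (z + (G - v)) * m ^ 2 - 2 * v * z * m - v * z ^ 2 = 0) :
    m = ratioRate v G ξ := by
  have hm0 : m ≠ 0 := ne_zero_of_re_pos hm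
  -- The ratio belonging to the given root; it must coincide with `ξ` by injectivity.
  set ζ : ℂ := 1 + z / m with hζ
  have hzm : z = (ζ - 1) * m := by rw [hζ]; field_simp; ring
  have hrel : v * ζ ^ 2 - G = m * ζ := by
    refine mul_left_cancel₀ (pow_ne_zero 2 hm0) ?_
    rw [hzm] at hroot
    linear_combination -hroot
  have hζ0 : ζ ≠ 0 := by
    intro h
    rw [h] at hrel
    have : (G : ℂ) = 0 := by linear_combination -hrel
    exact hG.ne' (by exact_mod_cast this)
  have hrate : ratioRate v G ζ = m := by
    unfold ratioRate
    field_simp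
    linear_combination hrel
  have hmap : ratioMap v G ζ = z := by rw [ratioMap_eq hζ0, hrate, ← hzm]
  obtain ⟨h1, h2⟩ := le_re_of_ratioRate_re_pos (ξ := ζ) hv (by rw [hmap]; exact hz)
    (by rw [hrate]; exact hm)
  have h3 : ρ ≤ ζ.re := by
    refine le_of_sq_le_sq ?_ h1.le
    nlinarith
  have h4 := norm_sub_le_ratioMap hv hG hρ hρG h3 hξ.le
  rw [hmap, hξz, sub_self, norm_zero] at h4
  have h5 : ‖ζ - ξ‖ ≤ 0 := by
    by_contra! h
    have := mul_pos hv h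
    linarith
  have h6 : ζ = ξ := sub_eq_zero.1 (norm_le_zero_iff.1 h5)
  rw [← h6, hrate]

end Eigenpair

/-! ### Decaying solutions of asymptotically diagonal systems. -/

section DecayingSolution

open MeasureTheory BoundedContinuousFunction

variable {ι : Type*} [Fintype ι]

/-- Solution operator, by integration from infinity, of the diagonal system `Z' = b Z + h`. -/
def diagSolve (b : ι → ℂ) (h : ℝ → ι → ℂ) (x : ℝ) : ι → ℂ := fun i =>
  -(Complex.exp (b i * x) * ∫ y in Set.Ioi x, Complex.exp (-(b i * y)) * h y i)

variable {b : ι → ℂ} {c ψ : ℝ → ℝ} {k : ℝ}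

/-- A decreasing weight with logarithmic derivative `-2c`. -/
structure IsDecayWeight (c ψ : ℝ → ℝ) : Prop where
  pos : ∀ x, 0 < ψ x
  nonneg : ∀ x, 0 ≤ c x
  deriv : ∀ x, HasDerivAt ψ (-(2 * (c x * ψ x))) x
  lim : Tendsto ψ atTop (𝓝 0)

lemma IsDecayWeight.integrableOn (hψ : IsDecayWeight c ψ) (x : ℝ) :
    IntegrableOn (fun y => c y * ψ y) (Set.Ioi x) := by
  have h := integrableOn_Ioi_deriv_of_nonpos' (a := x) (fun y _ => hψ.deriv y)
    (fun y _ => by have := mul_nonneg (hψ.nonneg y) (hψ.pos y).le; linarith) hψ.lim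
  have h2 := h.const_mul (-(1 / 2))
  have e : (fun y => c y * ψ y) = fun y => -(1 / 2) * -(2 * (c y * ψ y)) := by
    funext y; ring
  rw [e]
  exact h2

/-- The factor `2` in the logarithmic derivative of the weight produces the `1/2` here, which
becomes the contraction constant. -/
lemma IsDecayWeight.integral_eq (hψ : IsDecayWeight c ψ) (x : ℝ) :
    ∫ y in Set.Ioi x, c y * ψ y = ψ x / 2 := by
  have h := integral_Ioi_of_hasDerivAt_of_nonpos' (a := x) (fun y _ => hψ.deriv y)
    (fun y _ => by have := mul_nonneg (hψ.nonneg y) (hψ.pos y).le; linarith) hψ.lim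
  rw [integral_neg, integral_const_mul] at h
  linarith

lemma norm_exp_mul_apply_le (hb : ∀ i, 0 ≤ (b i).re) {h : ℝ → ι → ℂ}
    (hh : ∀ y, ‖h y‖ ≤ k * (c y * ψ y)) (i : ι) {x y : ℝ} (hxy : x < y) :
    ‖Complex.exp (-(b i * y)) * h y i‖ ≤ Real.exp (-((b i).re * x)) * (k * (c y * ψ y)) := by
  rw [norm_mul, Complex.norm_exp]
  refine mul_le_mul (Real.exp_le_exp.2 ?_) ((norm_le_pi_norm _ _).trans (hh y)) (norm_nonneg _)
    (Real.exp_pos _).le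
  simpa using mul_le_mul_of_nonneg_left hxy.le (hb i)

lemma integrableOn_exp_mul_apply (hψ : IsDecayWeight c ψ) (hb : ∀ i, 0 ≤ (b i).re)
    {h : ℝ → ι → ℂ} (hc : Continuous h) (hh : ∀ y, ‖h y‖ ≤ k * (c y * ψ y)) (i : ι) (x : ℝ) :
    IntegrableOn (fun y : ℝ => Complex.exp (-(b i * y)) * h y i) (Set.Ioi x) := by
  have hci : Continuous fun y => h y i := (continuous_apply i).comp hc
  refine Integrable.mono' (((hψ.integrableOn x).const_mul k).const_mul
    (Real.exp (-((b i).re * x)))) (by fun_prop) ?_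
  exact (ae_restrict_iff' measurableSet_Ioi).2
    (Eventually.of_forall fun y hy => norm_exp_mul_apply_le hb hh i hy)

/-- For `y > x` the kernel `exp (b (x - y))` has modulus at most one, so no spectral gap is needed.
-/
lemma norm_diagSolve_le (hψ : IsDecayWeight c ψ) (hb : ∀ i, 0 ≤ (b i).re)
    {h : ℝ → ι → ℂ} (hk : 0 ≤ k) (hh : ∀ y, ‖h y‖ ≤ k * (c y * ψ y)) (x : ℝ) :
    ‖diagSolve b h x‖ ≤ k / 2 * ψ x := by
  have hpos := hψ.pos x
  rw [pi_norm_le_iff_of_nonneg (by positivity)]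
  intro i
  rw [diagSolve, norm_neg, norm_mul]
  have h1 : ‖∫ y in Set.Ioi x, Complex.exp (-(b i * y)) * h y i‖ ≤
      ∫ y in Set.Ioi x, Real.exp (-((b i).re * x)) * (k * (c y * ψ y)) :=
    norm_integral_le_of_norm_le (((hψ.integrableOn x).const_mul k).const_mul _)
      ((ae_restrict_iff' measurableSet_Ioi).2
        (Eventually.of_forall fun y hy => norm_exp_mul_apply_le hb hh i hy))
  rw [integral_const_mul, integral_const_mul, hψ.integral_eq] at h1
  have h2 : ‖Complex.exp (b i * x)‖ = Real.exp ((b i).re * x) := by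
    rw [Complex.norm_exp]; simp
  rw [h2]
  calc _ ≤ Real.exp ((b i).re * x) * (Real.exp (-((b i).re * x)) * (k * (ψ x / 2))) :=
        mul_le_mul_of_nonneg_left h1 (Real.exp_pos _).le
    _ = (Real.exp ((b i).re * x) * Real.exp (-((b i).re * x))) * (k * (ψ x / 2)) := by ring
    _ = k / 2 * ψ x := by rw [← Real.exp_add]; simp; ring

lemma hasDerivAt_diagSolve (hψ : IsDecayWeight c ψ) (hb : ∀ i, 0 ≤ (b i).re)
    {h : ℝ → ι → ℂ} (hc : Continuous h) (hh : ∀ y, ‖h y‖ ≤ k * (c y * ψ y)) (x : ℝ) :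
    HasDerivAt (diagSolve b h) (fun i => b i * diagSolve b h x i + h x i) x := by
  rw [hasDerivAt_pi]
  intro i
  have hci : Continuous fun y => h y i := (continuous_apply i).comp hc
  have h1 := hasDerivAt_integral_Ioi (f := fun y : ℝ => Complex.exp (-(b i * y)) * h y i)
    (by fun_prop) (integrableOn_exp_mul_apply hψ hb hc hh i) x
  have h2 : HasDerivAt (fun t : ℝ => Complex.exp (b i * t)) (Complex.exp (b i * x) * (b i * 1)) x :=
    ((Complex.ofRealCLM.hasDerivAt (x := x)).const_mul (b i)).cexp
  have h3 : Complex.exp (b i * x) * Complex.exp (-(b i * x)) = 1 := by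
    rw [← Complex.exp_add]; simp
  convert! (h2.mul h1).neg using 1
  simp only [diagSolve]
  linear_combination (-h x i) * h3

lemma diagSolve_sub (hψ : IsDecayWeight c ψ) (hb : ∀ i, 0 ≤ (b i).re) {k' : ℝ}
    {h h' : ℝ → ι → ℂ} (hc : Continuous h) (hh : ∀ y, ‖h y‖ ≤ k * (c y * ψ y))
    (hc' : Continuous h') (hh' : ∀ y, ‖h' y‖ ≤ k' * (c y * ψ y)) (x : ℝ) :
    diagSolve b h x - diagSolve b h' x = diagSolve b (fun y => h y - h' y) x := by
  funext i
  have : ∫ y in Set.Ioi x, Complex.exp (-(b i * y)) * (h y - h' y) i =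
      (∫ y in Set.Ioi x, Complex.exp (-(b i * y)) * h y i) -
        ∫ y in Set.Ioi x, Complex.exp (-(b i * y)) * h' y i := by
    rw [← integral_sub (integrableOn_exp_mul_apply hψ hb hc hh i x)
      (integrableOn_exp_mul_apply hψ hb hc' hh' i x)]
    simp only [Pi.sub_apply, mul_sub]
  simp only [Pi.sub_apply, diagSolve]
  simp only [Pi.sub_apply] at this
  rw [this]
  ring

/-- A diagonal system without decaying modes, perturbed by a small matrix and an inhomogeneity,
has a solution that decays like the weight. -/
theorem exists_solution_of_decayWeight (hψ : IsDecayWeight c ψ) (hb : ∀ i, 0 ≤ (b i).re)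
    {M : ℝ → (ι → ℂ) →L[ℂ] (ι → ℂ)} {g : ℝ → ι → ℂ} (hM : Continuous M) (hg : Continuous g)
    (hMc : ∀ x, ‖M x‖ ≤ c x) {B : ℝ} (hB : 0 ≤ B) (hgc : ∀ x, ‖g x‖ ≤ B * (c x * ψ x)) :
    ∃ Z : ℝ → ι → ℂ, (∀ x, HasDerivAt Z (fun i => b i * Z x i + (M x (Z x) i + g x i)) x) ∧
      Tendsto Z atTop (𝓝 0) := by
  have hψc : Continuous ψ := continuous_iff_continuousAt.2 fun x => (hψ.deriv x).continuousAt
  -- The unknown is `Z = ψ U` with `U` bounded and continuous.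
  set h : (ℝ →ᵇ (ι → ℂ)) → ℝ → ι → ℂ := fun U y => M y ((ψ y : ℂ) • U y) + g y with hh
  have hhc : ∀ U, Continuous (h U) := fun U =>
    (hM.clm_apply ((Complex.continuous_ofReal.comp hψc).smul U.continuous)).add hg
  have hlin : ∀ y (u : ι → ℂ), ‖M y ((ψ y : ℂ) • u)‖ ≤ ‖u‖ * (c y * ψ y) := by
    intro y u
    refine ((M y).le_opNorm _).trans ?_
    rw [norm_smul, Complex.norm_real, Real.norm_of_nonneg (hψ.pos y).le]
    have := mul_le_mul_of_nonneg_right (hMc y)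
      (mul_nonneg (hψ.pos y).le (norm_nonneg u))
    linarith
  have hhb : ∀ U y, ‖h U y‖ ≤ (‖U‖ + B) * (c y * ψ y) := by
    intro U y
    refine (norm_add_le _ _).trans ?_
    have h1 := hlin y (U y)
    have h2 := mul_le_mul_of_nonneg_right (U.norm_coe_le_norm y)
      (mul_nonneg (hψ.nonneg y) (hψ.pos y).le)
    have := hgc y
    linarith
  have hcont : ∀ U, Continuous (diagSolve b (h U)) := fun U =>
    continuous_iff_continuousAt.2 fun x => (hasDerivAt_diagSolve hψ hb (hhc U) (hhb U) x).continuousAt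
  have hscale : ∀ (x : ℝ) (u : ι → ℂ), ‖((ψ x)⁻¹ : ℂ) • u‖ = (ψ x)⁻¹ * ‖u‖ := by
    intro x u
    rw [norm_smul, norm_inv, Complex.norm_real, Real.norm_of_nonneg (hψ.pos x).le]
  have hψne : ∀ x, (ψ x : ℂ) ≠ 0 := fun x => by exact_mod_cast (hψ.pos x).ne'
  set T : (ℝ →ᵇ (ι → ℂ)) → (ℝ →ᵇ (ι → ℂ)) := fun U =>
    BoundedContinuousFunction.ofNormedAddCommGroup
      (fun x => ((ψ x)⁻¹ : ℂ) • diagSolve b (h U) x)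
      (((Complex.continuous_ofReal.comp hψc).inv₀ hψne).smul (hcont U)) ((‖U‖ + B) / 2)
      (fun x => by
        rw [hscale, inv_mul_le_iff₀ (hψ.pos x), mul_comm (ψ x)]
        exact norm_diagSolve_le hψ hb (by positivity) (hhb U) x) with hT
  have hTapp : ∀ U x, T U x = ((ψ x)⁻¹ : ℂ) • diagSolve b (h U) x := fun U x => rfl
  have hcontr : ContractingWith (1 / 2) T := by
    refine ⟨by rw [← NNReal.coe_lt_coe]; norm_num, LipschitzWith.of_dist_le_mul fun U U' => ?_⟩
    rw [BoundedContinuousFunction.dist_le (by positivity)]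
    intro x
    rw [dist_eq_norm, hTapp, hTapp, ← smul_sub, hscale,
      diagSolve_sub hψ hb (hhc U) (hhb U) (hhc U') (hhb U'), inv_mul_le_iff₀ (hψ.pos x)]
    have h1 := norm_diagSolve_le (b := b) (h := fun y => h U y - h U' y) (k := dist U U') hψ hb
      dist_nonneg (fun y => by
        have e : h U y - h U' y = M y ((ψ y : ℂ) • (U y - U' y)) := by
          simp only [hh]
          rw [smul_sub, map_sub]
          abel
        rw [e]
        refine (hlin y _).trans (mul_le_mul_of_nonneg_right ?_
          (mul_nonneg (hψ.nonneg y) (hψ.pos y).le))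
        rw [← dist_eq_norm]
        exact BoundedContinuousFunction.dist_coe_le_dist y) x
    refine h1.trans (le_of_eq ?_)
    push_cast
    ring
  set U := hcontr.fixedPoint T with hU
  have hfix : T U = U := hcontr.fixedPoint_isFixedPt
  have hZ : ∀ x, diagSolve b (h U) x = (ψ x : ℂ) • U x := by
    intro x
    rw [← hfix, hTapp, hfix, smul_smul, mul_inv_cancel₀ (hψne x), one_smul]
  refine ⟨diagSolve b (h U), fun x => ?_, ?_⟩
  · have := hasDerivAt_diagSolve hψ hb (hhc U) (hhb U) x
    convert! this using 1
    funext i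
    rw [hh, hZ x]
    rfl
  · refine squeeze_zero_norm (fun x => norm_diagSolve_le hψ hb (by positivity) (hhb U) x) ?_
    simpa using hψ.lim.const_mul ((‖U‖ + B) / 2)

/-- The weight `exp (-2 η x + (2 C / ω) e^{-ω x})`. -/
lemma isDecayWeight_exp {η C ω : ℝ} (hη : 0 < η) (hC : 0 < C) (hω : 0 < ω) :
    IsDecayWeight (fun x => η + C * Real.exp (-ω * x))
      (fun x => Real.exp (-(2 * η) * x + 2 * C / ω * Real.exp (-ω * x))) := by
  refine ⟨fun x => Real.exp_pos _, fun x => by positivity, fun x => ?_, ?_⟩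
  · have h1 := ((hasDerivAt_id x).const_mul (-ω)).exp.const_mul (2 * C / ω)
    have h2 := (((hasDerivAt_id x).const_mul (-(2 * η))).add h1).exp
    convert! h2 using 1
    simp only [Pi.add_apply, id]
    field_simp
    ring
  · refine Real.tendsto_exp_atBot.comp ?_
    have h1 : Tendsto (fun x : ℝ => -(2 * η) * x) atTop atBot :=
      tendsto_id.const_mul_atTop_of_neg (by linarith)
    have h2 : Tendsto (fun x : ℝ => 2 * C / ω * Real.exp (-ω * x)) atTop (𝓝 (2 * C / ω * 0)) :=
      (Real.tendsto_exp_atBot.comp (tendsto_id.const_mul_atTop_of_neg (by linarith))).const_mul _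
    exact h1.atBot_add h2

/-- Asymptotically diagonal systems: existence of a decaying solution of the inhomogeneous system on
the half line. -/
theorem exists_decaying_solution (hb : ∀ i, 0 ≤ (b i).re) {η C ω : ℝ} (hη : 0 < η) (hC : 0 < C)
    (hω : 2 * η ≤ ω) {M : ℝ → (ι → ℂ) →L[ℂ] (ι → ℂ)} {g : ℝ → ι → ℂ} (hM : Continuous M)
    (hg : Continuous g) (hMc : ∀ x, 0 ≤ x → ‖M x‖ ≤ η + C * Real.exp (-ω * x))
    (hgc : ∀ x, 0 ≤ x → ‖g x‖ ≤ C * Real.exp (-ω * x)) :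
    ∃ Z : ℝ → ι → ℂ, (∀ x, 0 ≤ x → HasDerivAt Z
        (fun i => b i * Z x i + (M x (Z x) i + g x i)) x) ∧ Tendsto Z atTop (𝓝 0) := by
  have hω0 : 0 < ω := by linarith
  -- Coefficients are frozen on `x < 0`, so that the whole-line theorem applies.
  have hmax : Continuous fun x : ℝ => max x 0 := by fun_prop
  have hle : ∀ x : ℝ, Real.exp (-ω * max x 0) ≤ Real.exp (-ω * x) := fun x =>
    Real.exp_le_exp.2 (by nlinarith [le_max_left x 0])
  -- For `x ≥ 0` this is `2 η ≤ ω`; for `x ≤ 0` the double exponential in the weight dominates by `t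
  -- ≤ exp t`.
  have hweight : ∀ x : ℝ, Real.exp (-ω * x) ≤
      (1 + ω / (2 * C)) * Real.exp (-(2 * η) * x + 2 * C / ω * Real.exp (-ω * x)) := by
    intro x
    set ψ := Real.exp (-(2 * η) * x + 2 * C / ω * Real.exp (-ω * x)) with hψ
    have hψ0 : 0 < ψ := Real.exp_pos _
    have ht : 0 < 2 * C / ω * Real.exp (-ω * x) := by positivity
    have hq : 0 < ω / (2 * C) := by positivity
    rcases le_total 0 x with hx | hx
    · have h1 : Real.exp (-ω * x) ≤ ψ := Real.exp_le_exp.2 (by nlinarith)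
      nlinarith
    · have h1 : 2 * C / ω * Real.exp (-ω * x) ≤ ψ :=
        ((le_add_of_nonneg_right zero_le_one).trans (Real.add_one_le_exp _)).trans
          (Real.exp_le_exp.2 (by nlinarith))
      have h2 : Real.exp (-ω * x) = ω / (2 * C) * (2 * C / ω * Real.exp (-ω * x)) := by
        field_simp
      have h3 := mul_le_mul_of_nonneg_left h1 hq.le
      rw [← h2] at h3
      linarith
  obtain ⟨Z, hZ, hZ0⟩ := exists_solution_of_decayWeight (isDecayWeight_exp hη hC hω0) hb
    (hM.comp hmax) (hg.comp hmax)
    (fun x => (hMc _ (le_max_right x 0)).trans (by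
      have := mul_le_mul_of_nonneg_left (hle x) hC.le
      linarith))
    (B := C * (1 + ω / (2 * C)) / η) (by positivity) (fun x => by
      have h1 := (hgc _ (le_max_right x 0)).trans (mul_le_mul_of_nonneg_left (hle x) hC.le)
      have h2 := mul_le_mul_of_nonneg_left (hweight x) hC.le
      refine h1.trans (h2.trans ?_)
      have h3 : 0 < Real.exp (-(2 * η) * x + 2 * C / ω * Real.exp (-ω * x)) := Real.exp_pos _
      have h4 : 0 < C * Real.exp (-ω * x) := by positivity
      have h5 : 0 < C * (1 + ω / (2 * C)) / η := by positivity
      calc _ = C * (1 + ω / (2 * C)) / η *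
            (η * Real.exp (-(2 * η) * x + 2 * C / ω * Real.exp (-ω * x))) := by
            field_simp
        _ ≤ _ := by
            gcongr
            linarith)
  refine ⟨Z, fun x hx => ?_, hZ0⟩
  have := hZ x
  simpa only [Function.comp_apply, max_eq_left hx] using this

end DecayingSolution

/-! ### The eigenpair and the adjoint solution with prescribed asymptotics. -/

section Existence

open ComplexConjugate

variable {γ vp v0 : ℝ} {vhat : ℝ → ℝ}

lemma IsCompressiveInflowLayer.exists_fFun_decay (hγ : 1 ≤ γ)
    (hl : IsCompressiveInflowLayer γ vp v0 vhat) :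
    ∃ ω > 0, ∃ C > 0, ∀ x, 0 ≤ x → |vhat x - vp| ≤ C * Real.exp (-ω * x) ∧
      |fFun γ vp (vhat x) - fFun γ vp vp| ≤ C * Real.exp (-ω * x) := by
  obtain ⟨ω, hω, h⟩ := hl.exists_exp_decay hγ
  have hvp := hl.vp_pos
  have hCD : ContDiffOn ℝ 1 (fun s : ℝ => 2 * s - 1 - pressureCoeff γ vp
      - (γ - 1) * (pressureCoeff γ vp * s ^ (-γ))) (Set.Icc vp 1) := by
    have h1 : ContDiffOn ℝ 1 (fun s : ℝ => s ^ (-γ)) (Set.Icc vp 1) :=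
      contDiffOn_id.rpow_const_of_ne fun t ht => (hvp.trans_le ht.1).ne'
    exact (((contDiffOn_const.mul contDiffOn_id).sub contDiffOn_const).sub contDiffOn_const).sub
      (contDiffOn_const.mul (contDiffOn_const.mul h1))
  obtain ⟨K, hK⟩ := hCD.exists_lipschitzOnWith (by norm_num) (convex_Icc _ _) isCompact_Icc
  refine ⟨ω, hω, K + 1, by positivity, fun x hx => ?_⟩
  have h1 := hl.endState_lt hγ hx
  have h2 : |vhat x - vp| ≤ Real.exp (-ω * x) := by
    rw [abs_of_pos (by linarith)]; exact h x hx
  have hE := Real.exp_pos (-ω * x)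
  have hK0 : (0 : ℝ) ≤ K := K.2
  refine ⟨by nlinarith, ?_⟩
  have h3 := hK.dist_le_mul (vhat x) ⟨h1.le, (hl.le_boundary hγ hx).trans hl.v0_lt_one.le⟩ vp
    ⟨le_rfl, hl.vp_lt_one.le⟩
  rw [Real.dist_eq, Real.dist_eq, ← fFun_eq (hl.pos x), ← fFun_eq hvp] at h3
  have := mul_le_mul_of_nonneg_left h2 hK0
  linarith

/-- The analytic eigenpair of the decaying adjoint mode. -/
lemma exists_eigenpair {ρ : ℝ} (hvp : 0 < vp) (hG : 0 < vp - fFun γ vp vp) (hρ : 4 ≤ ρ)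
    {Ξ : ℂ → ℂ}
    (hΞd : DifferentiableOn ℂ Ξ {z | -((vp - fFun γ vp vp) / 4) < z.re})
    (hΞ : ∀ z : ℂ, -((vp - fFun γ vp vp) / 4) < z.re →
      ρ < (Ξ z).re ∧ ratioMap vp (vp - fFun γ vp vp) (Ξ z) = z) :
    IsDecayingAdjointEigenpair γ vp
      (fun z => -conj (ratioRate vp (vp - fFun γ vp vp) (Ξ z)))
      (fun z => ![1, conj (Ξ z), conj (ratioRate vp (vp - fFun γ vp vp) (Ξ z) / vp)]) := by
  set G : ℝ := vp - fFun γ vp vp with hGdef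
  have hvc : (vp : ℂ) ≠ 0 := by exact_mod_cast hvp.ne'
  have hsub : ∀ z : ℂ, 0 ≤ z.re → -(G / 4) < z.re := fun z hz => by linarith
  have hne : ∀ z : ℂ, -(G / 4) < z.re → Ξ z ≠ 0 := fun z hz =>
    ne_zero_of_re_pos (by linarith [(hΞ z hz).1])
  refine ⟨?_, fun z hz h => ?_, fun z hz => ?_, fun z hz hz0 => ?_⟩
  · have hopen : IsOpen {z : ℂ | -(G / 4) < z.re} :=
      isOpen_lt continuous_const Complex.continuous_re
    have hd : DifferentiableOn ℂ
        (fun z => ![1, Ξ z, ratioRate vp G (Ξ z) / vp]) {z : ℂ | -(G / 4) < z.re} := by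
      rw [differentiableOn_pi]
      intro i
      fin_cases i
      · exact differentiableOn_const _
      · exact hΞd
      · exact ((hΞd.const_mul _).sub ((differentiableOn_const _).div hΞd hne)).div_const _
    have e : (fun z => star ![1, conj (Ξ z), conj (ratioRate vp G (Ξ z) / vp)]) =
        fun z => ![1, Ξ z, ratioRate vp G (Ξ z) / vp] := by
      funext z i
      fin_cases i <;> simp
    rw [e]
    exact (hd.analyticOnNhd hopen).mono fun z hz => hsub z hz
  · have := congrFun h 0
    simp at this
  · obtain ⟨-, h2⟩ := hΞ z (hsub z hz)
    have h0 := hne z (hsub z hz)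
    set ξ := Ξ z with hξ
    set m := ratioRate vp G ξ with hm
    have hzm : (ξ - 1) * m = z := by rw [hm, ← ratioMap_eq h0, h2]
    have hrel : vp * ξ ^ 2 - (vp - fFun γ vp vp) = m * ξ := by
      have : (G : ℂ) = vp - fFun γ vp vp := by rw [hGdef]; push_cast; ring
      rw [hm, ratioRate, ← this]
      field_simp
    rw [conj_eigen]
    simp only [Matrix.cons_val_zero, Matrix.cons_val_one, Matrix.cons_val, Complex.conj_conj,
      map_neg, map_one, neg_neg]
    refine ⟨by field_simp, ?_, ?_⟩
    · field_simp
      linear_combination -hzm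
    · field_simp
      rw [← hzm]
      linear_combination m * hrel
  · obtain ⟨h1, h2⟩ := hΞ z (hsub z hz)
    have := ratioRate_re_pos hvp (by linarith) (by rw [h2]; exact hz) (by rw [h2]; exact hz0)
    simpa using this

lemma norm_smulRight_le_of {E : Type*} [NormedAddCommGroup E] [NormedSpace ℂ E]
    (R : E →L[ℂ] ℂ) (a : E) (c : ℂ) {B e : ℝ} (h : ‖R‖ * ‖a‖ ≤ B) (hc : ‖c‖ ≤ e) :
    ‖c • R.smulRight a‖ ≤ B * e := by
  rw [norm_smul, ContinuousLinearMap.norm_smulRight_apply, mul_comm]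
  exact mul_le_mul h hc (norm_nonneg _) ((mul_nonneg (norm_nonneg _) (norm_nonneg _)).trans h)

/-- The remaining two eigenvalues of `A₊(z)`: their distance to the growing one. -/
lemma exists_rate_gaps {v F ρ : ℝ} (hv : 0 < v) (hG : 0 < v + F) (hρ : 4 ≤ ρ)
    (hρG : 2 * v * ρ ^ 2 = v + F) {z ξ m : ℂ} (hz : 0 ≤ z.re) (hξ : ρ < ξ.re)
    (hξz : ratioMap v (v + F) ξ = z) (hm : m = ratioRate v (v + F) ξ) (hm0 : 0 < m.re) :
    ∃ b₂ b₃ : ℂ, 0 ≤ b₂.re ∧ 0 ≤ b₃.re ∧ b₂ + b₃ = F + z + 3 * m ∧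
      b₂ * b₃ = m * (F + z + 2 * m) + z * v * (ξ - 1) := by
  have h0 : ξ ≠ 0 := ne_zero_of_re_pos (by linarith)
  have hzm : (ξ - 1) * m = z := by rw [hm, ← ratioMap_eq h0, hξz]
  have hrel : v * ξ ^ 2 - (v + F) = m * ξ := by
    rw [hm, ratioRate]
    push_cast
    field_simp
  set S : ℂ := F + z + 3 * m with hS
  set D : ℂ := m * (F + z + 2 * m) + z * v * (ξ - 1) with hD
  obtain ⟨s, hs⟩ := IsAlgClosed.exists_pow_nat_eq (S ^ 2 - 4 * D) (n := 2) (by norm_num)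
  -- A gap with negative real part would give another root `m - b` with positive real part, which
  -- must equal `m`.
  have hroot : ∀ b : ℂ, b ^ 2 - S * b + D = 0 → 0 ≤ b.re := by
    intro b hb
    by_contra! hneg
    have h1 := eq_ratioRate_of_root (G := v + F) hv hG hρ hρG hz hξ hξz (m := m - b)
      (by rw [Complex.sub_re]; linarith) (by
        push_cast
        rw [hS, hD, ← hzm] at hb
        rw [← hzm]
        linear_combination -b * hb + (m * b - m ^ 2) * hrel)
    rw [← hm, sub_eq_self] at h1
    rw [h1] at hneg
    simp at hneg
  refine ⟨(S + s) / 2, (S - s) / 2, hroot _ ?_, hroot _ ?_, by ring, ?_⟩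
  · linear_combination hs / 4
  · linear_combination hs / 4
  · linear_combination -hs / 4

/-- Existence of the decaying solution of the adjoint equation for `z ≠ 0`. -/
lemma exists_rowSolution {v ρ ω C : ℝ} {f : ℝ → ℝ} {f₀ : ℝ} (hv : 0 < v)
    (hG : 0 < v + f₀) (hρ : 4 ≤ ρ) (hρG : 2 * v * ρ ^ 2 = v + f₀) {z ξ m : ℂ} (hz : 0 ≤ z.re)
    (hz0 : z ≠ 0) (hξ : ρ < ξ.re) (hξz : ratioMap v (v + f₀) ξ = z)
    (hm : m = ratioRate v (v + f₀) ξ) (hm0 : 0 < m.re) (hω : 0 < ω) (hC : 0 < C)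
    (hvc : Continuous vhat) (hfc : Continuous f)
    (hdv : ∀ x, 0 ≤ x → |vhat x - v| ≤ C * Real.exp (-ω * x))
    (hdf : ∀ x, 0 ≤ x → |f x - f₀| ≤ C * Real.exp (-ω * x)) :
    ∃ P Q R : ℝ → ℂ, IsRowSolution vhat f z (fun x => Complex.exp (-(m * x)) * P x)
      (fun x => Complex.exp (-(m * x)) * Q x) (fun x => Complex.exp (-(m * x)) * R x) ∧
      Tendsto P atTop (𝓝 1) ∧ Tendsto Q atTop (𝓝 ξ) ∧ Tendsto R atTop (𝓝 (m / v)) := by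
  have h0 : ξ ≠ 0 := ne_zero_of_re_pos (by linarith)
  have hvC : (v : ℂ) ≠ 0 := by exact_mod_cast hv.ne'
  have hzm : (ξ - 1) * m = z := by rw [hm, ← ratioMap_eq h0, hξz]
  have hrel : v * ξ ^ 2 - (v + f₀) = m * ξ := by
    rw [hm, ratioRate]
    push_cast
    field_simp
  obtain ⟨b₂, b₃, hb₂, hb₃, hsum, hprod⟩ := exists_rate_gaps hv hG hρ hρG hz hξ hξz hm hm0
  set η : ℝ := ω / 2 with hη
  have hη0 : 0 < η := by positivity
  -- Successive coordinates are scaled by powers of `κ` to bring the off-diagonal part of the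
  -- triangular limit below `η`. Triangular form also covers coinciding eigenvalues.
  set κ : ℝ := (v + ‖z‖) / η + 1 with hκ
  have hκ0 : 0 < κ := by positivity
  have hκC : (κ : ℂ) ≠ 0 := by exact_mod_cast hκ0.ne'
  have hκη : v + ‖z‖ ≤ η * κ := by
    rw [hκ, mul_add, mul_div_cancel₀ _ hη0.ne']; linarith
  -- Chosen so that `Y = Q - P ξ + c₂ Γ` decouples from `P` and `Γ` in the limiting system, with
  -- rate `b₂`.
  set c₂ : ℂ := (m - b₂) / z with hc₂
  have hc₂z : c₂ * z = m - b₂ := by rw [hc₂]; field_simp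
  set d₁ : ℝ → ℂ := fun x => -((vhat x : ℂ) - v) with hd₁
  set d₂ : ℝ → ℂ := fun x => (f x : ℂ) - f₀ with hd₂
  have hd₁c : Continuous d₁ := by fun_prop
  have hd₂c : Continuous d₂ := by fun_prop
  have hd₁b : ∀ x, 0 ≤ x → ‖d₁ x‖ ≤ C * Real.exp (-ω * x) := by
    intro x hx
    rw [hd₁, norm_neg, ← Complex.ofReal_sub, Complex.norm_real]
    exact hdv x hx
  have hd₂b : ∀ x, 0 ≤ x → ‖d₂ x‖ ≤ C * Real.exp (-ω * x) := by
    intro x hx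
    simp only [hd₂]
    rw [← Complex.ofReal_sub, Complex.norm_real]
    exact hdf x hx
  set a₁ : Fin 3 → ℂ := ![1, -(κ * (m / v)), κ ^ 2 * ((1 - ξ) - c₂ * (m / v))] with ha₁
  set a₂ : Fin 3 → ℂ := ![0, κ, κ ^ 2 * c₂] with ha₂
  set R₀ : (Fin 3 → ℂ) →L[ℂ] ℂ := (m / v) • ContinuousLinearMap.proj (R := ℂ) 0 +
    (κ : ℂ)⁻¹ • ContinuousLinearMap.proj (R := ℂ) 1 with hR₀
  have hR₀app : ∀ u, R₀ u = (m / v) * u 0 + (κ : ℂ)⁻¹ * u 1 := fun u => rfl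
  set N : (Fin 3 → ℂ) →L[ℂ] (Fin 3 → ℂ) := ContinuousLinearMap.pi
    ![(-(v / κ) : ℂ) • ContinuousLinearMap.proj (R := ℂ) 1,
      (-(z / κ) : ℂ) • ContinuousLinearMap.proj (R := ℂ) 2, 0] with hN
  have hN0 : ∀ u, N u 0 = -(v / κ) * u 1 := fun u => rfl
  have hN1 : ∀ u, N u 1 = -(z / κ) * u 2 := fun u => rfl
  have hN2 : ∀ u, N u 2 = 0 := fun u => rfl
  have hNn : ‖N‖ ≤ η := by
    refine ContinuousLinearMap.opNorm_le_bound _ hη0.le fun u => ?_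
    rw [pi_norm_le_iff_of_nonneg (by positivity)]
    have hvκ : ‖-((v : ℂ) / κ)‖ ≤ η := by
      rw [norm_neg, norm_div, Complex.norm_real, Complex.norm_real, Real.norm_of_nonneg hv.le,
        Real.norm_of_nonneg hκ0.le, div_le_iff₀ hκ0]
      linarith [norm_nonneg z]
    have hzκ : ‖-((z : ℂ) / κ)‖ ≤ η := by
      rw [norm_neg, norm_div, Complex.norm_real, Real.norm_of_nonneg hκ0.le, div_le_iff₀ hκ0]
      linarith
    intro i
    fin_cases i
    · change ‖N u 0‖ ≤ _
      rw [hN0, norm_mul]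
      exact mul_le_mul hvκ (norm_le_pi_norm u 1) (norm_nonneg _) hη0.le
    · change ‖N u 1‖ ≤ _
      rw [hN1, norm_mul]
      exact mul_le_mul hzκ (norm_le_pi_norm u 2) (norm_nonneg _) hη0.le
    · change ‖N u 2‖ ≤ _
      rw [hN2, norm_zero]
      positivity
  set M : ℝ → (Fin 3 → ℂ) →L[ℂ] (Fin 3 → ℂ) := fun x =>
    N + (d₁ x • R₀.smulRight a₁ + d₂ x • R₀.smulRight a₂) with hM
  set g : ℝ → Fin 3 → ℂ := fun x => (m / v) • (d₁ x • a₁ + d₂ x • a₂) with hg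
  have hMcont : Continuous M := by
    exact continuous_const.add
      ((hd₁c.smul continuous_const).add (hd₂c.smul continuous_const))
  have hgcont : Continuous g := by
    have h : Continuous fun x => d₁ x • a₁ + d₂ x • a₂ :=
      (hd₁c.smul continuous_const).add (hd₂c.smul continuous_const)
    exact h.const_smul (m / (v : ℂ))
  set B : ℝ := (‖R₀‖ + ‖m / v‖ + 1) * (‖a₁‖ + ‖a₂‖ + 1) with hB
  have hB0 : 0 < B := by positivity
  obtain ⟨Z, hZ, hZ0⟩ := exists_decaying_solution (b := ![0, b₃, b₂]) (M := M) (g := g)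
    (η := η) (C := 2 * (B * C)) (ω := ω)
    (by
      intro i
      fin_cases i
      · simp
      · simpa using hb₃
      · simpa using hb₂) hη0 (by positivity) (by rw [hη]; linarith)
    hMcont hgcont
    (fun x hx => by
      have e1 : ‖R₀‖ * ‖a₁‖ ≤ B := mul_le_mul (by linarith [norm_nonneg (m / v : ℂ)])
        (by linarith [norm_nonneg a₂]) (norm_nonneg _) (by positivity)
      have e2 : ‖R₀‖ * ‖a₂‖ ≤ B := mul_le_mul (by linarith [norm_nonneg (m / v : ℂ)])
        (by linarith [norm_nonneg a₁]) (norm_nonneg _) (by positivity)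
      have h1 := norm_smulRight_le_of R₀ a₁ (d₁ x) e1 (hd₁b x hx)
      have h2 := norm_smulRight_le_of R₀ a₂ (d₂ x) e2 (hd₂b x hx)
      refine (norm_add_le _ _).trans (add_le_add hNn ((norm_add_le _ _).trans ?_))
      linarith)
    (fun x hx => by
      have e1 : ‖m / (v : ℂ)‖ * ‖a₁‖ ≤ B := mul_le_mul (by linarith [norm_nonneg R₀])
        (by linarith [norm_nonneg a₂]) (norm_nonneg _) (by positivity)
      have e2 : ‖m / (v : ℂ)‖ * ‖a₂‖ ≤ B := mul_le_mul (by linarith [norm_nonneg R₀])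
        (by linarith [norm_nonneg a₁]) (norm_nonneg _) (by positivity)
      have h1 := mul_le_mul e1 (hd₁b x hx) (norm_nonneg _) hB0.le
      have h2 := mul_le_mul e2 (hd₂b x hx) (norm_nonneg _) hB0.le
      have h3 := norm_add_le (d₁ x • a₁) (d₂ x • a₂)
      rw [norm_smul, norm_smul] at h3
      rw [hg, norm_smul]
      have h4 := mul_le_mul_of_nonneg_left h3 (norm_nonneg (m / (v : ℂ)))
      linarith)
  set P : ℝ → ℂ := fun x => 1 + Z x 0 with hP
  set Γ : ℝ → ℂ := fun x => (κ : ℂ)⁻¹ * Z x 1 with hΓ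
  set Y : ℝ → ℂ := fun x => ((κ : ℂ) ^ 2)⁻¹ * Z x 2 with hY
  set R : ℝ → ℂ := fun x => P x * (m / v) + Γ x with hR
  set Q : ℝ → ℂ := fun x => P x * ξ + (Y x - c₂ * Γ x) with hQ
  have hRZ : ∀ x, R x = R₀ (Z x) + m / v := by
    intro x
    rw [hR₀app, hR]
    simp only [hP, hΓ]
    ring
  have hcomp : ∀ i x, 0 ≤ x → HasDerivAt (fun x => Z x i)
      ((![0, b₃, b₂] : Fin 3 → ℂ) i * Z x i + (N (Z x) i + R x * (d₁ x * a₁ i + d₂ x * a₂ i)))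
      x := by
    intro i x hx
    have := hasDerivAt_pi.1 (hZ x hx) i
    convert! this using 2
    rw [hRZ]
    simp only [hM, hg, _root_.add_apply, _root_.smul_apply,
      ContinuousLinearMap.smulRight_apply, Pi.add_apply, Pi.smul_apply, smul_eq_mul]
    ring
  have hPd : ∀ x, 0 ≤ x → HasDerivAt P (-v * Γ x + d₁ x * R x) x := by
    intro x hx
    convert! (hcomp 0 x hx).const_add 1 using 1
    rw [hN0]
    simp [hΓ, ha₁, ha₂]
    field_simp
  have hΓd : ∀ x, 0 ≤ x →
      HasDerivAt Γ (b₃ * Γ x - z * Y x + (d₂ x - m / v * d₁ x) * R x) x := by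
    intro x hx
    convert! (hcomp 1 x hx).const_mul (κ : ℂ)⁻¹ using 1
    rw [hN1]
    simp [hΓ, hY, ha₁, ha₂]
    field_simp
    ring
  have hYd : ∀ x, 0 ≤ x → HasDerivAt Y
      (b₂ * Y x + ((1 - ξ) * d₁ x + c₂ * (d₂ x - m / v * d₁ x)) * R x) x := by
    intro x hx
    convert! (hcomp 2 x hx).const_mul ((κ : ℂ) ^ 2)⁻¹ using 1
    rw [hN2]
    simp [hY, ha₁, ha₂]
    field_simp
    ring
  have hEd : ∀ x : ℝ, HasDerivAt (fun x : ℝ => Complex.exp (-(m * x)))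
      (Complex.exp (-(m * x)) * -m) x := by
    intro x
    have := ((Complex.ofRealCLM.hasDerivAt (x := x)).const_mul m).neg.cexp
    simpa using this
  have hRd : ∀ x, 0 ≤ x → HasDerivAt R ((-v * Γ x + d₁ x * R x) * (m / v) +
      (b₃ * Γ x - z * Y x + (d₂ x - m / v * d₁ x) * R x)) x := fun x hx =>
    ((hPd x hx).mul_const _).add (hΓd x hx)
  have hQd : ∀ x, 0 ≤ x → HasDerivAt Q ((-v * Γ x + d₁ x * R x) * ξ +
      ((b₂ * Y x + ((1 - ξ) * d₁ x + c₂ * (d₂ x - m / v * d₁ x)) * R x) -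
        c₂ * (b₃ * Γ x - z * Y x + (d₂ x - m / v * d₁ x) * R x))) x := fun x hx =>
    ((hPd x hx).mul_const _).add ((hYd x hx).sub ((hΓd x hx).const_mul _))
  have hvR : ∀ x, v * R x = P x * m + v * Γ x := by
    intro x
    simp only [hR]
    field_simp
  have hΓ0 : c₂ * (b₃ - m) = -v * (ξ - 1) := by
    refine mul_left_cancel₀ hz0 ?_
    linear_combination (b₃ - m) * hc₂z + m * hsum - hprod
  have hP0 : (f₀ + z + m) * (m / v) = z * (1 + ξ) := by
    field_simp
    rw [← hzm]
    linear_combination -m * hrel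
  have hΓl : Tendsto Γ atTop (𝓝 0) := by
    simpa using (tendsto_pi_nhds.1 hZ0 1).const_mul (κ : ℂ)⁻¹
  have hYl : Tendsto Y atTop (𝓝 0) := by
    simpa using (tendsto_pi_nhds.1 hZ0 2).const_mul ((κ : ℂ) ^ 2)⁻¹
  have hPl : Tendsto P atTop (𝓝 1) := by
    simpa using (tendsto_pi_nhds.1 hZ0 0).const_add 1
  refine ⟨P, Q, R, ⟨fun x hx => ?_, fun x hx => ?_, fun x hx => ?_⟩, hPl, ?_, ?_⟩
  · convert! ((hEd x).mul (hPd x hx)).hasDerivWithinAt using 1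
    simp only [hd₁]
    linear_combination -Complex.exp (-(m * x)) * hvR x
  · convert! ((hEd x).mul (hQd x hx)).hasDerivWithinAt using 1
    simp only [hd₁, hQ]
    linear_combination Complex.exp (-(m * x)) *
      (-hvR x + P x * hzm - Y x * hc₂z + Γ x * hΓ0)
  · convert! ((hEd x).mul (hRd x hx)).hasDerivWithinAt using 1
    simp only [hd₂, hQ]
    have hm' : (v : ℂ) * (m / v) = m := by field_simp
    have hRx : R x = P x * (m / v) + Γ x := rfl
    linear_combination Complex.exp (-(m * x)) *
      (P x * hP0 + Γ x * (hc₂z - hsum) + Γ x * hm' + (f₀ + z + m) * hRx)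
  · simpa using (hPl.mul_const ξ).add (hYl.sub (hΓl.const_mul c₂))
  · simpa using (hPl.mul_const (m / (v : ℂ))).add hΓl

end Existence

/-! ### Existence of the Evans function. -/

section Stability

open ComplexConjugate

variable {γ vp v0 : ℝ} {vhat : ℝ → ℝ}

/-- Existence of the adjoint solution asymptotic to the decaying mode, for `z` in the closed right
half plane. -/
lemma exists_adjointSolution {ρ : ℝ} (hγ : 1 ≤ γ) (hl : IsCompressiveInflowLayer γ vp v0 vhat)
    (hG : 0 < vp - fFun γ vp vp) (hρ : 4 ≤ ρ) (hρG : 2 * vp * ρ ^ 2 = vp - fFun γ vp vp)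
    {z ξ : ℂ} (hz : 0 ≤ z.re) (hξ : ρ < ξ.re) (hξz : ratioMap vp (vp - fFun γ vp vp) ξ = z) :
    ∃ W : ℝ → Fin 3 → ℂ, IsAdjointSolution γ vp vhat z W ∧
      Tendsto (fun x : ℝ => Complex.exp
          (-(-conj (ratioRate vp (vp - fFun γ vp vp) ξ) * (x : ℂ))) • W x) atTop
        (𝓝 ![1, conj ξ, conj (ratioRate vp (vp - fFun γ vp vp) ξ / vp)]) := by
  set G : ℝ := vp - fFun γ vp vp with hGdef
  set m : ℂ := ratioRate vp G ξ with hm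
  have h0 : ξ ≠ 0 := ne_zero_of_re_pos (by linarith)
  rcases eq_or_ne z 0 with rfl | hz0
  · have hm0 : m = 0 := by
      have h1 : (ξ - 1) * m = 0 := by rw [hm, ← ratioMap_eq h0, hξz]
      refine (mul_eq_zero.1 h1).resolve_left (ne_zero_of_re_pos ?_)
      rw [Complex.sub_re, Complex.one_re]
      linarith
    rw [hm0]
    have hs : IsRowSolution vhat (fun x => -fFun γ vp (vhat x)) 0 (fun _ => 1) (fun _ => ξ)
        (fun _ => 0) := by
      refine ⟨fun x _ => ?_, fun x _ => ?_, fun x _ => ?_⟩ <;>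
        simpa using hasDerivWithinAt_const (x := x) (s := Set.Ici (0 : ℝ)) _
    refine ⟨_, hs.isAdjointSolution, ?_⟩
    simp
  · obtain ⟨ω, hω, C, hC, hdec⟩ := hl.exists_fFun_decay hγ
    have hfc : Continuous fun x => -fFun γ vp (vhat x) :=
      continuous_iff_continuousAt.2 fun x => (hl.hasDerivAt_fFun x).neg.continuousAt
    have hm0 : 0 < m.re := ratioRate_re_pos hl.vp_pos (by linarith) (by rw [hξz]; exact hz)
      (by rw [hξz]; exact hz0)
    obtain ⟨P, Q, R, hs, hP, hQ, hR⟩ := exists_rowSolution (f₀ := -fFun γ vp vp) hl.vp_pos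
      hG hρ hρG hz hz0 hξ hξz hm hm0 hω hC hl.continuous hfc
      (fun x hx => (hdec x hx).1)
      (fun x hx => by
        rw [← neg_add_eq_sub, neg_neg, ← sub_eq_add_neg, abs_sub_comm]
        exact (hdec x hx).2)
    refine ⟨_, hs.isAdjointSolution, ?_⟩
    have key : ∀ (f : ℝ → ℂ) (c : ℂ), Tendsto f atTop (𝓝 c) →
        Tendsto (fun x : ℝ => Complex.exp (-(-conj m * (x : ℂ))) *
          conj (Complex.exp (-(m * x)) * f x)) atTop (𝓝 (conj c)) := by
      intro f c hf
      refine ((Complex.continuous_conj.tendsto _).comp hf).congr fun x => ?_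
      rw [map_mul, ← Complex.exp_conj, ← mul_assoc, ← Complex.exp_add]
      simp
    rw [tendsto_pi_nhds]
    intro i
    fin_cases i
    · simpa using key P 1 hP
    · simpa using key Q ξ hQ
    · simpa using key R (m / vp) hR

lemma dotProduct_star_eq (w : Fin 3 → ℂ) : ![1, 0, 0] ⬝ᵥ star w = conj (w 0) := by
  simp [dotProduct, Fin.sum_univ_three]

/-- Existence of the Evans function of a layer with small boundary value. -/
theorem IsCompressiveInflowLayer.exists_evansFunction (hγ : 1 ≤ γ)
    (hl : IsCompressiveInflowLayer γ vp v0 vhat) (hv0 : v0 < 1 / 64) :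
    ∃ D : ℂ → ℂ, IsInflowEvansFunction γ vp vhat D := by
  have hvp := hl.vp_pos
  have hvp' : vp < 1 / 64 := hl.vp_lt_v0.trans hv0
  have hF := neg_fFun_ge hγ hvp hl.vp_lt_one le_rfl (by linarith)
  have hG : 1 / 2 ≤ vp - fFun γ vp vp := by linarith
  set ρ : ℝ := Real.sqrt ((vp - fFun γ vp vp) / (2 * vp)) with hρdef
  -- Since `G ≥ 1/2`, the bound `vp < 1/64` yields `G / (2 vp) ≥ 16`.
  have hρ : 4 ≤ ρ := by
    refine Real.le_sqrt_of_sq_le ?_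
    rw [le_div_iff₀ (by positivity)]
    linarith
  have hρG : 2 * vp * ρ ^ 2 = vp - fFun γ vp vp := by
    rw [hρdef, Real.sq_sqrt (div_nonneg (by linarith) (by linarith))]
    field_simp
  obtain ⟨Ξ, hΞd, hΞ⟩ := exists_analytic_ratio hvp (by linarith) hρ hρG
  have hex : ∀ z : ℂ, ∃ W : ℝ → Fin 3 → ℂ, 0 ≤ z.re → IsAdjointSolution γ vp vhat z W ∧
      Tendsto (fun x : ℝ => Complex.exp
          (-(-conj (ratioRate vp (vp - fFun γ vp vp) (Ξ z)) * (x : ℂ))) • W x) atTop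
        (𝓝 ![1, conj (Ξ z), conj (ratioRate vp (vp - fFun γ vp vp) (Ξ z) / vp)]) := by
    intro z
    by_cases hz : 0 ≤ z.re
    · obtain ⟨h1, h2⟩ := hΞ z (by linarith)
      obtain ⟨W, hW⟩ := exists_adjointSolution hγ hl (by linarith) hρ hρG hz h1 h2
      exact ⟨W, fun _ => hW⟩
    · exact ⟨0, fun h => (hz h).elim⟩
  choose W hW using hex
  exact ⟨fun z => ![1, 0, 0] ⬝ᵥ star (W z 0), _, _, W,
    exists_eigenpair hvp (by linarith) hρ hΞd hΞ,
    fun z hz => ⟨(hW z hz).1, (hW z hz).2, rfl⟩⟩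

end Stability

end BoundaryLayer

end

/-- Spectral stability of compressive inflow boundary layers with small boundary value. -/
theorem theorem3p3 (γ : ℝ) (hγ : 1 ≤ γ) :
    ∃ ε : ℝ, 0 < ε ∧
      ∀ (vp v0 : ℝ) (vhat : ℝ → ℝ),
        BoundaryLayer.IsCompressiveInflowLayer γ vp v0 vhat → v0 < ε →
          (∃ D : ℂ → ℂ, BoundaryLayer.IsInflowEvansFunction γ vp vhat D) ∧
          (∀ D : ℂ → ℂ, BoundaryLayer.IsInflowEvansFunction γ vp vhat D →
            ∀ z : ℂ, 0 ≤ z.re → D z ≠ 0) ∧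
          (∀ z : ℂ, 0 ≤ z.re → ¬ BoundaryLayer.IsInflowEigenvalue γ vp vhat z) := by
  obtain ⟨ε, hε, hne⟩ := BoundaryLayer.exists_forall_adjointSolution_ne_zero hγ
  refine ⟨min ε (1 / 64), by positivity, fun vp v0 vhat hl hv => ?_⟩
  have hv1 : v0 < ε := hv.trans_le (min_le_left _ _)
  have hv2 : v0 < 1 / 64 := hv.trans_le (min_le_right _ _)
  have hF := BoundaryLayer.neg_fFun_ge hγ hl.vp_pos hl.vp_lt_one le_rfl
    (by linarith [hl.vp_lt_v0])
  have hex := hl.exists_evansFunction hγ hv2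
  refine ⟨hex, ?_, ?_⟩
  · rintro D ⟨μ, V, W, hV, hW⟩ z hz
    obtain ⟨h1, h2, h3⟩ := hW z hz
    rw [h3, BoundaryLayer.dotProduct_star_eq, Ne, map_eq_zero]
    rcases eq_or_ne z 0 with rfl | hz0
    · obtain ⟨hμ, hV0⟩ := hV.at_zero hl.vp_pos (by linarith)
      rw [h1.first_component_of_zero hγ hl (by linarith) (by simpa [hμ] using h2)]
      exact hV0
    · exact hne vp v0 vhat hl hv1 z (μ z) (V z) (W z) hz hz0 (hV.decaying z hz hz0)
        (hV.ne_zero z hz) h1 h2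
  · intro z hz
    rcases eq_or_ne z 0 with rfl | hz0
    · exact BoundaryLayer.not_isInflowEigenvalue_zero hγ hl
    · obtain ⟨D, μ, V, W, hV, hW⟩ := hex
      obtain ⟨h1, h2, -⟩ := hW z hz
      have hμ := hV.decaying z hz hz0
      have hlim := fun i => BoundaryLayer.tendsto_mul_of_exp_decay (by simpa using hμ)
        (BoundaryLayer.tendsto_exp_mul_apply h2 i)
      refine BoundaryLayer.not_isInflowEigenvalue_of_rowSolution hγ hl h1.isRowSolution (hlim 0)
        (BoundaryLayer.tendsto_zero_of_tendsto_mul (hlim 1))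
        (BoundaryLayer.tendsto_zero_of_tendsto_mul (hlim 2)) ?_
      rw [Ne, map_eq_zero]
      exact hne vp v0 vhat hl hv1 z (μ z) (V z) (W z) hz hz0 hμ (hV.ne_zero z hz) h1 h2
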